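/- **Setting.** Let $d\in\{2,3\}$, let $\Omega\subset\mathbb R^d$ be a (connected, bounded) polyhedral domain, $\partial\Omega=\partial_1\Omega\cup\partial_2\Omega$ a disjoint partition with outer normal $\vec{\rm n}$, and $\mathcal T^h$ a conforming partitioning of $\Omega$ into disjoint open simplices. Let $(\cdot,\cdot)$, $\|\cdot\|_0$ denote the $L^2(\Omega)$ inner product and norm. $\mathbb U^h$ is a space of continuous piecewise polynomial vector fields on $\mathcal T^h$ (of some fixed degree) with $\vec\varphi=\vec 0$ on $\partial_1\Omega$ and $\vec\varphi\cdot\vec{\rm n}=0$ on $\partial_2\Omega$. $\mathbb P^h(t)\subset L^2(\Omega)$, $t\in[0,T]$, are linear spaces that contain the constants, and $\widehat{\mathbb P}^h(t)=\{\varphi\in\mathbb P^h(t):\int_\Omega\varphi=0\}$. $\vec I_2^h$ is the continuous piecewise quadratic Lagrange interpolation operator on $\mathcal T^h$, $\vec f_1,\vec f_2\in L^2(0,T;[C(\overline\Omega)]^d)$ and $\vec f_i^h=\vec I_2^h\vec f_i$. *Data.* $\rho_\pm,\mu_\pm>0$; $\mu_\Gamma\in C(\mathbb R,\mathbb R_{\ge0})$,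 $\lambda_\Gamma\in C(\mathbb R)$ with $\lambda_\Gamma+\frac2{d-1}\mu_\Gamma\ge0$; $\mathcal D_\Gamma\ge0$; $\psi_\infty\in(0,\infty]$; $\gamma\in C^1([0,\psi_\infty))$ with $\gamma'\le0$; $F$ with $\gamma(r)=F(r)-rF'(r)$ on $(0,\psi_\infty)$ and $\lim_{r\to0}rF'(r)=F(0)-\gamma(0)=0$. For $\epsilon\in(0,\psi_\infty)$: $F_\epsilon(r)=F(r)$, $\gamma_\epsilon(r)=\gamma(r)$ for $r\ge\epsilon$, and $F_\epsilon(r)=F(\epsilon)+F'(\epsilon)(r-\epsilon)+\frac12F''(\epsilon)(r-\epsilon)^2$, $\gamma_\epsilon(r)=\gamma(\epsilon)+\frac12F''(\epsilon)(\epsilon^2-r^2)$ for $r<\epsilon$. *Surface.* For $t\in[0,T]$, $\Gamma^h(t)\subset\Omega$ is a closed polyhedral surface: a union of closed nondegenerate $(d-1)$-simplices $\overline{\sigma_j(t)}$, $j=1,\dots,J_\Gamma$, with vertices among $\vec q_k(t)$, $k=1,\dots,K_\Gamma$, with time independent connectivity; two simplices meet exactly in their common face, and every facet belongs to exactly two of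 them. $\Gamma^h(t)=\partial\Omega_-^h(t)$ for an open set $\Omega^h_-(t)$ with $\overline{\Omega_-^h(t)}\subset\Omega$, $\Omega_+^h(t)=\Omega\setminus\overline{\Omega_-^h(t)}$, and $\vec\nu^h$ is the piecewise constant unit normal pointing from $\Omega_-^h(t)$ into $\Omega_+^h(t)$. The $\vec q_k$ are absolutely continuous on $[0,T]$. $W(\Gamma^h(t))$ is the space of continuous functions on $\Gamma^h(t)$ that are affine on each simplex, with nodal basis $\chi_k^h(\cdot,t)$, $\underline V(\Gamma^h(t))=[W(\Gamma^h(t))]^d$, and $\pi^h,\vec\pi^h$ are the nodal interpolation operators. $\vec{\mathcal V}^h=\sum_k\dot{\vec q}_k\,\chi_k^h$; for $\zeta=\sum_k\zeta_k(t)\chi_k^h(\cdot,t)$, $\partial_t^{\circ,h}\zeta=\sum_k\dot\zeta_k\,\chi_k^h$; $W(\mathcal G_T^h)$ and $W_T(\mathcal G^h_T)$ are the spaces of such $\zeta$ with $\zeta_k\in C([0,T])$ and $\zeta_k\in C^1([0,T])$, respectively. $\langle\cdot,\cdot\rangle_{\Gamma^h(t)}$ is the $L^2$ inner product, and $\langle\eta,\zeta\rangle^h_{\Gamma^h(t)}=\frac1d\sum_j\mathcal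 H^{d-1}(\sigma_j)\sum_{k=1}^d(\eta\zeta)((\vec q_{j_k})^-)$ the mass lumped one, with limits at the vertices $\vec q_{j_k}$ of $\sigma_j$ taken from inside $\sigma_j$. $\nabla_s$ is the surface gradient, $(\nabla_s\vec\eta)_{il}=\partial_{s_l}\eta_i$, $\mathcal P=\mathrm{Id}-\vec\nu^h\otimes\vec\nu^h$, $D_s^h(\vec\eta)=\frac12\mathcal P(\nabla_s\vec\eta+(\nabla_s\vec\eta)^T)\mathcal P$, $\widehat D_s^h(\vec\eta)=D_s^h(\vec\eta)-\frac1{d-1}(\nabla_s\cdot\vec\eta)\mathcal P$, and $D(\vec u)=\frac12(\nabla\vec u+(\nabla\vec u)^T)$. *Coefficients.* $\rho^h(t)$ equals $\rho_-$ on elements contained in $\Omega_-^h(t)$, $\rho_+$ on elements contained in $\Omega_+^h(t)$, and $\frac12(\rho_-+\rho_+)$ on the elements that meet $\Gamma^h(t)$; $\mu^h(t)$ is defined in the same way from $\mu_\pm$. On $\sigma_j$, $\rho^h_{\Gamma,\star}$ is the mean value of $\rho_\Gamma^h$ over $\sigma_j$ if $\rho_\Gamma^h\ge0$ on $\overline{\sigma_j}$,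 and $0$ otherwise. If $d=3$, $\Psi^h_{\star,\epsilon}=\Psi^h$; if $d=2$, on a segment where $\Psi^h$ has the nodal values $a,b$, $\Psi^h_{\star,\epsilon}=-\frac{\gamma_\epsilon(b)-\gamma_\epsilon(a)}{F_\epsilon'(b)-F_\epsilon'(a)}$ if $F'_\epsilon(a)\ne F'_\epsilon(b)$, and $\frac12(a+b)$ otherwise. On $\sigma_j$ with vertices $\vec p_0,\dots,\vec p_{d-1}$, for $z\in W(\Gamma^h(t))$, $\Xi^h(z)=M^{-T}\,\mathrm{diag}\big(\frac12(z(\vec p_0)+z(\vec p_1)),\dots,\frac12(z(\vec p_0)+z(\vec p_{d-1})),0\big)\,M^T$, where the columns of $M$ are $\vec p_i-\vec p_0$, $i=1,\dots,d-1$, and a nonzero vector normal to $\sigma_j$. *Scheme.* A solution consists of $\Gamma^h(t)$ as above, $\rho_\Gamma^h,\Psi^h\in W_T(\mathcal G_T^h)$, $\kappa^h\in W(\mathcal G_T^h)$, $\vec U^h\in H^1(0,T;\mathbb U^h)$ such that $\vec\pi^h[\vec U^h|_{\Gamma^h(t)}]$ defines an element of $[W_T(\mathcal G_T^h)]^d$,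 and $P^h\in L^2(0,T;L^2(\Omega))$ with $P^h(t)\in\widehat{\mathbb P}^h(t)$ for a.e. $t$, such that for almost all $t\in(0,T)$ (the derivatives $\frac{\rm d}{{\rm d}t}$ existing), with $\langle\cdot,\cdot\rangle^{(h)}=\langle\cdot,\cdot\rangle^{(h)}_{\Gamma^h(t)}$, (a) $\frac{\rm d}{{\rm d}t}\langle\rho_\Gamma^h,\zeta\rangle^h=\langle\rho_\Gamma^h,\partial_t^{\circ,h}\zeta\rangle^h-\langle\rho^h_{\Gamma,\star},(\vec{\mathcal V}^h-\vec U^h)\cdot\nabla_s\zeta\rangle^h$ for all $\zeta\in W_T(\mathcal G_T^h)$; (b) for all $\vec\xi\in H^1(0,T;\mathbb U^h)$, $$\begin{aligned}&\tfrac12\big[\tfrac{\rm d}{{\rm d}t}(\rho^h\vec U^h,\vec\xi)+(\rho^h\vec U^h_t,\vec\xi)-(\rho^h\vec U^h,\vec\xi_t)\big]+2(\mu^hD(\vec U^h),D(\vec\xi))\\&+\tfrac12\big(\rho^h,[(\vec I_2^h\vec U^h\cdot\nabla)\vec U^h]\cdot\vec\xi-[(\vec I_2^h\vec U^h\cdot\nabla)\vec\xi]\cdot\vec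 U^h\big)-(P^h,\nabla\cdot\vec\xi)+\tfrac{\rm d}{{\rm d}t}\langle\rho_\Gamma^h\vec U^h,\vec\xi\rangle^h\\&+2\langle\mu_\Gamma(\Psi^h)D_s^h(\vec\pi^h\vec U^h),D_s^h(\vec\pi^h\vec\xi)\rangle^h+\langle\lambda_\Gamma(\Psi^h)\nabla_s\cdot(\vec\pi^h\vec U^h),\nabla_s\cdot(\vec\pi^h\vec\xi)\rangle^h\\&-\langle\pi^h[\gamma_\epsilon(\Psi^h)\kappa^h]\vec\nu^h,\vec\xi\rangle-\langle\nabla_s[\pi^h\gamma_\epsilon(\Psi^h)],\vec\xi\rangle^h\\&=(\rho^h\vec f_1^h+\vec f_2^h,\vec\xi)+\langle\rho_\Gamma^h\vec U^h,\partial_t^{\circ,h}(\vec\pi^h\vec\xi)\rangle^h-\sum_{i=1}^d\langle\rho^h_{\Gamma,\star}(\vec{\mathcal V}^h-\vec U^h),\Xi^h(\pi^hU_i^h)\nabla_s(\pi^h\xi_i)\rangle^h;\end{aligned}$$ (c) $(\nabla\cdot\vec U^h,\varphi)=0$ for all $\varphi\in\widehat{\mathbb P}^h(t)$; (d) $\langle\vec{\mathcal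 V}^h,\chi\vec\nu^h\rangle^h=\langle\vec U^h,\chi\vec\nu^h\rangle$ for all $\chi\in W(\Gamma^h(t))$; (e) $\langle\kappa^h\vec\nu^h,\vec\eta\rangle^h+\langle\nabla_s\vec{\rm id},\nabla_s\vec\eta\rangle=0$ for all $\vec\eta\in\underline V(\Gamma^h(t))$; (f) $\frac{\rm d}{{\rm d}t}\langle\Psi^h,\chi\rangle^h+\mathcal D_\Gamma\langle\nabla_s\Psi^h,\nabla_s\chi\rangle=\langle\Psi^h,\partial_t^{\circ,h}\chi\rangle^h-\langle\Psi^h_{\star,\epsilon},(\vec{\mathcal V}^h-\vec U^h)\cdot\nabla_s\chi\rangle^h$ for all $\chi\in W_T(\mathcal G_T^h)$. **Theorem 3.7.** Let $(\Gamma^h,\rho_\Gamma^h,\vec U^h,P^h,\kappa^h,\Psi^h)$ be a solution of (a)–(f). 1. $\frac{\rm d}{{\rm d}t}\langle\Psi^h,1\rangle_{\Gamma^h(t)}=0$ for a.e. $t\in(0,T)$, and $\langle\Psi^h,1\rangle_{\Gamma^h(t)}$ is constant on $[0,T]$. 2. For a.e. $t\in(0,T)$: if the characteristic function of $\Omega_-^h(t)$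 belongs to $\mathbb P^h(t)$, then $\frac{\rm d}{{\rm d}t}\mathcal L^d(\Omega_-^h(t))=0$. If this membership holds for a.e. $t$, then $\mathcal L^d(\Omega_-^h(t))$ is constant on $[0,T]$. 3. If $d=2$ and $\Psi^h(\cdot,t)<\psi_\infty$ on $\Gamma^h(t)$ for all $t\in[0,T]$, then for a.e. $t\in(0,T)$ the following time derivative exists and $$\begin{aligned}&\tfrac{\rm d}{{\rm d}t}\Big(\tfrac12\|[\rho^h]^{1/2}\vec U^h\|_0^2+\tfrac12\langle\rho_\Gamma^h\vec U^h,\vec U^h\rangle^h_{\Gamma^h(t)}+\langle F_\epsilon(\Psi^h),1\rangle^h_{\Gamma^h(t)}\Big)+2\|[\mu^h]^{1/2}D(\vec U^h)\|_0^2\\&+2\langle\mu_\Gamma(\Psi^h)\widehat D_s^h(\vec\pi^h\vec U^h),\widehat D_s^h(\vec\pi^h\vec U^h)\rangle^h_{\Gamma^h(t)}\\&+\langle(\lambda_\Gamma(\Psi^h)+\tfrac2{d-1}\mu_\Gamma(\Psi^h))\nabla_s\cdot(\vec\pi^h\vec U^h),\nabla_s\cdot(\vec\pi^h\vec U^h)\rangle^h_{\Gamma^h(t)}\le(\rho^h\vec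 f_1^h+\vec f_2^h,\vec U^h).\end{aligned}$$ -/

import Mathlib

open MeasureTheory Set Filter Topology
open scoped BoundedContinuousFunction Matrix

namespace SurfFlow

noncomputable section

/-! ### Simplices in `ℝ^d`, `d = n + 1` -/

/-- `ℝ^d` with the Euclidean norm, where `d = n + 1`. -/
abbrev Vec (n : ℕ) := EuclideanSpace ℝ (Fin (n + 1))

/-- The generalized cross product of the edge vectors `p_1 - p_0, …, p_{d-1} - p_0` of a
`(d-1)`-simplex: the vector `N` with `N ⬝ w = det (w, p_1 - p_0, …, p_{d-1} - p_0)` for all `w`.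
It is orthogonal to the simplex, and `|N|` is the volume of the parallelotope that the edge
vectors span. -/
def normalVec {n : ℕ} (p : Fin (n + 1) → Vec n) : Vec n :=
  WithLp.toLp 2 fun i =>
    Matrix.det (Matrix.of (Fin.cons (α := fun _ => Fin (n + 1) → ℝ) (Pi.single i 1)
      fun k : Fin n => (p k.succ - p 0).ofLp))

/-- The `(d-1)`-dimensional measure `H^{d-1}(σ)` of the simplex with vertices `p`
(length of a segment if `d = 2`, area of a triangle if `d = 3`). -/
def area {n : ℕ} (p : Fin (n + 1) → Vec n) : ℝ := ‖normalVec p‖ / (n.factorial : ℝ)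

/-- The unit normal of the simplex, oriented by the order of its vertices. -/
def unitNormal {n : ℕ} (p : Fin (n + 1) → Vec n) : Vec n := ‖normalVec p‖⁻¹ • normalVec p

/-- The closed reference simplex in `ℝ^{d-1}`. -/
def refSimplex (n : ℕ) : Set (Fin n → ℝ) := {y | (∀ i, 0 ≤ y i) ∧ ∑ i, y i ≤ 1}

/-- Barycentric coordinates of a point of the reference simplex. -/
def bary {n : ℕ} (y : Fin n → ℝ) : Fin (n + 1) → ℝ :=
  Fin.cons (α := fun _ => ℝ) (1 - ∑ i, y i) y

/-- The value of the affine function with nodal values `z` at the point of a simplex with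
barycentric coordinates `l`. -/
def lin {n : ℕ} {α : Type*} [AddCommGroup α] [Module ℝ α] (z : Fin (n + 1) → α)
    (l : Fin (n + 1) → ℝ) : α := ∑ k, l k • z k

/-- The surface integral over the simplex with vertices `p`, with respect to `H^{d-1}`, of a
function given in barycentric coordinates (transformation to the reference simplex; the
surface element of the affine parameterization is `‖normalVec p‖`). -/
def simplexInt {n : ℕ} (p : Fin (n + 1) → Vec n) (g : (Fin (n + 1) → ℝ) → ℝ) : ℝ :=
  ‖normalVec p‖ * ∫ y in refSimplex n, g (bary y)

/-- The relatively open simplex with vertices `p`. -/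
def openSimplex {n : ℕ} (p : Fin (n + 1) → Vec n) : Set (Vec n) :=
  {x | ∃ l : Fin (n + 1) → ℝ, (∀ k, 0 < l k) ∧ ∑ k, l k = 1 ∧ x = lin p l}

/-- The transposed matrix `M_σ^T` of the affine map from the reference simplex: its rows are a
normal vector and the edge vectors `p_i - p_0`. -/
def frameT {n : ℕ} (p : Fin (n + 1) → Vec n) : Matrix (Fin (n + 1)) (Fin (n + 1)) ℝ :=
  Matrix.of (Fin.cons (α := fun _ => Fin (n + 1) → ℝ) (normalVec p).ofLp
    fun k : Fin n => (p k.succ - p 0).ofLp)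

/-- The (constant) surface gradient of the affine function on the simplex `p` with nodal values
`z`: the tangential vector `g` with `g ⬝ (p_i - p_0) = z_i - z_0`. -/
def surfGrad {n : ℕ} (p : Fin (n + 1) → Vec n) (z : Fin (n + 1) → ℝ) : Vec n :=
  WithLp.toLp 2 ((frameT p)⁻¹ *ᵥ
    Fin.cons (α := fun _ => ℝ) 0 fun k : Fin n => z k.succ - z 0)

/-- `∇_s η = (∂_{s_l} η_i)_{i,l}` for the affine vector field with nodal values `η`. -/
def surfJac {n : ℕ} (p : Fin (n + 1) → Vec n) (η : Fin (n + 1) → Vec n) :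
    Matrix (Fin (n + 1)) (Fin (n + 1)) ℝ :=
  Matrix.of fun i l => surfGrad p (fun k => η k i) l

/-- The surface divergence `∇_s . η`. -/
def surfDiv {n : ℕ} (p : Fin (n + 1) → Vec n) (η : Fin (n + 1) → Vec n) : ℝ :=
  (surfJac p η).trace

/-- The tangential projection `Id - ν ⊗ ν`. -/
def tangProj {n : ℕ} (p : Fin (n + 1) → Vec n) : Matrix (Fin (n + 1)) (Fin (n + 1)) ℝ :=
  1 - Matrix.vecMulVec (unitNormal p).ofLp (unitNormal p).ofLp

/-- The surface rate-of-deformation tensor `D_s^h(η)`. -/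
def surfD {n : ℕ} (p : Fin (n + 1) → Vec n) (η : Fin (n + 1) → Vec n) :
    Matrix (Fin (n + 1)) (Fin (n + 1)) ℝ :=
  (1 / 2 : ℝ) • (tangProj p * (surfJac p η + (surfJac p η)ᵀ) * tangProj p)

/-- The deviatoric part of `D_s^h(η)`; note that `n = d - 1`. -/
def surfDdev {n : ℕ} (p : Fin (n + 1) → Vec n) (η : Fin (n + 1) → Vec n) :
    Matrix (Fin (n + 1)) (Fin (n + 1)) ℝ :=
  surfD p η - ((1 / (n : ℝ)) * surfDiv p η) • tangProj p

/-- The inner product `A : B` of matrices. -/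
def frob {n : ℕ} (A B : Matrix (Fin (n + 1)) (Fin (n + 1)) ℝ) : ℝ := ∑ i, ∑ l, A i l * B i l

/-- The matrix `Ξ^h(z)` on the simplex `p`, for the affine function with nodal values `z`. -/
def xiMat {n : ℕ} (p : Fin (n + 1) → Vec n) (z : Fin (n + 1) → ℝ) :
    Matrix (Fin (n + 1)) (Fin (n + 1)) ℝ :=
  (frameT p)⁻¹ * Matrix.diagonal (Fin.cons (α := fun _ => ℝ) 0
    fun k : Fin n => (1 / 2 : ℝ) * (z 0 + z k.succ)) * frameT p

/-- `e` is the outer unit normal of the set `A` at the (flat) boundary point `x`: near `x`, the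
set is the open half space that `e` points out of. -/
def IsOuterNormal {n : ℕ} (A : Set (Vec n)) (x e : Vec n) : Prop :=
  ‖e‖ = 1 ∧ ∃ r > 0, ∀ y ∈ Metric.ball x r, y ∈ A ↔ inner ℝ (y - x) e < 0

/-! ### Bulk mesh and finite element spaces -/

/-- A regular (conforming) partitioning into `d`-simplices; a nondegenerate `d`-simplex is given
by its vertices, an affine basis of `ℝ^d`. -/
structure BulkMesh (n : ℕ) where
  J : ℕ
  elem : Fin J → AffineBasis (Fin (n + 2)) ℝ (Vec n)
  distinct : Function.Injective fun j => Set.range (elem j)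
  disjoint : ∀ i j, i ≠ j → Disjoint (interior (convexHull ℝ (Set.range (elem i))))
    (interior (convexHull ℝ (Set.range (elem j))))
  conforming : ∀ i j, convexHull ℝ (Set.range (elem i)) ∩ convexHull ℝ (Set.range (elem j)) =
    convexHull ℝ (Set.range (elem i) ∩ Set.range (elem j))
  connected : IsConnected (interior (⋃ j, convexHull ℝ (Set.range (elem j))))

/-- The closed element. -/
def BulkMesh.closedElem {n : ℕ} (M : BulkMesh n) (j : Fin M.J) : Set (Vec n) :=
  convexHull ℝ (Set.range (M.elem j))

/-- The open element `o_j`. -/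
def BulkMesh.openElem {n : ℕ} (M : BulkMesh n) (j : Fin M.J) : Set (Vec n) :=
  interior (M.closedElem j)

/-- The polyhedral domain `Ω` partitioned by the mesh. -/
def BulkMesh.domain {n : ℕ} (M : BulkMesh n) : Set (Vec n) :=
  interior (⋃ j, M.closedElem j)

/-- `[S_k^h]^d`: continuous on `closure Ω`, and on every element each component is a polynomial
of degree at most `k`. -/
def BulkMesh.IsFE {n : ℕ} (M : BulkMesh n) (k : ℕ) (u : Vec n → Vec n) : Prop :=
  ContinuousOn u (closure M.domain) ∧
  ∀ (j : Fin M.J) (i : Fin (n + 1)), ∃ p : MvPolynomial (Fin (n + 1)) ℝ,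
    p.totalDegree ≤ k ∧ ∀ x ∈ M.closedElem j, u x i = MvPolynomial.eval (fun l => x l) p

/-- The quadratic Lagrange interpolant on one simplex, with nodes at the vertices and at the
midpoints of the edges, in terms of barycentric coordinates. -/
def quadInterp {n : ℕ} (b : AffineBasis (Fin (n + 2)) ℝ (Vec n)) (η : Vec n → Vec n)
    (x : Vec n) : Vec n :=
  (∑ i, (b.coord i x * (2 * b.coord i x - 1)) • η (b i)) +
  ∑ i, ∑ j with i < j, (4 * b.coord i x * b.coord j x) • η (midpoint ℝ (b i) (b j))

open Classical in
/-- The standard interpolation operator `I_2^h` onto `[S_2^h]^d` (`0` outside `closure Ω`). On a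
face shared by several elements the local interpolants agree, so the choice is irrelevant. -/
def BulkMesh.interp2 {n : ℕ} (M : BulkMesh n) (η : Vec n → Vec n) (x : Vec n) : Vec n :=
  if h : ∃ j, x ∈ M.closedElem j then quadInterp (M.elem h.choose) η x else 0

/-- `∇ u = (∂_{x_l} u_i)_{i,l}`. -/
def jac {n : ℕ} (u : Vec n → Vec n) (x : Vec n) : Matrix (Fin (n + 1)) (Fin (n + 1)) ℝ :=
  Matrix.of fun i l => fderiv ℝ u x (EuclideanSpace.single l 1) i

/-- The rate-of-deformation tensor `D(u)`. -/
def symGrad {n : ℕ} (u : Vec n → Vec n) (x : Vec n) : Matrix (Fin (n + 1)) (Fin (n + 1)) ℝ :=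
  (1 / 2 : ℝ) • (jac u x + (jac u x)ᵀ)

/-- The divergence `∇ . u`. -/
def divg {n : ℕ} (u : Vec n → Vec n) (x : Vec n) : ℝ := (jac u x).trace

open Classical in
/-- The value on an element `o ⊆ Ω` of the discrete density or viscosity, for the values `a` in
the inner phase `Om` and `b` in the outer phase `Ω \ closure Om`; the last case is that of an
element that meets the interface. -/
def elemCoeff {n : ℕ} (a b : ℝ) (Ω Om o : Set (Vec n)) : ℝ :=
  if o ⊆ Om then a else if o ⊆ Ω \ closure Om then b else (a + b) / 2

/-- The piecewise constant function on the mesh with the values `elemCoeff`. -/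
def BulkMesh.coeff {n : ℕ} (M : BulkMesh n) (a b : ℝ) (Om : Set (Vec n)) (x : Vec n) : ℝ :=
  ∑ j, (M.openElem j).indicator (fun _ => elemCoeff a b M.domain Om (M.openElem j)) x

/-- Extension by zero of a continuous function on `closure Ω`. -/
def extendZero {n : ℕ} {A : Set (Vec n)} (f : A →ᵇ Vec n) (x : Vec n) : Vec n :=
  open Classical in if h : x ∈ A then f ⟨x, h⟩ else 0

/-- Domain, time interval, discrete spaces and forcing. -/
structure Setup (n : ℕ) where
  mesh : BulkMesh n
  T : ℝ
  T_pos : 0 < T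
  /-- the no-slip part of the boundary -/
  bdry1 : Set (Vec n)
  /-- the free-slip part of the boundary -/
  bdry2 : Set (Vec n)
  bdry_union : bdry1 ∪ bdry2 = frontier mesh.domain
  bdry_disjoint : Disjoint bdry1 bdry2
  /-- polynomial degree of the velocity space -/
  deg : ℕ
  /-- the velocity space, a finite element space contained in `𝕌` -/
  Uh : Submodule ℝ (Vec n → Vec n)
  Uh_fe : ∀ u ∈ Uh, mesh.IsFE deg u
  Uh_noslip : ∀ u ∈ Uh, ∀ x ∈ bdry1, u x = 0
  Uh_freeslip : ∀ u ∈ Uh, ∀ x ∈ bdry2, ∀ e, IsOuterNormal mesh.domain x e → inner ℝ (u x) e = 0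
  /-- the (time dependent) pressure spaces, subspaces of `L²(Ω)` that contain the constants -/
  Ph : ℝ → Submodule ℝ (Lp ℝ 2 (volume.restrict mesh.domain))
  Ph_const : ∀ t ∈ Icc 0 T, ∃ φ ∈ Ph t, ∀ᵐ x ∂(volume.restrict mesh.domain), φ x = 1
  /-- the forcing `f = ρ f₁ + f₂`, with `f₁, f₂ ∈ L²(0,T;[C(closure Ω)]^d)` -/
  f1 : ℝ → (closure mesh.domain →ᵇ Vec n)
  f2 : ℝ → (closure mesh.domain →ᵇ Vec n)
  f1_mem : MemLp f1 2 (volume.restrict (Ioo 0 T))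
  f2_mem : MemLp f2 2 (volume.restrict (Ioo 0 T))

/-- The domain `Ω`. -/
abbrev Setup.Ω {n : ℕ} (S : Setup n) : Set (Vec n) := S.mesh.domain

/-- `H¹(0,T;𝕌^h)`. As `𝕌^h` is a space of finite element functions, which is finite dimensional
on `closure Ω`, membership can be tested pointwise. -/
def Setup.MemH1 {n : ℕ} (S : Setup n) (u : ℝ → Vec n → Vec n) : Prop :=
  (∀ t ∈ Icc 0 S.T, u t ∈ S.Uh) ∧
  ∀ x ∈ closure S.Ω, AbsolutelyContinuousOnInterval (fun t => u t x) 0 S.T ∧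
    MemLp (deriv fun t => u t x) 2 (volume.restrict (Ioo 0 S.T))

/-- The time derivative `u_t`. -/
def timeDeriv {n : ℕ} (u : ℝ → Vec n → Vec n) (t : ℝ) (x : Vec n) : Vec n :=
  deriv (fun s => u s x) t

/-! ### Physical data -/

/-- Densities, viscosities, surface tension, and surface energy. The function `γ` matters only
on `[0,ψ_∞)` and `F` only on `[0,ψ_∞)`, where `ψ_∞ ∈ (0,∞]`. -/
structure Phys (n : ℕ) where
  rhoM : ℝ
  rhoP : ℝ
  muM : ℝ
  muP : ℝ
  rhoM_pos : 0 < rhoM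
  rhoP_pos : 0 < rhoP
  muM_pos : 0 < muM
  muP_pos : 0 < muP
  /-- the interfacial shear viscosity `μ_Γ` -/
  muS : ℝ → ℝ
  /-- the second interfacial viscosity coefficient `λ_Γ` -/
  lamS : ℝ → ℝ
  muS_cont : Continuous muS
  lamS_cont : Continuous lamS
  muS_nonneg : ∀ r, 0 ≤ muS r
  lam_mu : ∀ r, 0 ≤ lamS r + 2 / (n : ℝ) * muS r
  /-- the surfactant diffusion coefficient `𝒟_Γ` -/
  diff : ℝ
  diff_nonneg : 0 ≤ diff
  psiInf : EReal
  psiInf_pos : 0 < psiInf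
  gam : ℝ → ℝ
  gam_smooth : ContDiffOn ℝ 1 gam {r : ℝ | 0 ≤ r ∧ (r : EReal) < psiInf}
  gam_anti : ∀ r : ℝ, 0 ≤ r → (r : EReal) < psiInf →
    derivWithin gam {r : ℝ | 0 ≤ r ∧ (r : EReal) < psiInf} r ≤ 0
  F : ℝ → ℝ
  F_diff : ∀ r : ℝ, 0 < r → (r : EReal) < psiInf → DifferentiableAt ℝ F r
  F_eq : ∀ r : ℝ, 0 < r → (r : EReal) < psiInf → gam r = F r - r * deriv F r
  F_zero : F 0 - gam 0 = 0
  F_lim : Tendsto (fun r => r * deriv F r) (𝓝[>] 0) (𝓝 0)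
  /-- the regularization parameter `ε` -/
  eps : ℝ
  eps_pos : 0 < eps
  eps_lt : (eps : EReal) < psiInf

/-- The regularized energy `F_ε`. -/
def Phys.Feps {n : ℕ} (D : Phys n) (r : ℝ) : ℝ :=
  if D.eps ≤ r then D.F r
  else D.F D.eps + deriv D.F D.eps * (r - D.eps)
    + 1 / 2 * deriv (deriv D.F) D.eps * (r - D.eps) ^ 2

/-- The regularized surface tension `γ_ε`. -/
def Phys.gamEps {n : ℕ} (D : Phys n) (r : ℝ) : ℝ :=
  if D.eps ≤ r then D.gam r
  else D.gam D.eps + 1 / 2 * deriv (deriv D.F) D.eps * (D.eps ^ 2 - r ^ 2)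

open Classical in
/-- `Ψ^h_{⋆,ε}` at the `k`-th vertex of a simplex on which `Ψ^h` has the nodal values `z`: for
`d = 2` a constant on each segment, for `d = 3` simply `Ψ^h`. -/
def Phys.psiStar {n : ℕ} (D : Phys n) (z : Fin (n + 1) → ℝ) (k : Fin (n + 1)) : ℝ :=
  if n = 1 then
    if deriv D.Feps (z 0) ≠ deriv D.Feps (z (Fin.last n)) then
      -((D.gamEps (z (Fin.last n)) - D.gamEps (z 0)) /
        (deriv D.Feps (z (Fin.last n)) - deriv D.Feps (z 0)))
    else 1 / 2 * (z 0 + z (Fin.last n))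
  else z k

/-! ### The evolving polyhedral surface -/

/-- The (time independent) combinatorial structure of a closed polyhedral surface with `K`
vertices and `J` simplices. Every facet of a simplex is shared with exactly one other simplex. -/
structure SurfMesh (n J K : ℕ) where
  vert : Fin J → Fin (n + 1) → Fin K
  vert_inj : ∀ j, Function.Injective (vert j)
  distinct : Function.Injective fun j => Set.range (vert j)
  covers : ∀ k, ∃ j i, vert j i = k
  closed : ∀ j i, ∃! j', j' ≠ j ∧ ∀ l, l ≠ i → vert j l ∈ Set.range (vert j')

variable {n J K : ℕ}

/-- The restriction of nodal values to the vertices of the simplex `σ_j`. For the vertex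
positions `q` this gives the vertices of `σ_j`. -/
def SurfMesh.loc {α : Type*} (m : SurfMesh n J K) (z : Fin K → α) (j : Fin J) :
    Fin (n + 1) → α := fun k => z (m.vert j k)

/-- The polyhedral surface `Γ^h` with vertex positions `q`. -/
def SurfMesh.surface (m : SurfMesh n J K) (q : Fin K → Vec n) : Set (Vec n) :=
  ⋃ j, convexHull ℝ (Set.range (m.loc q j))

/-- The integral over `Γ^h` of a function given on each simplex in barycentric coordinates. -/
def SurfMesh.surfInt (m : SurfMesh n J K) (q : Fin K → Vec n)
    (g : Fin J → (Fin (n + 1) → ℝ) → ℝ) : ℝ :=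
  ∑ j, simplexInt (m.loc q j) (g j)

/-- The mass lumped integral over `Γ^h` of a piecewise continuous function; `g j k` is its limit
at the `k`-th vertex of `σ_j` from inside `σ_j`. -/
def SurfMesh.lumped (m : SurfMesh n J K) (q : Fin K → Vec n)
    (g : Fin J → Fin (n + 1) → ℝ) : ℝ :=
  1 / ((n : ℝ) + 1) * ∑ j, area (m.loc q j) * ∑ k, g j k

/-- `Γ ⊂ Ω` is a polyhedral surface (nondegenerate simplices, any two of which meet exactly in
their common face) which bounds the inner phase `Om`, and the vertices of the simplices are
numbered such that the unit normals point out of `Om`. -/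
structure SurfMesh.IsInterface (m : SurfMesh n J K) (Ω : Set (Vec n)) (q : Fin K → Vec n)
    (Om : Set (Vec n)) : Prop where
  nondegenerate : ∀ j, AffineIndependent ℝ (m.loc q j)
  conforming : ∀ i j, convexHull ℝ (Set.range (m.loc q i)) ∩
    convexHull ℝ (Set.range (m.loc q j)) =
      convexHull ℝ (q '' (Set.range (m.vert i) ∩ Set.range (m.vert j)))
  isOpen : IsOpen Om
  subset : closure Om ⊆ Ω
  frontier_eq : frontier Om = m.surface q
  normal : ∀ j, ∀ x ∈ openSimplex (m.loc q j), IsOuterNormal Om x (unitNormal (m.loc q j))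

open Classical in
/-- `ρ^h_{Γ,⋆}` on the simplex `p`, on which `ρ^h_Γ` has the nodal values `z`. -/
def rhoStar (p : Fin (n + 1) → Vec n) (z : Fin (n + 1) → ℝ) : ℝ :=
  if ∀ l ∈ stdSimplex ℝ (Fin (n + 1)), 0 ≤ lin z l then
    1 / area p * simplexInt p (lin z)
  else 0

/-- The unknowns `(Γ^h, ρ_Γ^h, U^h, P^h, κ^h, Ψ^h)(t)`. The surface is given by its vertices
`q_k(t)` (and `Om t` is its interior `Ω_-^h(t)`), and continuous piecewise linear functions on it
by their nodal values. -/
structure State (S : Setup n) (K : ℕ) where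
  q : ℝ → Fin K → Vec n
  Om : ℝ → Set (Vec n)
  rhoG : ℝ → Fin K → ℝ
  U : ℝ → Vec n → Vec n
  P : ℝ → Lp ℝ 2 (volume.restrict S.Ω)
  kap : ℝ → Fin K → ℝ
  Psi : ℝ → Fin K → ℝ

/-- The nodal values of `𝒱^h(·,t)`. -/
def State.V {S : Setup n} (X : State S K) (t : ℝ) (k : Fin K) : Vec n :=
  deriv (fun s => X.q s k) t

/-- The nodal values of `π^h u` for a bulk function `u`. -/
def State.nodal {S : Setup n} (X : State S K) (t : ℝ) (u : Vec n → Vec n) (k : Fin K) : Vec n :=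
  u (X.q t k)

/-- The discrete density `ρ^h(t)`. -/
def State.rhoh {S : Setup n} (X : State S K) (D : Phys n) (t : ℝ) : Vec n → ℝ :=
  S.mesh.coeff D.rhoM D.rhoP (X.Om t)

/-- The discrete viscosity `μ^h(t)`. -/
def State.muh {S : Setup n} (X : State S K) (D : Phys n) (t : ℝ) : Vec n → ℝ :=
  S.mesh.coeff D.muM D.muP (X.Om t)

/-- `(ρ^h f_1^h + f_2^h, ξ)` with `f_i^h = I_2^h f_i`. -/
def State.forcing {S : Setup n} (X : State S K) (D : Phys n) (t : ℝ) (ξ : Vec n → Vec n) : ℝ :=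
  ∫ x in S.Ω, inner ℝ (X.rhoh D t x • S.mesh.interp2 (extendZero (S.f1 t)) x
    + S.mesh.interp2 (extendZero (S.f2 t)) x) (ξ x)

/-- `⟨ρ_Γ^h u, ξ⟩^h` at time `t`. -/
def State.surfMom {S : Setup n} (X : State S K) (m : SurfMesh n J K) (t : ℝ)
    (u ξ : Vec n → Vec n) : ℝ :=
  m.lumped (X.q t) fun j k =>
    m.loc (X.rhoG t) j k * inner ℝ (m.loc (X.nodal t u) j k) (m.loc (X.nodal t ξ) j k)

/-- `W_T(𝒢_T^h)` in nodal values: as the basis functions are transported by the motion of the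
surface, `∂_t^{∘,h}` is the differentiation of the nodal values. -/
def MemWT (T : ℝ) (ζ : ℝ → Fin K → ℝ) : Prop := ContDiffOn ℝ 1 ζ (Icc 0 T)

/-- The momentum equation with test function `ξ` at time `t`, including the existence of the two
time derivatives that occur in it. -/
def State.Momentum {S : Setup n} (X : State S K) (D : Phys n) (m : SurfMesh n J K)
    (ξ : ℝ → Vec n → Vec n) (t : ℝ) : Prop :=
  ∃ a b : ℝ,
    HasDerivAt (fun s => ∫ x in S.Ω, X.rhoh D s x * inner ℝ (X.U s x) (ξ s x)) a t ∧
    HasDerivAt (fun s => X.surfMom m s (X.U s) (ξ s)) b t ∧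
    1 / 2 * (a + (∫ x in S.Ω, X.rhoh D t x * inner ℝ (timeDeriv X.U t x) (ξ t x))
        - ∫ x in S.Ω, X.rhoh D t x * inner ℝ (X.U t x) (timeDeriv ξ t x))
      + 2 * (∫ x in S.Ω, X.muh D t x * frob (symGrad (X.U t) x) (symGrad (ξ t) x))
      + 1 / 2 * (∫ x in S.Ω, X.rhoh D t x *
          (inner ℝ (fderiv ℝ (X.U t) x (S.mesh.interp2 (X.U t) x)) (ξ t x)
            - inner ℝ (fderiv ℝ (ξ t) x (S.mesh.interp2 (X.U t) x)) (X.U t x)))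
      - (∫ x in S.Ω, X.P t x * divg (ξ t) x)
      + b
      + 2 * m.lumped (X.q t) (fun j k => D.muS (m.loc (X.Psi t) j k) *
          frob (surfD (m.loc (X.q t) j) (m.loc (X.nodal t (X.U t)) j))
            (surfD (m.loc (X.q t) j) (m.loc (X.nodal t (ξ t)) j)))
      + m.lumped (X.q t) (fun j k => D.lamS (m.loc (X.Psi t) j k) *
          (surfDiv (m.loc (X.q t) j) (m.loc (X.nodal t (X.U t)) j) *
            surfDiv (m.loc (X.q t) j) (m.loc (X.nodal t (ξ t)) j)))
      - m.surfInt (X.q t) (fun j l =>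
          lin (m.loc (fun k => D.gamEps (X.Psi t k) * X.kap t k) j) l *
            inner ℝ (unitNormal (m.loc (X.q t) j)) (ξ t (lin (m.loc (X.q t) j) l)))
      - m.lumped (X.q t) (fun j k =>
          inner ℝ (surfGrad (m.loc (X.q t) j) (m.loc (fun k => D.gamEps (X.Psi t k)) j))
            (m.loc (X.nodal t (ξ t)) j k))
    = X.forcing D t (ξ t)
      + m.lumped (X.q t) (fun j k => m.loc (X.rhoG t) j k *
          inner ℝ (m.loc (X.nodal t (X.U t)) j k)
            (m.loc (fun k => deriv (fun s => X.nodal s (ξ s) k) t) j k))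
      - ∑ i : Fin (n + 1), m.lumped (X.q t) (fun j k =>
          rhoStar (m.loc (X.q t) j) (m.loc (X.rhoG t) j) *
            inner ℝ (m.loc (X.V t) j k - m.loc (X.nodal t (X.U t)) j k)
              (WithLp.toLp 2
                (xiMat (m.loc (X.q t) j) (m.loc (fun k => X.nodal t (X.U t) k i) j) *ᵥ
                  (surfGrad (m.loc (X.q t) j)
                    (m.loc (fun k => X.nodal t (ξ t) k i) j)).ofLp)))

/-- Solutions of the semi-discrete scheme with implicit tangential mesh motion. -/
structure State.IsSolution {S : Setup n} (X : State S K) (D : Phys n) (m : SurfMesh n J K) :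
    Prop where
  /-- the vertices move absolutely continuously in time -/
  q_ac : ∀ k, AbsolutelyContinuousOnInterval (fun t => X.q t k) 0 S.T
  interface : ∀ t ∈ Icc 0 S.T, m.IsInterface S.Ω (X.q t) (X.Om t)
  rhoG_mem : MemWT S.T X.rhoG
  U_mem : S.MemH1 X.U
  U_trace : ∀ k, ContDiffOn ℝ 1 (fun t => X.U t (X.q t k)) (Icc 0 S.T)
  P_mem : MemLp X.P 2 (volume.restrict (Ioo 0 S.T))
  P_mem_Ph : ∀ᵐ t ∂(volume.restrict (Ioo 0 S.T)), X.P t ∈ S.Ph t ∧ ∫ x in S.Ω, X.P t x = 0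
  kap_mem : ContinuousOn X.kap (Icc 0 S.T)
  Psi_mem : MemWT S.T X.Psi
  /-- transport of the surface material density -/
  eq_a : ∀ ζ : ℝ → Fin K → ℝ, MemWT S.T ζ → ∀ᵐ t ∂(volume.restrict (Ioo 0 S.T)),
    HasDerivAt (fun s => m.lumped (X.q s) fun j k => m.loc (X.rhoG s) j k * m.loc (ζ s) j k)
      (m.lumped (X.q t) (fun j k =>
          m.loc (X.rhoG t) j k * m.loc (fun k => deriv (fun s => ζ s k) t) j k)
        - m.lumped (X.q t) (fun j k => rhoStar (m.loc (X.q t) j) (m.loc (X.rhoG t) j) *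
            inner ℝ (m.loc (X.V t) j k - m.loc (X.nodal t (X.U t)) j k)
              (surfGrad (m.loc (X.q t) j) (m.loc (ζ t) j)))) t
  /-- momentum equation -/
  eq_b : ∀ ξ : ℝ → Vec n → Vec n, S.MemH1 ξ →
    ∀ᵐ t ∂(volume.restrict (Ioo 0 S.T)), X.Momentum D m ξ t
  /-- incompressibility -/
  eq_c : ∀ᵐ t ∂(volume.restrict (Ioo 0 S.T)), ∀ φ ∈ S.Ph t, ∫ x in S.Ω, φ x = 0 →
    ∫ x in S.Ω, divg (X.U t) x * φ x = 0
  /-- the normal velocity of the surface -/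
  eq_d : ∀ᵐ t ∂(volume.restrict (Ioo 0 S.T)), ∀ χ : Fin K → ℝ,
    m.lumped (X.q t) (fun j k =>
        inner ℝ (m.loc (X.V t) j k) (m.loc χ j k • unitNormal (m.loc (X.q t) j)))
      = m.surfInt (X.q t) (fun j l =>
        inner ℝ (X.U t (lin (m.loc (X.q t) j) l))
          (lin (m.loc χ j) l • unitNormal (m.loc (X.q t) j)))
  /-- the discrete curvature -/
  eq_e : ∀ᵐ t ∂(volume.restrict (Ioo 0 S.T)), ∀ η : Fin K → Vec n,
    m.lumped (X.q t) (fun j k =>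
        inner ℝ (m.loc (X.kap t) j k • unitNormal (m.loc (X.q t) j)) (m.loc η j k))
      + m.surfInt (X.q t) (fun j _ =>
        frob (surfJac (m.loc (X.q t) j) (m.loc (X.q t) j))
          (surfJac (m.loc (X.q t) j) (m.loc η j))) = 0
  /-- transport and diffusion of the surfactant -/
  eq_f : ∀ χ : ℝ → Fin K → ℝ, MemWT S.T χ → ∀ᵐ t ∂(volume.restrict (Ioo 0 S.T)),
    HasDerivAt (fun s => m.lumped (X.q s) fun j k => m.loc (X.Psi s) j k * m.loc (χ s) j k)
      (m.lumped (X.q t) (fun j k =>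
          m.loc (X.Psi t) j k * m.loc (fun k => deriv (fun s => χ s k) t) j k)
        - m.lumped (X.q t) (fun j k => D.psiStar (m.loc (X.Psi t) j) k *
            inner ℝ (m.loc (X.V t) j k - m.loc (X.nodal t (X.U t)) j k)
              (surfGrad (m.loc (X.q t) j) (m.loc (χ t) j)))
        - D.diff * m.surfInt (X.q t) (fun j _ =>
            inner ℝ (surfGrad (m.loc (X.q t) j) (m.loc (X.Psi t) j))
              (surfGrad (m.loc (X.q t) j) (m.loc (χ t) j)))) t

/-- The total amount of surfactant `⟨Ψ^h, 1⟩` at time `t`. -/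
def State.totalPsi {S : Setup n} (X : State S K) (m : SurfMesh n J K) (t : ℝ) : ℝ :=
  m.surfInt (X.q t) fun j l => lin (m.loc (X.Psi t) j) l

/-- The volume of `Ω_-^h(t)`. -/
def State.vol {S : Setup n} (X : State S K) (t : ℝ) : ℝ := (volume (X.Om t)).toReal

/-- The characteristic function of `Ω_-^h(t)` belongs to the pressure space. -/
def State.CharMem {S : Setup n} (X : State S K) (t : ℝ) : Prop :=
  ∃ φ ∈ S.Ph t, ∀ᵐ x ∂(volume.restrict S.Ω), φ x = (X.Om t).indicator (fun _ => (1 : ℝ)) x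

/-- `½ ‖[ρ^h]^{1/2} U^h‖² + ½ ⟨ρ_Γ^h U^h, U^h⟩^h + ⟨F_ε(Ψ^h), 1⟩^h` at time `t`. -/
def State.energy {S : Setup n} (X : State S K) (D : Phys n) (m : SurfMesh n J K) (t : ℝ) : ℝ :=
  1 / 2 * (∫ x in S.Ω, ‖√(X.rhoh D t x) • X.U t x‖ ^ 2)
    + 1 / 2 * X.surfMom m t (X.U t) (X.U t)
    + m.lumped (X.q t) fun j k => D.Feps (m.loc (X.Psi t) j k)

/-- The bulk dissipation and the two parts of the surface dissipation. -/
def State.dissipation {S : Setup n} (X : State S K) (D : Phys n) (m : SurfMesh n J K)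
    (t : ℝ) : ℝ :=
  2 * (∫ x in S.Ω, X.muh D t x * frob (symGrad (X.U t) x) (symGrad (X.U t) x))
    + 2 * m.lumped (X.q t) (fun j k => D.muS (m.loc (X.Psi t) j k) *
        frob (surfDdev (m.loc (X.q t) j) (m.loc (X.nodal t (X.U t)) j))
          (surfDdev (m.loc (X.q t) j) (m.loc (X.nodal t (X.U t)) j)))
    + m.lumped (X.q t) (fun j k =>
        (D.lamS (m.loc (X.Psi t) j k) + 2 / (n : ℝ) * D.muS (m.loc (X.Psi t) j k)) *
        (surfDiv (m.loc (X.q t) j) (m.loc (X.nodal t (X.U t)) j) *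
          surfDiv (m.loc (X.q t) j) (m.loc (X.nodal t (X.U t)) j)))

end

end SurfFlow

/-! Each of the three claims comes from testing the scheme with the right function.

Surfactant mass: the constant test function in (f) removes every gradient term, and mass lumping is
exact on affine functions (`SurfMesh.surfInt_lin`), so the total amount has derivative zero almost
everywhere. It is absolutely continuous, hence constant.

Volume: the divergence theorem gives the enclosed volume as `1/d!` times the sum of the determinants
of the vertices of the simplices (`State.IsSolution.vol_eq`), a polynomial in the vertex positions.
Its time derivative is the lumped flux of the mesh velocity (`State.IsSolution.hasDerivAt_vol`):
when the determinants are rearranged, the contributions of the facets cancel in pairs, because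
neighbouring simplices induce opposite orientations on their common facet
(`SurfMesh.IsInterface.sign_eq_neg_one`). This in turn is forced by all unit normals pointing out of
the same set. Equation (d) with `χ = 1` replaces the flux of the mesh velocity by that of the fluid
velocity, which is the integral of the divergence over the inner phase. That integral vanishes: the
characteristic function minus its mean is admissible in (c), and the total divergence over the
domain is zero by the boundary conditions. The divergence theorem itself is obtained by Fubini: on
almost every line parallel to an axis it is the fundamental theorem of calculus with a sign at each
crossing of the boundary (`FlatBoundary.integral_partialDeriv`). It is applied to the inner phase
and to the whole domain.

Energy, `d = 2`: (b) is tested with the velocity `U`, (a) with `|U|²/2`, and (f) with `F_ε'(Ψ)`. The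
matrix `Ξ` obeys a discrete chain rule, so (a) accounts for half of the derivative of the surface
momentum term. The surface energy is split as `F_ε = γ_ε + Ψ F_ε'`; the first part is differentiated
by the transport formula for segments, the second by (f), and `Ψ_⋆` is chosen such that `Ψ_⋆ ∇_s
F_ε' = -∇_s γ_ε`. Testing (d) with `γ_ε κ` and (e) with `γ_ε 𝒱` turns the curvature force into the
divergence of the interpolant of `γ_ε 𝒱`. Only the diffusion term is left over, and it has a sign
since `F_ε` is convex (`State.IsSolution.surfaceEnergy_identity`). -/

namespace SurfFlow

/-! ### Linear algebra of one simplex: normal vector, frame and surface gradient. -/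

section SimplexAlgebra

variable {n : ℕ}

/-- The matrix whose rows are the edge vectors of a simplex. -/
def edgeMat (p : Fin (n + 1) → Vec n) : Matrix (Fin n) (Fin (n + 1)) ℝ :=
  Matrix.of fun k => (p k.succ - p 0).ofLp

/-- Cofactor expansion along the first row, which is a unit vector. The minors that appear are the
Jacobians of the projections along the coordinate directions, see `abs_det_shadowLin`. -/
lemma normalVec_apply (p : Fin (n + 1) → Vec n) (i : Fin (n + 1)) :
    normalVec p i = (-1) ^ (i : ℕ) * ((edgeMat p).submatrix id i.succAbove).det := by
  simp only [normalVec]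
  rw [Matrix.det_succ_row_zero, Finset.sum_eq_single i]
  · simp only [Matrix.of_apply, Fin.cons_zero, Pi.single_eq_same, mul_one]
    rfl
  · intro b _ hb
    simp [hb]
  · simp

lemma inner_normalVec (p : Fin (n + 1) → Vec n) (w : Vec n) :
    inner ℝ (normalVec p) w = Matrix.det (Matrix.of
      (Fin.cons (α := fun _ => Fin (n + 1) → ℝ) w.ofLp
        fun k : Fin n => (p k.succ - p 0).ofLp)) := by
  rw [Matrix.det_succ_row_zero, PiLp.inner_apply]
  refine Finset.sum_congr rfl fun i _ => ?_
  rw [normalVec_apply]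
  simp only [Matrix.of_apply, Fin.cons_zero, RCLike.inner_apply, conj_trivial]
  rw [show ((Matrix.of (Fin.cons (α := fun _ => Fin (n + 1) → ℝ) w.ofLp
        fun k : Fin n => (p k.succ - p 0).ofLp)).submatrix Fin.succ i.succAbove)
      = (edgeMat p).submatrix id i.succAbove from rfl]
  ring

lemma inner_normalVec_edge (p : Fin (n + 1) → Vec n) (k : Fin (n + 1)) :
    inner ℝ (normalVec p) (p k - p 0) = 0 := by
  rw [inner_normalVec]
  refine Fin.cases ?_ (fun k => ?_) k
  · apply Matrix.det_eq_zero_of_row_eq_zero 0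
    intro j
    simp
  · apply Matrix.det_zero_of_row_eq (i := 0) (j := k.succ) (Fin.succ_ne_zero k).symm
    rfl

lemma inner_normalVec_sub (p : Fin (n + 1) → Vec n) (k l : Fin (n + 1)) :
    inner ℝ (normalVec p) (p k - p l) = 0 := by
  have : p k - p l = (p k - p 0) - (p l - p 0) := by abel
  rw [this, inner_sub_right, inner_normalVec_edge, inner_normalVec_edge, sub_zero]

lemma det_frameT (p : Fin (n + 1) → Vec n) : (frameT p).det = ‖normalVec p‖ ^ 2 := by
  rw [← real_inner_self_eq_norm_sq, inner_normalVec]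
  rfl

/-- The `n` edges cannot span `ℝ^{n+1}`; any vector `w` outside their span completes them to an
invertible matrix, whose determinant is the inner product of `w` with the normal. -/
lemma normalVec_ne_zero {p : Fin (n + 1) → Vec n} (hp : AffineIndependent ℝ p) :
    normalVec p ≠ 0 := by
  have hli : LinearIndependent ℝ fun k : Fin n => p k.succ - p 0 := by
    have h := (affineIndependent_iff_linearIndependent_vsub ℝ p 0).1 hp
    have := h.comp (fun k : Fin n => (⟨k.succ, Fin.succ_ne_zero k⟩ : {x // x ≠ (0 : Fin (n+1))}))
      (fun a b hab => by simpa using hab)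
    exact this
  obtain ⟨w, hw⟩ : ∃ w : Vec n, w ∉ Submodule.span ℝ (range fun k : Fin n => p k.succ - p 0) := by
    by_contra hcon
    push Not at hcon
    have htop : Submodule.span ℝ (range fun k : Fin n => p k.succ - p 0) = ⊤ :=
      eq_top_iff.2 fun x _ => hcon x
    have h1 := finrank_range_le_card (R := ℝ) fun k : Fin n => p k.succ - p 0
    rw [Set.finrank, htop, finrank_top] at h1
    simp at h1
  have hli2 : LinearIndependent ℝ
      (Fin.cons w fun k : Fin n => p k.succ - p 0 : Fin (n + 1) → Vec n) :=
    linearIndependent_finCons.2 ⟨hli, hw⟩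
  have hli3 : LinearIndependent ℝ
      (Fin.cons (α := fun _ => Fin (n + 1) → ℝ) w.ofLp fun k : Fin n => (p k.succ - p 0).ofLp) := by
    have := hli2.map' (WithLp.linearEquiv 2 ℝ (Fin (n + 1) → ℝ)).toLinearMap
      (LinearEquiv.ker _)
    have he : (Fin.cons (α := fun _ => Fin (n + 1) → ℝ) w.ofLp
        fun k : Fin n => (p k.succ - p 0).ofLp) = (WithLp.linearEquiv 2 ℝ (Fin (n + 1) → ℝ)) ∘
        (Fin.cons w fun k : Fin n => p k.succ - p 0 : Fin (n + 1) → Vec n) := by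
      funext k
      refine Fin.cases ?_ (fun k => ?_) k <;> simp
    rw [he]
    exact this
  intro h0
  have hdet : inner ℝ (normalVec p) w = 0 := by rw [h0, inner_zero_left]
  rw [inner_normalVec] at hdet
  have hu := Matrix.linearIndependent_rows_iff_isUnit.1
    (show LinearIndependent ℝ (Matrix.of
      (Fin.cons (α := fun _ => Fin (n + 1) → ℝ) w.ofLp
        fun k : Fin n => (p k.succ - p 0).ofLp)).row from hli3)
  rw [Matrix.isUnit_iff_isUnit_det, hdet] at hu
  exact not_isUnit_zero hu

variable {p : Fin (n + 1) → Vec n}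

lemma isUnit_det_frameT (hp : AffineIndependent ℝ p) : IsUnit (frameT p).det := by
  rw [det_frameT, isUnit_iff_ne_zero]
  exact pow_ne_zero _ (norm_ne_zero_iff.2 (normalVec_ne_zero hp))

lemma frameT_mulVec_surfGrad (hp : AffineIndependent ℝ p) (z : Fin (n + 1) → ℝ) :
    frameT p *ᵥ (surfGrad p z).ofLp =
      Fin.cons (α := fun _ => ℝ) 0 fun k : Fin n => z k.succ - z 0 := by
  simp only [surfGrad]
  rw [Matrix.mulVec_mulVec, Matrix.mul_nonsing_inv _ (isUnit_det_frameT hp), Matrix.one_mulVec]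

lemma inner_normalVec_surfGrad (hp : AffineIndependent ℝ p) (z : Fin (n + 1) → ℝ) :
    inner ℝ (normalVec p) (surfGrad p z) = 0 := by
  have h := congrFun (frameT_mulVec_surfGrad hp z) 0
  simp only [Fin.cons_zero] at h
  rw [← h, PiLp.inner_apply]
  simp [Matrix.mulVec, dotProduct, frameT, mul_comm]

lemma surfGrad_const (p : Fin (n + 1) → Vec n) (c : ℝ) : surfGrad p (fun _ => c) = 0 := by
  have : (Fin.cons (α := fun _ => ℝ) 0 fun k : Fin n => c - c) = (0 : Fin (n + 1) → ℝ) := by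
    funext k
    refine Fin.cases ?_ (fun k => ?_) k <;> simp
  simp only [surfGrad]
  rw [this, Matrix.mulVec_zero]
  rfl

lemma surfGrad_sum {ι : Type*} (s : Finset ι) (p : Fin (n + 1) → Vec n)
    (z : ι → Fin (n + 1) → ℝ) :
    surfGrad p (fun k => ∑ i ∈ s, z i k) = ∑ i ∈ s, surfGrad p (z i) := by
  have : (Fin.cons (α := fun _ => ℝ) 0 fun k : Fin n => (∑ i ∈ s, z i k.succ) - ∑ i ∈ s, z i 0)
      = (∑ i ∈ s, Fin.cons (α := fun _ => ℝ) 0 fun k : Fin n => z i k.succ - z i 0 :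
        Fin (n + 1) → ℝ) := by
    funext k
    refine Fin.cases ?_ (fun k => ?_) k <;> simp [Finset.sum_apply]
  simp only [surfGrad]
  rw [this, Matrix.mulVec_sum, WithLp.toLp_sum]

/-- The chain rule for the discrete gradient of a square. -/
lemma xiMat_mulVec_surfGrad (hp : AffineIndependent ℝ p) (z : Fin (n + 1) → ℝ) :
    WithLp.toLp 2 (xiMat p z *ᵥ (surfGrad p z).ofLp) =
      surfGrad p (fun k => 1 / 2 * (z k) ^ 2) := by
  rw [xiMat, ← Matrix.mulVec_mulVec, frameT_mulVec_surfGrad hp, ← Matrix.mulVec_mulVec]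
  simp only [surfGrad]
  congr 2
  funext k
  rw [Matrix.mulVec_diagonal]
  refine Fin.cases ?_ (fun k => ?_) k
  · simp
  -- The diagonal entry times the nodal difference is a difference of squares: `½ (z₀ + z_k)(z_k -
  -- z₀) = ½ z_k² - ½ z₀²`.
  · simp only [Fin.cons_succ]
    ring

lemma area_nonneg (p : Fin (n + 1) → Vec n) : 0 ≤ area p := by
  unfold area
  positivity

lemma norm_unitNormal (hp : AffineIndependent ℝ p) : ‖unitNormal p‖ = 1 := by
  have := norm_ne_zero_iff.2 (normalVec_ne_zero hp)
  rw [unitNormal, norm_smul, norm_inv, norm_norm, inv_mul_cancel₀ this]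

lemma normalVec_eq_norm_smul (hp : AffineIndependent ℝ p) :
    ‖normalVec p‖ • unitNormal p = normalVec p := by
  have := norm_ne_zero_iff.2 (normalVec_ne_zero hp)
  rw [unitNormal, smul_smul, mul_inv_cancel₀ this, one_smul]

lemma inner_unitNormal_surfGrad (hp : AffineIndependent ℝ p) (z : Fin (n + 1) → ℝ) :
    inner ℝ (unitNormal p) (surfGrad p z) = 0 := by
  rw [unitNormal, inner_smul_left, inner_normalVec_surfGrad hp, mul_zero]

end SimplexAlgebra

/-! ### Integrals of affine functions over the reference simplex. -/

section ReferenceSimplex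

lemma isClosed_refSimplex (n : ℕ) : IsClosed (refSimplex n) := by
  have h : refSimplex n = (⋂ i, {y | 0 ≤ y i}) ∩ {y | ∑ i, y i ≤ 1} := by
    ext y
    simp [refSimplex]
  rw [h]
  refine IsClosed.inter (isClosed_iInter fun i => ?_) ?_
  · exact isClosed_le continuous_const (continuous_apply i)
  · exact isClosed_le (by fun_prop) continuous_const

lemma refSimplex_subset_Icc (n : ℕ) : refSimplex n ⊆ Icc 0 1 := by
  rintro y ⟨h0, h1⟩
  refine ⟨fun i => h0 i, fun i => ?_⟩
  exact (Finset.single_le_sum (fun j _ => h0 j) (Finset.mem_univ i)).trans h1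

lemma isCompact_refSimplex (n : ℕ) : IsCompact (refSimplex n) :=
  isCompact_Icc.of_isClosed_subset (isClosed_refSimplex n) (refSimplex_subset_Icc n)

lemma continuous_bary (n : ℕ) : Continuous (bary : (Fin n → ℝ) → Fin (n + 1) → ℝ) := by
  refine continuous_pi fun k => ?_
  refine Fin.cases ?_ (fun k => ?_) k
  · simp only [bary, Fin.cons_zero]
    fun_prop
  · simp only [bary, Fin.cons_succ]
    fun_prop

lemma sum_bary {n : ℕ} (y : Fin n → ℝ) : ∑ k, bary y k = 1 := by
  rw [Fin.sum_univ_succ]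
  simp [bary]

lemma continuous_lin {n : ℕ} {E : Type*} [NormedAddCommGroup E] [NormedSpace ℝ E]
    (z : Fin (n + 1) → E) : Continuous (lin z) := by
  unfold lin
  fun_prop

lemma integrableOn_refSimplex {n : ℕ} {f : (Fin n → ℝ) → ℝ} (hf : Continuous f) :
    IntegrableOn f (refSimplex n) :=
  hf.continuousOn.integrableOn_compact (isCompact_refSimplex n)

lemma integral_affine_refSimplex_one (a b : ℝ) :
    ∫ y in refSimplex 1, (a + b * y 0) = a + b / 2 := by
  have hmp := volume_preserving_funUnique (Fin 1) ℝ
  have hs : refSimplex 1 = (MeasurableEquiv.funUnique (Fin 1) ℝ) ⁻¹' Icc 0 1 := by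
    ext y
    simp [refSimplex]
  rw [hs]
  have : ∫ y in (MeasurableEquiv.funUnique (Fin 1) ℝ) ⁻¹' Icc 0 1, (a + b * y 0) =
      ∫ t in Icc (0 : ℝ) 1, (a + b * t) :=
    hmp.setIntegral_preimage_emb (MeasurableEquiv.measurableEmbedding _)
      (fun t : ℝ => a + b * t) (Icc 0 1)
  rw [this, integral_Icc_eq_integral_Ioc, ← intervalIntegral.integral_of_le zero_le_one,
    intervalIntegral.integral_add (by simp)
      (by simp [intervalIntegral.intervalIntegrable_id.const_mul]),
    intervalIntegral.integral_const_mul, integral_id]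
  simp
  ring

lemma integral_affine_refSimplex_two (a b c : ℝ) :
    ∫ y in refSimplex 2, (a + b * y 0 + c * y 1) = a / 2 + b / 6 + c / 6 := by
  have hmp := volume_preserving_finTwoArrow ℝ
  set T : Set (ℝ × ℝ) := {z | 0 ≤ z.1 ∧ 0 ≤ z.2 ∧ z.1 + z.2 ≤ 1} with hT
  have hs : refSimplex 2 = (MeasurableEquiv.finTwoArrow (α := ℝ)) ⁻¹' T := by
    ext y
    simp [refSimplex, hT, Fin.forall_fin_two, and_assoc]
  have hTc : IsClosed T := by
    refine (isClosed_le continuous_const continuous_fst).inter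
      ((isClosed_le continuous_const continuous_snd).inter
        (isClosed_le (continuous_fst.add continuous_snd) continuous_const))
  have hTK : IsCompact T := by
    refine (isCompact_Icc (a := (0 : ℝ × ℝ)) (b := 1)).of_isClosed_subset hTc ?_
    rintro ⟨u, v⟩ ⟨h1, h2, h3⟩
    simp only at h1 h2 h3
    exact ⟨⟨h1, h2⟩, ⟨by simp; linarith, by simp; linarith⟩⟩
  rw [hs]
  have : ∫ y in (MeasurableEquiv.finTwoArrow (α := ℝ)) ⁻¹' T, (a + b * y 0 + c * y 1) =
      ∫ z in T, (a + b * z.1 + c * z.2) :=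
    hmp.setIntegral_preimage_emb (MeasurableEquiv.measurableEmbedding _)
      (fun z : ℝ × ℝ => a + b * z.1 + c * z.2) T
  rw [this, ← integral_indicator hTc.measurableSet, Measure.volume_eq_prod, integral_prod]
  · have inner_eq : ∀ u : ℝ, ∫ v, T.indicator (fun z : ℝ × ℝ => a + b * z.1 + c * z.2) (u, v)
        = (Icc (0 : ℝ) 1).indicator
          (fun u => (a + b * u) * (1 - u) + c * ((1 - u) ^ 2 / 2)) u := by
      intro u
      by_cases hu : u ∈ Icc (0 : ℝ) 1
      · rw [indicator_of_mem hu]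
        have h1 : (fun v => T.indicator (fun z : ℝ × ℝ => a + b * z.1 + c * z.2) (u, v))
            = (Icc (0 : ℝ) (1 - u)).indicator (fun v => (a + b * u) + c * v) := by
          funext v
          by_cases hv : v ∈ Icc (0 : ℝ) (1 - u)
          · rw [indicator_of_mem hv, indicator_of_mem]
            exact ⟨hu.1, hv.1, by simp only; linarith [hv.2]⟩
          · rw [indicator_of_notMem hv, indicator_of_notMem]
            rintro ⟨h1, h2, h3⟩
            exact hv ⟨h2, by simp only at h3; linarith⟩
        rw [h1, integral_indicator measurableSet_Icc, integral_Icc_eq_integral_Ioc,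
          ← intervalIntegral.integral_of_le (by linarith [hu.2]),
          intervalIntegral.integral_add (by simp)
            (by simp [intervalIntegral.intervalIntegrable_id.const_mul]),
          intervalIntegral.integral_const_mul, integral_id]
        simp
        ring
      · rw [indicator_of_notMem hu]
        have h1 : (fun v => T.indicator (fun z : ℝ × ℝ => a + b * z.1 + c * z.2) (u, v))
            = fun _ => 0 := by
          funext v
          rw [indicator_of_notMem]
          rintro ⟨h1, h2, h3⟩
          simp only at h1 h2 h3
          exact hu ⟨h1, by linarith⟩
        rw [h1, integral_zero]
    simp_rw [inner_eq]
    rw [integral_indicator measurableSet_Icc, integral_Icc_eq_integral_Ioc,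
      ← intervalIntegral.integral_of_le zero_le_one]
    have hd : ∀ u ∈ uIcc (0 : ℝ) 1, HasDerivAt
        (fun u => a * (u - u ^ 2 / 2) + b * (u ^ 2 / 2 - u ^ 3 / 3) - c * ((1 - u) ^ 3 / 6))
        ((a + b * u) * (1 - u) + c * ((1 - u) ^ 2 / 2)) u := by
      intro u _
      have h1 := hasDerivAt_id u
      have := (((h1.sub ((h1.pow 2).div_const 2)).const_mul a).add
        ((((h1.pow 2).div_const 2).sub ((h1.pow 3).div_const 3)).const_mul b)).sub
        ((((h1.const_sub 1).pow 3).div_const 6).const_mul c)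
      refine this.congr_deriv ?_
      norm_num
      ring
    rw [intervalIntegral.integral_eq_sub_of_hasDerivAt hd
      (Continuous.intervalIntegrable (by fun_prop) _ _)]
    norm_num
    ring
  · rw [← Measure.volume_eq_prod, integrable_indicator_iff hTc.measurableSet]
    exact ContinuousOn.integrableOn_compact hTK (by fun_prop)

/-- All `n + 1` barycentric coordinates have the same integral and they sum to one, so each carries
the fraction `1/(n+1)` of the volume `1/n!`. -/
lemma integral_bary {n : ℕ} (hn : n = 1 ∨ n = 2) (k : Fin (n + 1)) :
    ∫ y in refSimplex n, bary y k = 1 / ((n + 1).factorial : ℝ) := by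
  rcases hn with rfl | rfl
  · fin_cases k
    · have := integral_affine_refSimplex_one 1 (-1)
      simp only [bary, Fin.zero_eta, Fin.cons_zero, Finset.univ_unique, Fin.default_eq_zero,
        Finset.sum_singleton]
      rw [show (fun y : Fin 1 → ℝ => 1 - y 0) = fun y => 1 + -1 * y 0 by funext y; ring, this]
      norm_num [Nat.factorial]
    · have := integral_affine_refSimplex_one 0 1
      simp only [zero_add, one_mul] at this
      rw [show (fun y : Fin 1 → ℝ => bary y ((fun i => i) ⟨1, by simp⟩)) = fun y => y 0 from rfl]
      rw [this]
      norm_num [Nat.factorial]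
  · fin_cases k
    · have := integral_affine_refSimplex_two 1 (-1) (-1)
      rw [show (fun y : Fin 2 → ℝ => bary y ((fun i => i) ⟨0, by simp⟩))
        = fun y => 1 + -1 * y 0 + -1 * y 1 by funext y; simp [bary]; ring, this]
      norm_num [Nat.factorial]
    · have := integral_affine_refSimplex_two 0 1 0
      rw [show (fun y : Fin 2 → ℝ => bary y ((fun i => i) ⟨1, by simp⟩))
        = fun y => 0 + 1 * y 0 + 0 * y 1 by
          funext y; rw [show bary y ((fun i => i) ⟨1, by simp⟩) = y 0 from rfl]; ring, this]
      norm_num [Nat.factorial]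
    · have := integral_affine_refSimplex_two 0 0 1
      rw [show (fun y : Fin 2 → ℝ => bary y ((fun i => i) ⟨2, by simp⟩))
        = fun y => 0 + 0 * y 0 + 1 * y 1 by
          funext y; rw [show bary y ((fun i => i) ⟨2, by simp⟩) = y 1 from rfl]; ring, this]
      norm_num [Nat.factorial]

lemma integral_lin_bary {n : ℕ} (hn : n = 1 ∨ n = 2) (z : Fin (n + 1) → ℝ) :
    ∫ y in refSimplex n, lin z (bary y) = 1 / ((n + 1).factorial : ℝ) * ∑ k, z k := by
  have hc : ∀ k, Continuous fun y : Fin n → ℝ => bary y k := fun k =>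
    (continuous_apply k).comp (continuous_bary n)
  simp only [lin, smul_eq_mul]
  rw [integral_finsetSum _ fun k _ => integrableOn_refSimplex
    (show Continuous fun y => bary y k * z k from (hc k).mul continuous_const)]
  simp_rw [integral_mul_const, integral_bary hn, Finset.mul_sum]

/-- Exactness of the vertex quadrature rule on affine functions. -/
lemma simplexInt_lin {n : ℕ} (hn : n = 1 ∨ n = 2) (p : Fin (n + 1) → Vec n)
    (z : Fin (n + 1) → ℝ) :
    simplexInt p (lin z) = 1 / ((n : ℝ) + 1) * (area p * ∑ k, z k) := by
  rw [simplexInt, integral_lin_bary hn, area, Nat.factorial_succ]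
  have : (n.factorial : ℝ) ≠ 0 := by positivity
  push_cast
  field_simp

lemma simplexInt_const {n : ℕ} (hn : n = 1 ∨ n = 2) (p : Fin (n + 1) → Vec n) (c : ℝ) :
    simplexInt p (fun _ => c) = area p * c := by
  have h : simplexInt p (fun _ => c) = simplexInt p (lin fun _ => c) := by
    unfold simplexInt lin
    simp_rw [← Finset.sum_smul, sum_bary, one_smul]
  rw [h, simplexInt_lin hn]
  simp
  field_simp

end ReferenceSimplex

/-! ### Exact and mass lumped integrals over the surface. -/

section SurfaceIntegrals

variable {n J K : ℕ}

/-- The total amount of surfactant is defined by an exact integral, whereas (f) evolves the lumped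
one; this identifies them. -/
lemma SurfMesh.surfInt_lin (hn : n = 1 ∨ n = 2) (m : SurfMesh n J K) (q : Fin K → Vec n)
    (z : Fin K → ℝ) :
    (m.surfInt q fun j l => lin (m.loc z j) l) = m.lumped q fun j k => m.loc z j k := by
  unfold SurfMesh.surfInt SurfMesh.lumped
  rw [Finset.mul_sum]
  exact Finset.sum_congr rfl fun j _ => simplexInt_lin hn _ _

lemma SurfMesh.lumped_add (m : SurfMesh n J K) (q : Fin K → Vec n)
    (f g : Fin J → Fin (n + 1) → ℝ) :
    (m.lumped q fun j k => f j k + g j k) = m.lumped q f + m.lumped q g := by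
  simp only [SurfMesh.lumped, Finset.sum_add_distrib, mul_add]

lemma SurfMesh.lumped_sub (m : SurfMesh n J K) (q : Fin K → Vec n)
    (f g : Fin J → Fin (n + 1) → ℝ) :
    (m.lumped q fun j k => f j k - g j k) = m.lumped q f - m.lumped q g := by
  simp only [SurfMesh.lumped, Finset.sum_sub_distrib, mul_sub]

lemma SurfMesh.lumped_const_mul (m : SurfMesh n J K) (q : Fin K → Vec n) (c : ℝ)
    (f : Fin J → Fin (n + 1) → ℝ) :
    (m.lumped q fun j k => c * f j k) = c * m.lumped q f := by
  simp only [SurfMesh.lumped, Finset.mul_sum]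
  exact Finset.sum_congr rfl fun j _ => Finset.sum_congr rfl fun k _ => by ring

lemma SurfMesh.lumped_sum {ι : Type*} (s : Finset ι) (m : SurfMesh n J K) (q : Fin K → Vec n)
    (f : ι → Fin J → Fin (n + 1) → ℝ) :
    (m.lumped q fun j k => ∑ i ∈ s, f i j k) = ∑ i ∈ s, m.lumped q (f i) := by
  classical
  induction s using Finset.induction_on with
  | empty => simp [SurfMesh.lumped]
  | insert a s ha ih =>
    simp only [Finset.sum_insert ha]
    rw [SurfMesh.lumped_add, ih]

end SurfaceIntegrals

/-! ### Stability of absolute continuity under composition, sums and products of spaces. -/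

section AbsoluteContinuity

lemma _root_.LipschitzOnWith.comp_absolutelyContinuousOnInterval {X Y : Type*}
    [PseudoMetricSpace X] [PseudoMetricSpace Y] {f : ℝ → X} {g : X → Y} {a b : ℝ}
    {C : NNReal} {s : Set X} (hg : LipschitzOnWith C g s)
    (hf : AbsolutelyContinuousOnInterval f a b) (hs : ∀ t ∈ uIcc a b, f t ∈ s) :
    AbsolutelyContinuousOnInterval (fun t => g (f t)) a b := by
  rw [absolutelyContinuousOnInterval_iff] at hf ⊢
  intro ε hε
  -- `C + 1` in place of `C`, since the Lipschitz constant may be zero.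
  obtain ⟨δ, hδ, h⟩ := hf (ε / (C + 1)) (by positivity)
  refine ⟨δ, hδ, fun E hE hEδ => ?_⟩
  have h1 := h E hE hEδ
  calc ∑ i ∈ Finset.range E.1, dist (g (f (E.2 i).1)) (g (f (E.2 i).2))
      ≤ ∑ i ∈ Finset.range E.1, (C + 1) * dist (f (E.2 i).1) (f (E.2 i).2) := by
        refine Finset.sum_le_sum fun i hi => ?_
        have hm := hE.1 i hi
        refine (hg.dist_le_mul _ (hs _ hm.1) _ (hs _ hm.2)).trans ?_
        have := dist_nonneg (x := f (E.2 i).1) (y := f (E.2 i).2)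
        nlinarith
    _ = (C + 1) * ∑ i ∈ Finset.range E.1, dist (f (E.2 i).1) (f (E.2 i).2) := by
        rw [Finset.mul_sum]
    _ < (C + 1) * (ε / (C + 1)) := by gcongr
    _ = ε := by field_simp

/-- An absolutely continuous curve is bounded on the interval, so it stays in a closed ball; this
ball is compact and convex, and a `C¹` map is Lipschitz on it. -/
lemma _root_.AbsolutelyContinuousOnInterval.contDiff_comp {E F : Type*} [NormedAddCommGroup E]
    [NormedSpace ℝ E] [FiniteDimensional ℝ E] [NormedAddCommGroup F] [NormedSpace ℝ F]
    {f : ℝ → E} {g : E → F} {a b : ℝ} (hf : AbsolutelyContinuousOnInterval f a b)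
    (hg : ContDiff ℝ 1 g) : AbsolutelyContinuousOnInterval (fun t => g (f t)) a b := by
  obtain ⟨C, hC⟩ := hf.exists_bound
  obtain ⟨L, hL⟩ := hg.contDiffOn.exists_lipschitzOnWith (by decide)
    (convex_closedBall (0 : E) C) (isCompact_closedBall 0 C)
  exact hL.comp_absolutelyContinuousOnInterval hf fun t ht => by simpa using hC t ht

lemma _root_.AbsolutelyContinuousOnInterval.finsetSum {ι F : Type*} [NormedAddCommGroup F]
    {f : ι → ℝ → F} {a b : ℝ} (s : Finset ι)
    (hf : ∀ i ∈ s, AbsolutelyContinuousOnInterval (f i) a b) :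
    AbsolutelyContinuousOnInterval (fun t => ∑ i ∈ s, f i t) a b := by
  classical
  induction s using Finset.induction_on with
  | empty =>
    simp only [Finset.sum_empty]
    exact (LipschitzWith.const (0 : F)).lipschitzOnWith.absolutelyContinuousOnInterval
  | insert i s hi ih =>
    simp only [Finset.sum_insert hi]
    exact (hf i (by simp)).add (ih fun j hj => hf j (by simp [hj]))

lemma _root_.AbsolutelyContinuousOnInterval.norm_comp {F : Type*} [NormedAddCommGroup F]
    {f : ℝ → F} {a b : ℝ} (hf : AbsolutelyContinuousOnInterval f a b) :
    AbsolutelyContinuousOnInterval (fun t => ‖f t‖) a b :=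
  (lipschitzWith_one_norm.lipschitzOnWith (s := univ)).comp_absolutelyContinuousOnInterval hf
    fun _ _ => mem_univ _

lemma _root_.AbsolutelyContinuousOnInterval.pi {ι F : Type*} [Fintype ι] [NormedAddCommGroup F]
    [NormedSpace ℝ F] {f : ℝ → ι → F} {a b : ℝ}
    (hf : ∀ i, AbsolutelyContinuousOnInterval (fun t => f t i) a b) :
    AbsolutelyContinuousOnInterval f a b := by
  classical
  -- The curve is the finite sum of its components under the coordinate embeddings, which are
  -- Lipschitz.
  have h : f = fun t => ∑ i, ContinuousLinearMap.single ℝ (fun _ : ι => F) i (f t i) := by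
    funext t
    ext i
    simp [Finset.sum_apply, Pi.single_apply]
  rw [h]
  refine AbsolutelyContinuousOnInterval.finsetSum _ fun i _ => ?_
  exact ((ContinuousLinearMap.single ℝ (fun _ : ι => F) i).lipschitz.lipschitzOnWith
    (s := univ)).comp_absolutelyContinuousOnInterval (hf i) fun _ _ => mem_univ _

end AbsoluteContinuity

/-! ### Absolute continuity in time of areas and lumped integrals. -/

section Area

variable {n J K : ℕ}

lemma contDiff_det_comp {E : Type*} [NormedAddCommGroup E] [NormedSpace ℝ E] {k : ℕ}
    {A : E → Matrix (Fin k) (Fin k) ℝ} (hA : ∀ i j, ContDiff ℝ 1 fun x => A x i j) :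
    ContDiff ℝ 1 fun x => (A x).det := by
  simp only [Matrix.det_apply]
  refine ContDiff.sum fun σ _ => ContDiff.const_smul _ ?_
  exact contDiff_prod fun i _ => hA _ _

lemma contDiff_normalVec : ContDiff ℝ 1 (normalVec : (Fin (n + 1) → Vec n) → Vec n) := by
  rw [contDiff_euclidean]
  intro i
  refine contDiff_det_comp fun a b => ?_
  refine Fin.cases ?_ (fun a => ?_) a
  · simp only [Matrix.of_apply, Fin.cons_zero]
    exact contDiff_const
  · simp only [Matrix.of_apply, Fin.cons_succ, PiLp.sub_apply]
    fun_prop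

lemma SurfMesh.loc_comp_absolutelyContinuous {T : ℝ} (m : SurfMesh n J K) {q : ℝ → Fin K → Vec n}
    (hq : ∀ k, AbsolutelyContinuousOnInterval (fun t => q t k) 0 T) (j : Fin J) :
    AbsolutelyContinuousOnInterval (fun t => m.loc (q t) j) 0 T :=
  AbsolutelyContinuousOnInterval.pi fun k => hq (m.vert j k)

/-- The normal vector is polynomial in the vertices. The norm is treated as a Lipschitz map rather
than a smooth one, so no lower bound on the area is needed. -/
lemma SurfMesh.area_absolutelyContinuous {T : ℝ} (m : SurfMesh n J K) {q : ℝ → Fin K → Vec n}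
    (hq : ∀ k, AbsolutelyContinuousOnInterval (fun t => q t k) 0 T) (j : Fin J) :
    AbsolutelyContinuousOnInterval (fun t => area (m.loc (q t) j)) 0 T := by
  have h := ((m.loc_comp_absolutelyContinuous hq j).contDiff_comp contDiff_normalVec).norm_comp
  have := h.const_mul ((n.factorial : ℝ))⁻¹
  simpa only [area, div_eq_inv_mul] using this

lemma SurfMesh.lumped_absolutelyContinuous {T : ℝ} (m : SurfMesh n J K) {q : ℝ → Fin K → Vec n}
    (hq : ∀ k, AbsolutelyContinuousOnInterval (fun t => q t k) 0 T) {z : ℝ → Fin K → ℝ}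
    (hz : ∀ k, AbsolutelyContinuousOnInterval (fun t => z t k) 0 T) :
    AbsolutelyContinuousOnInterval
      (fun t => m.lumped (q t) fun j k => m.loc (z t) j k) 0 T := by
  refine AbsolutelyContinuousOnInterval.const_mul _ ?_
  refine AbsolutelyContinuousOnInterval.finsetSum _ fun j _ => ?_
  refine AbsolutelyContinuousOnInterval.fun_mul (m.area_absolutelyContinuous hq j) ?_
  exact AbsolutelyContinuousOnInterval.finsetSum _ fun k _ => hz (m.vert j k)

end Area

/-! ### Conservation of the total amount of surfactant. -/

section Conservation

variable {n J K : ℕ} {S : Setup n} {D : Phys n} {m : SurfMesh n J K} {X : State S K}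

lemma eq_initial_of_ae_hasDerivAt_zero {f : ℝ → ℝ} {T : ℝ} (hT : 0 < T)
    (hf : AbsolutelyContinuousOnInterval f 0 T)
    (h0 : ∀ᵐ t ∂(volume.restrict (Ioo 0 T)), HasDerivAt f 0 t) :
    ∀ t ∈ Icc 0 T, f t = f 0 := by
  rw [ae_restrict_iff' measurableSet_Ioo] at h0
  -- The criterion asks for the derivative at almost every point of the closed interval; the two
  -- endpoints are null.
  obtain ⟨C, hC⟩ := hf.const_of_ae_hasDerivAt_zero (by
    have h1 : ∀ᵐ x : ℝ, x ≠ 0 := by simp [ae_iff]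
    have h2 : ∀ᵐ x : ℝ, x ≠ T := by simp [ae_iff]
    filter_upwards [h0, h1, h2] with x hx hx0 hxT hm
    rw [uIcc_of_le hT.le] at hm
    exact hx ⟨lt_of_le_of_ne hm.1 (Ne.symm hx0), lt_of_le_of_ne hm.2 hxT⟩)
  rw [uIcc_of_le hT.le] at hC
  intro t ht
  rw [hC t ht, hC 0 ⟨le_rfl, hT.le⟩]

lemma MemWT.absolutelyContinuous {T : ℝ} (hT : 0 ≤ T) {z : ℝ → Fin K → ℝ} (hz : MemWT T z)
    (k : Fin K) : AbsolutelyContinuousOnInterval (fun t => z t k) 0 T := by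
  refine ContDiffOn.absolutelyContinuousOnInterval ?_
  rw [uIcc_of_le hT]
  exact contDiffOn_pi.1 hz k

lemma State.totalPsi_eq (hn : n = 1 ∨ n = 2) (m : SurfMesh n J K) (X : State S K) (t : ℝ) :
    X.totalPsi m t = m.lumped (X.q t) fun j k => m.loc (X.Psi t) j k :=
  m.surfInt_lin hn _ _

/-- Equation (f) with the constant test function: its surface gradient and its material derivative
vanish, which leaves nothing on the right-hand side. -/
lemma State.IsSolution.hasDerivAt_totalPsi (hn : n = 1 ∨ n = 2) (hX : X.IsSolution D m) :
    ∀ᵐ t ∂(volume.restrict (Ioo 0 S.T)), HasDerivAt (fun s => X.totalPsi m s) 0 t := by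
  filter_upwards [hX.eq_f (fun _ _ => 1) contDiffOn_const] with t ht
  simp only [State.totalPsi_eq hn]
  have h1 : ∀ j, m.loc (fun _ : Fin K => (1 : ℝ)) j = fun _ => 1 := fun j => rfl
  have h0 : ∀ j k, m.loc (fun _ : Fin K => (0 : ℝ)) j k = 0 := fun j k => rfl
  simp only [h1, mul_one, deriv_const, h0, mul_zero, surfGrad_const, inner_zero_right] at ht
  refine ht.congr_deriv ?_
  simp [SurfMesh.lumped, SurfMesh.surfInt, simplexInt]

lemma State.IsSolution.totalPsi_const (hn : n = 1 ∨ n = 2) (hX : X.IsSolution D m) :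
    ∀ t ∈ Icc 0 S.T, X.totalPsi m t = X.totalPsi m 0 := by
  refine eq_initial_of_ae_hasDerivAt_zero S.T_pos ?_ (hX.hasDerivAt_totalPsi hn)
  rw [show X.totalPsi m = _ from funext (X.totalPsi_eq hn m)]
  exact m.lumped_absolutelyContinuous hX.q_ac fun k =>
    hX.Psi_mem.absolutelyContinuous S.T_pos.le k

end Conservation

/-! ### Deviatoric and spherical parts of the surface rate-of-deformation tensor. -/

section Deviatoric

variable {n : ℕ} {p : Fin (n + 1) → Vec n}

lemma frob_eq_trace (A B : Matrix (Fin (n + 1)) (Fin (n + 1)) ℝ) :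
    frob A B = (A * Bᵀ).trace := by
  simp [frob, Matrix.trace, Matrix.mul_apply]

lemma frob_add_left (A B C : Matrix (Fin (n + 1)) (Fin (n + 1)) ℝ) :
    frob (A + B) C = frob A C + frob B C := by
  simp [frob_eq_trace, Matrix.add_mul]

lemma frob_smul_left (c : ℝ) (A B : Matrix (Fin (n + 1)) (Fin (n + 1)) ℝ) :
    frob (c • A) B = c * frob A B := by
  simp [frob_eq_trace]

lemma frob_comm (A B : Matrix (Fin (n + 1)) (Fin (n + 1)) ℝ) : frob A B = frob B A := by
  simp [frob, mul_comm]

lemma unitNormal_dotProduct (hp : AffineIndependent ℝ p) :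
    (unitNormal p).ofLp ⬝ᵥ (unitNormal p).ofLp = 1 := by
  have h := real_inner_self_eq_norm_sq (unitNormal p)
  rw [norm_unitNormal hp, one_pow, PiLp.inner_apply] at h
  simpa [dotProduct, pow_two] using h

lemma transpose_tangProj (p : Fin (n + 1) → Vec n) : (tangProj p)ᵀ = tangProj p := by
  simp [tangProj, Matrix.transpose_vecMulVec]

lemma tangProj_mul_self (hp : AffineIndependent ℝ p) :
    tangProj p * tangProj p = tangProj p := by
  have h : Matrix.vecMulVec (unitNormal p).ofLp (unitNormal p).ofLp *
      Matrix.vecMulVec (unitNormal p).ofLp (unitNormal p).ofLp =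
      Matrix.vecMulVec (unitNormal p).ofLp (unitNormal p).ofLp := by
    rw [Matrix.vecMulVec_mul_vecMulVec, unitNormal_dotProduct hp, one_smul]
  simp only [tangProj, Matrix.mul_sub, Matrix.sub_mul, Matrix.one_mul, Matrix.mul_one, h]
  abel

lemma trace_tangProj (hp : AffineIndependent ℝ p) : (tangProj p).trace = n := by
  rw [tangProj, Matrix.trace_sub, Matrix.trace_one, Matrix.trace_vecMulVec,
    unitNormal_dotProduct hp]
  simp

lemma frob_tangProj_self (hp : AffineIndependent ℝ p) : frob (tangProj p) (tangProj p) = n := by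
  rw [frob_eq_trace, transpose_tangProj, tangProj_mul_self hp, trace_tangProj hp]

/-- The rows of the Jacobian are surface gradients, hence tangential. -/
lemma surfJac_mul_tangProj (hp : AffineIndependent ℝ p) (η : Fin (n + 1) → Vec n) :
    surfJac p η * tangProj p = surfJac p η := by
  have h : surfJac p η *ᵥ (unitNormal p).ofLp = 0 := by
    funext i
    have := inner_unitNormal_surfGrad hp (fun k => η k i)
    rw [PiLp.inner_apply] at this
    simpa [Matrix.mulVec, dotProduct, surfJac] using this
  rw [tangProj, Matrix.mul_sub, Matrix.mul_one, Matrix.mul_vecMulVec, h]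
  simp

/-- By cyclicity of the trace and `P² = P`, the two projections inside `surfD` are absorbed, and the
Jacobian and its transpose each contribute half of the divergence. -/
lemma frob_surfD_tangProj (hp : AffineIndependent ℝ p) (η : Fin (n + 1) → Vec n) :
    frob (surfD p η) (tangProj p) = surfDiv p η := by
  rw [surfD, frob_smul_left, frob_eq_trace, transpose_tangProj, Matrix.mul_assoc,
    tangProj_mul_self hp, Matrix.mul_assoc, Matrix.trace_mul_comm, Matrix.mul_assoc,
    tangProj_mul_self hp, Matrix.add_mul, Matrix.trace_add, surfJac_mul_tangProj hp]
  have h : ((surfJac p η)ᵀ * tangProj p).trace = surfDiv p η := by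
    rw [← Matrix.trace_transpose, Matrix.transpose_mul, Matrix.transpose_transpose,
      transpose_tangProj, Matrix.trace_mul_comm, surfJac_mul_tangProj hp]
    rfl
  rw [h, surfDiv]
  ring

/-- The splitting of the rate-of-deformation tensor in its deviatoric and spherical parts. -/
lemma frob_surfD_self (hn : n ≠ 0) (hp : AffineIndependent ℝ p) (η : Fin (n + 1) → Vec n) :
    frob (surfD p η) (surfD p η) =
      frob (surfDdev p η) (surfDdev p η) + 1 / (n : ℝ) * (surfDiv p η * surfDiv p η) := by
  have hn' : (n : ℝ) ≠ 0 := by exact_mod_cast hn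
  set c := 1 / (n : ℝ) * surfDiv p η with hc
  have hD : surfD p η = surfDdev p η + c • tangProj p := by
    rw [surfDdev]
    abel
  -- Orthogonality of the two parts: `D_s : P` is the divergence and `P : P = n`, so the multiple of
  -- `P` that was subtracted is exactly the component of `D_s` along `P`.
  have h0 : frob (surfDdev p η) (tangProj p) = 0 := by
    have h := frob_surfD_tangProj hp η
    rw [hD, frob_add_left, frob_smul_left, frob_tangProj_self hp] at h
    have : c * n = surfDiv p η := by rw [hc]; field_simp
    linarith
  have h1 : frob (surfDdev p η) (c • tangProj p) = 0 := by
    rw [frob_comm, frob_smul_left, frob_comm, h0, mul_zero]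
  have h2 : frob (c • tangProj p) (c • tangProj p) = c * (c * n) := by
    rw [frob_smul_left, frob_comm, frob_smul_left, frob_tangProj_self hp]
  rw [hD, frob_add_left, frob_comm (surfDdev p η), frob_comm (c • tangProj p), frob_add_left,
    frob_add_left, frob_comm (c • tangProj p) (surfDdev p η), h1, h2, hc]
  field_simp
  ring

end Deviatoric

/-! ### Explicit formulas on a segment, `d = 2`. -/

section Segment

variable {p : Fin 2 → Vec 1}

lemma normalVec_segment (p : Fin 2 → Vec 1) :
    normalVec p = !₂[p 1 1 - p 0 1, -(p 1 0 - p 0 0)] := by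
  ext i
  rw [normalVec_apply, Matrix.det_fin_one]
  fin_cases i <;> simp [edgeMat, Fin.succAbove]

lemma area_segment (p : Fin 2 → Vec 1) : area p = ‖p 1 - p 0‖ := by
  rw [area, normalVec_segment, EuclideanSpace.norm_eq, EuclideanSpace.norm_eq]
  simp only [Nat.factorial_one, Nat.cast_one, div_one, Fin.sum_univ_two, Real.norm_eq_abs, sq_abs]
  simp
  congr 1
  ring

lemma segment_ne (hp : AffineIndependent ℝ p) : p 1 - p 0 ≠ 0 := by
  have := hp.injective.ne (show (1 : Fin 2) ≠ 0 by decide)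
  exact sub_ne_zero.2 this

lemma surfGrad_segment (hp : AffineIndependent ℝ p) (z : Fin 2 → ℝ) :
    surfGrad p z = ((z 1 - z 0) / ‖p 1 - p 0‖ ^ 2) • (p 1 - p 0) := by
  have he := norm_ne_zero_iff.2 (segment_ne hp)
  have hdet := isUnit_det_frameT hp
  have h : frameT p *ᵥ (((z 1 - z 0) / ‖p 1 - p 0‖ ^ 2) • (p 1 - p 0)).ofLp =
      Fin.cons (α := fun _ => ℝ) 0 fun k : Fin 1 => z k.succ - z 0 := by
    have h1 : ‖p 1 - p 0‖ ^ 2 = (p 1 0 - p 0 0) ^ 2 + (p 1 1 - p 0 1) ^ 2 := by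
      rw [EuclideanSpace.norm_sq_eq]
      simp [Fin.sum_univ_two]
    funext i
    fin_cases i
    · simp [Matrix.mulVec, dotProduct, frameT, Fin.sum_univ_two, normalVec_segment]
      ring
    · simp [Matrix.mulVec, dotProduct, frameT, Fin.sum_univ_two]
      have h2 : (p 1 0 - p 0 0) ^ 2 + (p 1 1 - p 0 1) ^ 2 ≠ 0 := by
        rw [← h1]; exact pow_ne_zero _ he
      rw [h1]
      field_simp
  unfold surfGrad
  rw [← h, Matrix.mulVec_mulVec, Matrix.nonsing_inv_mul _ hdet, Matrix.one_mulVec]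

lemma surfJac_segment (hp : AffineIndependent ℝ p) (η : Fin 2 → Vec 1) (i l : Fin 2) :
    surfJac p η i l = (η 1 i - η 0 i) / ‖p 1 - p 0‖ ^ 2 * (p 1 l - p 0 l) := by
  rw [surfJac, Matrix.of_apply, surfGrad_segment hp]
  simp

lemma surfDiv_segment (hp : AffineIndependent ℝ p) (η : Fin 2 → Vec 1) :
    surfDiv p η = inner ℝ (η 1 - η 0) (p 1 - p 0) / ‖p 1 - p 0‖ ^ 2 := by
  rw [surfDiv, Matrix.trace]
  simp only [Matrix.diag_apply, surfJac_segment hp, PiLp.inner_apply]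
  simp
  ring

/-- The surface gradient of the identity is the tangential projection. Through this, the curvature
equation (e) becomes a statement about the divergence of the test field. -/
lemma frob_surfJac_segment (hp : AffineIndependent ℝ p) (η : Fin 2 → Vec 1) :
    frob (surfJac p p) (surfJac p η) = surfDiv p η := by
  have he := norm_ne_zero_iff.2 (segment_ne hp)
  have h1 : ‖p 1 - p 0‖ ^ 2 = (p 1 0 - p 0 0) ^ 2 + (p 1 1 - p 0 1) ^ 2 := by
    rw [EuclideanSpace.norm_sq_eq]
    simp [Fin.sum_univ_two]
  have h2 : (p 1 0 - p 0 0) ^ 2 + (p 1 1 - p 0 1) ^ 2 ≠ 0 := by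
    rw [← h1]; exact pow_ne_zero _ he
  rw [surfDiv_segment hp, frob]
  simp only [surfJac_segment hp, PiLp.inner_apply]
  simp
  rw [h1]
  field_simp

/-- The mass lumped product rule for the divergence on a segment. -/
lemma sum_surfDiv_mul_add_inner (hp : AffineIndependent ℝ p) (η : Fin 2 → Vec 1)
    (z : Fin 2 → ℝ) :
    ∑ k, (surfDiv p η * z k + inner ℝ (η k) (surfGrad p z)) =
      2 * surfDiv p (fun k => z k • η k) := by
  -- Everything is an inner product with the edge, and what remains is the algebraic identity `(η₁ -
  -- η₀)(z₀ + z₁) + (η₀ + η₁)(z₁ - z₀) = 2 (z₁ η₁ - z₀ η₀)`.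
  rw [surfDiv_segment hp, surfDiv_segment hp, surfGrad_segment hp]
  simp only [Fin.sum_univ_two, inner_sub_left, inner_smul_left, inner_smul_right, conj_trivial]
  ring

/-- The derivative of the length `|e|` is `e · ė / |e|`; nondegeneracy is what makes the norm
differentiable here. -/
lemma hasDerivAt_area_segment {q : ℝ → Fin 2 → Vec 1} {v : Fin 2 → Vec 1} {t : ℝ}
    (hq : ∀ k, HasDerivAt (fun s => q s k) (v k) t) (hp : AffineIndependent ℝ (q t)) :
    HasDerivAt (fun s => area (q s)) (area (q t) * surfDiv (q t) v) t := by
  have he := segment_ne hp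
  have he' := norm_ne_zero_iff.2 he
  simp only [area_segment]
  have h := ((hq 1).sub (hq 0)).norm_sq.sqrt (by
    simpa using he)
  simp only [Pi.sub_apply, Real.sqrt_sq (norm_nonneg _)] at h
  refine h.congr_deriv ?_
  rw [surfDiv_segment hp, real_inner_comm]
  field_simp

end Segment

/-! ### The regularized energy and surface tension: smoothness, convexity, and the choice of `Ψ_⋆`.
-/

section RegularizedEnergy

/-- Away from `a` one branch is active in a neighbourhood; at `a` the one-sided derivatives of the
two branches are joined, which needs equal values there. -/
lemma hasDerivAt_ite_le {f g : ℝ → ℝ} {a d x : ℝ} (hf : a ≤ x → HasDerivAt f d x)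
    (hg : x ≤ a → HasDerivAt g d x) (hfg : f a = g a) :
    HasDerivAt (fun r => if a ≤ r then f r else g r) d x := by
  rcases lt_trichotomy a x with h | h | h
  · refine (hf h.le).congr_of_eventuallyEq ?_
    filter_upwards [lt_mem_nhds h] with r hr
    rw [if_pos hr.le]
  · subst h
    have h1 : HasDerivWithinAt (fun r => if a ≤ r then f r else g r) d (Ici a) a :=
      (hf le_rfl).hasDerivWithinAt.congr (fun r hr => if_pos hr) (if_pos le_rfl)
    have h2 : HasDerivWithinAt (fun r => if a ≤ r then f r else g r) d (Iic a) a := by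
      refine (hg le_rfl).hasDerivWithinAt.congr (fun r hr => ?_) (by rw [if_pos le_rfl, hfg])
      rcases eq_or_lt_of_le (show r ≤ a from hr) with rfl | hr'
      · rw [if_pos le_rfl, hfg]
      · rw [if_neg (not_le.2 hr')]
    have := h1.union h2
    rwa [Ici_union_Iic, hasDerivWithinAt_univ] at this
  · refine (hg h.le).congr_of_eventuallyEq ?_
    filter_upwards [gt_mem_nhds h] with r hr
    rw [if_neg (not_le.2 hr)]

namespace Phys

variable {n : ℕ} (D : Phys n)

/-- The arguments below `ψ_∞`. -/
def belowInf : Set ℝ := {r | (r : EReal) < D.psiInf}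

lemma isOpen_belowInf : IsOpen D.belowInf :=
  isOpen_lt continuous_coe_real_ereal continuous_const

lemma mem_belowInf_of_le {r s : ℝ} (hs : s ∈ D.belowInf) (h : r ≤ s) : r ∈ D.belowInf :=
  lt_of_le_of_lt (EReal.coe_le_coe_iff.2 h) hs

lemma eps_mem : D.eps ∈ D.belowInf := D.eps_lt

lemma convex_belowInf : Convex ℝ D.belowInf := by
  have : OrdConnected D.belowInf :=
    ⟨fun x _ y hy z hz => D.mem_belowInf_of_le hy hz.2⟩
  exact this.convex

lemma gam_domain_mem_nhds {r : ℝ} (h0 : 0 < r) (hr : r ∈ D.belowInf) :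
    {r : ℝ | 0 ≤ r ∧ (r : EReal) < D.psiInf} ∈ 𝓝 r := by
  filter_upwards [lt_mem_nhds h0, D.isOpen_belowInf.mem_nhds hr] with s h1 h2
  exact ⟨h1.le, h2⟩

lemma contDiffAt_gam {r : ℝ} (h0 : 0 < r) (hr : r ∈ D.belowInf) : ContDiffAt ℝ 1 D.gam r :=
  D.gam_smooth.contDiffAt (D.gam_domain_mem_nhds h0 hr)

lemma hasDerivAt_gam {r : ℝ} (h0 : 0 < r) (hr : r ∈ D.belowInf) :
    HasDerivAt D.gam (deriv D.gam r) r :=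
  ((D.contDiffAt_gam h0 hr).differentiableAt one_ne_zero).hasDerivAt

lemma deriv_gam_nonpos {r : ℝ} (h0 : 0 < r) (hr : r ∈ D.belowInf) : deriv D.gam r ≤ 0 := by
  rw [← derivWithin_of_mem_nhds (D.gam_domain_mem_nhds h0 hr)]
  exact D.gam_anti r h0.le hr

lemma continuousAt_deriv_gam {r : ℝ} (h0 : 0 < r) (hr : r ∈ D.belowInf) :
    ContinuousAt (deriv D.gam) r := by
  have hU : IsOpen (Ioi (0 : ℝ) ∩ D.belowInf) := isOpen_Ioi.inter D.isOpen_belowInf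
  have h : ContDiffOn ℝ 1 D.gam (Ioi (0 : ℝ) ∩ D.belowInf) :=
    D.gam_smooth.mono fun s hs => ⟨le_of_lt hs.1, hs.2⟩
  exact (h.continuousOn_deriv_of_isOpen hU le_rfl).continuousAt (hU.mem_nhds ⟨h0, hr⟩)

/-- Only first derivatives of `F` are assumed. Solving `γ = F - r F'` for `F' = (F - γ)/r` shows
that `F'` is differentiable, and differentiation gives `F'' = -γ'/r`, which is nonnegative because
`γ` decreases. -/
lemma hasDerivAt_deriv_F {r : ℝ} (h0 : 0 < r) (hr : r ∈ D.belowInf) :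
    HasDerivAt (deriv D.F) (-(deriv D.gam r) / r) r := by
  have h1 : HasDerivAt (fun s => (D.F s - D.gam s) / s)
      (((deriv D.F r - deriv D.gam r) * r - (D.F r - D.gam r) * 1) / r ^ 2) r :=
    ((D.F_diff r h0 hr).hasDerivAt.sub (D.hasDerivAt_gam h0 hr)).div (hasDerivAt_id r) h0.ne'
  have h2 : deriv D.F =ᶠ[𝓝 r] fun s => (D.F s - D.gam s) / s := by
    filter_upwards [lt_mem_nhds h0, D.isOpen_belowInf.mem_nhds hr] with s hs hs'
    rw [D.F_eq s hs hs']
    field_simp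
    ring
  refine (h1.congr_of_eventuallyEq h2).congr_deriv ?_
  rw [D.F_eq r h0 hr]
  field_simp
  ring

/-- The derivative of `F_ε`. -/
noncomputable def dFeps (r : ℝ) : ℝ :=
  if D.eps ≤ r then deriv D.F r
  else deriv D.F D.eps + deriv (deriv D.F) D.eps * (r - D.eps)

/-- The second derivative of `F_ε`. -/
noncomputable def ddFeps (r : ℝ) : ℝ := -(deriv D.gam (max r D.eps)) / max r D.eps

lemma max_eps_mem {r : ℝ} (hr : r ∈ D.belowInf) : max r D.eps ∈ D.belowInf := by
  rcases max_choice r D.eps with h | h <;> rw [h]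
  exacts [hr, D.eps_mem]

lemma max_eps_pos (r : ℝ) : 0 < max r D.eps := lt_max_of_lt_right D.eps_pos

lemma ddFeps_nonneg {r : ℝ} (hr : r ∈ D.belowInf) : 0 ≤ D.ddFeps r :=
  div_nonneg (neg_nonneg.2 (D.deriv_gam_nonpos (D.max_eps_pos r) (D.max_eps_mem hr)))
    (D.max_eps_pos r).le

/-- The maximum with `ε` covers both branches at once, since `F_ε''` is constant below `ε`. It also
keeps the argument positive, away from the boundary point `0` of the domain of `γ`. -/
lemma continuousOn_ddFeps : ContinuousOn D.ddFeps D.belowInf := by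
  intro r hr
  refine ContinuousAt.continuousWithinAt ?_
  have hm : ContinuousAt (fun s => max s D.eps) r := by fun_prop
  have h1 : ContinuousAt (fun s => deriv D.gam (max s D.eps)) r :=
    ContinuousAt.comp (g := deriv D.gam) (f := fun s => max s D.eps)
      (D.continuousAt_deriv_gam (D.max_eps_pos r) (D.max_eps_mem hr)) hm
  exact h1.neg.div hm (D.max_eps_pos r).ne'

lemma hasDerivAt_Feps {r : ℝ} (hr : r ∈ D.belowInf) : HasDerivAt D.Feps (D.dFeps r) r := by
  refine hasDerivAt_ite_le (fun h => ?_) (fun h => ?_) (by simp)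
  · rw [dFeps, if_pos h]
    exact (D.F_diff r (D.eps_pos.trans_le h) hr).hasDerivAt
  · have h1 := (hasDerivAt_id r).sub_const D.eps
    have h2 := ((h1.const_mul (deriv D.F D.eps)).const_add (D.F D.eps)).add
      ((h1.pow 2).const_mul (1 / 2 * deriv (deriv D.F) D.eps))
    refine h2.congr_deriv ?_
    rcases eq_or_lt_of_le h with rfl | h'
    · simp [dFeps]
    · rw [dFeps, if_neg (not_le.2 h')]
      simp
      ring

lemma hasDerivAt_dFeps {r : ℝ} (hr : r ∈ D.belowInf) : HasDerivAt D.dFeps (D.ddFeps r) r := by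
  refine hasDerivAt_ite_le (fun h => ?_) (fun h => ?_) (by simp)
  · rw [ddFeps, max_eq_left h]
    exact D.hasDerivAt_deriv_F (D.eps_pos.trans_le h) hr
  · have h1 := (hasDerivAt_id r).sub_const D.eps
    have h2 := (h1.const_mul (deriv (deriv D.F) D.eps)).const_add (deriv D.F D.eps)
    refine h2.congr_deriv ?_
    rw [ddFeps, max_eq_right h, (D.hasDerivAt_deriv_F D.eps_pos D.eps_mem).deriv]
    ring

lemma deriv_Feps {r : ℝ} (hr : r ∈ D.belowInf) : deriv D.Feps r = D.dFeps r :=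
  (D.hasDerivAt_Feps hr).deriv

/-- The regularization keeps the relation between energy and tension, and extends it to all
arguments below `ψ_∞`, negative ones included. -/
lemma gamEps_eq {r : ℝ} (hr : r ∈ D.belowInf) : D.gamEps r = D.Feps r - r * D.dFeps r := by
  unfold gamEps Feps dFeps
  split_ifs with h
  · exact D.F_eq r (D.eps_pos.trans_le h) hr
  · rw [D.F_eq D.eps D.eps_pos D.eps_mem]
    ring

lemma hasDerivAt_gamEps {r : ℝ} (hr : r ∈ D.belowInf) :
    HasDerivAt D.gamEps (-(r * D.ddFeps r)) r := by
  have h1 := (D.hasDerivAt_Feps hr).sub ((hasDerivAt_id r).mul (D.hasDerivAt_dFeps hr))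
  have h2 : D.gamEps =ᶠ[𝓝 r] fun s => D.Feps s - s * D.dFeps s := by
    filter_upwards [D.isOpen_belowInf.mem_nhds hr] with s hs
    exact D.gamEps_eq hs
  refine (HasDerivAt.congr_of_eventuallyEq h1 h2).congr_deriv ?_
  simp

lemma contDiffOn_dFeps : ContDiffOn ℝ 1 D.dFeps D.belowInf := by
  rw [show (1 : WithTop ℕ∞) = 0 + 1 from rfl, contDiffOn_succ_iff_deriv_of_isOpen D.isOpen_belowInf]
  refine ⟨fun r hr => (D.hasDerivAt_dFeps hr).differentiableAt.differentiableWithinAt, by simp, ?_⟩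
  rw [contDiffOn_zero]
  exact D.continuousOn_ddFeps.congr fun r hr => (D.hasDerivAt_dFeps hr).deriv

/-- Makes the nodal values `F_ε'(Ψ)` continuously differentiable in time, hence an admissible test
function in (f). -/
lemma contDiffOn_deriv_Feps : ContDiffOn ℝ 1 (deriv D.Feps) D.belowInf :=
  D.contDiffOn_dFeps.congr fun _ hr => D.deriv_Feps hr

lemma hasDerivAt_deriv_Feps {r : ℝ} (hr : r ∈ D.belowInf) :
    HasDerivAt (deriv D.Feps) (D.ddFeps r) r := by
  refine (D.hasDerivAt_dFeps hr).congr_of_eventuallyEq ?_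
  filter_upwards [D.isOpen_belowInf.mem_nhds hr] with s hs
  exact D.deriv_Feps hs

/-- Convexity of `F_ε`, which gives the diffusion term its sign. -/
lemma monotoneOn_deriv_Feps : MonotoneOn (deriv D.Feps) D.belowInf := by
  refine monotoneOn_of_deriv_nonneg D.convex_belowInf D.contDiffOn_deriv_Feps.continuousOn
    (fun r hr => ?_) fun r hr => ?_
  · exact (D.hasDerivAt_deriv_Feps (interior_subset hr)).differentiableAt.differentiableWithinAt
  · rw [(D.hasDerivAt_deriv_Feps (interior_subset hr)).deriv]
    exact D.ddFeps_nonneg (interior_subset hr)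

/-- Where `F_ε'` does not change, neither does `γ_ε`. -/
lemma gamEps_eq_of_deriv_Feps_eq {a b : ℝ} (hb : b ∈ D.belowInf) (hab : a ≤ b)
    (h : deriv D.Feps a = deriv D.Feps b) : D.gamEps a = D.gamEps b := by
  have hsub : Icc a b ⊆ D.belowInf := fun x hx => D.mem_belowInf_of_le hb hx.2
  -- A monotone function with equal end values is constant, so `F_ε''` vanishes in between.
  have hc : ∀ x ∈ Icc a b, deriv D.Feps x = deriv D.Feps a := fun x hx =>
    le_antisymm ((D.monotoneOn_deriv_Feps (hsub hx) hb hx.2).trans h.ge)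
      (D.monotoneOn_deriv_Feps (hsub ⟨le_rfl, hab⟩) (hsub hx) hx.1)
  rcases eq_or_lt_of_le hab with rfl | hlt
  · rfl
  have hz : ∀ x ∈ Ioo a b, D.ddFeps x = 0 := fun x hx => by
    have h1 : deriv D.Feps =ᶠ[𝓝 x] fun _ => deriv D.Feps a := by
      filter_upwards [Ioo_mem_nhds hx.1 hx.2] with y hy
      exact hc y ⟨hy.1.le, hy.2.le⟩
    have h2 := (D.hasDerivAt_deriv_Feps (hsub ⟨hx.1.le, hx.2.le⟩)).congr_of_eventuallyEq h1.symm
    exact h2.unique (hasDerivAt_const x _)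
  -- Mean value theorem, with `γ_ε' = -r F_ε'' = 0` at the intermediate point.
  obtain ⟨c, hcm, hce⟩ := exists_hasDerivAt_eq_slope D.gamEps (fun r => -(r * D.ddFeps r)) hlt
    (fun x hx => (D.hasDerivAt_gamEps (hsub hx)).continuousAt.continuousWithinAt)
    (fun x hx => D.hasDerivAt_gamEps (hsub ⟨hx.1.le, hx.2.le⟩))
  rw [hz c hcm, mul_zero, neg_zero, eq_comm, div_eq_zero_iff] at hce
  rcases hce with h | h <;> linarith

end Phys

/-- The choice of `Ψ^h_{⋆,ε}` turns the convective term into the gradient of `γ_ε`. -/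
lemma psiStar_mul_surfGrad {D : Phys 1} {p : Fin 2 → Vec 1} (hp : AffineIndependent ℝ p)
    {z : Fin 2 → ℝ} (hz : ∀ k, z k ∈ D.belowInf) (k : Fin 2) :
    D.psiStar z k • surfGrad p (fun k => deriv D.Feps (z k)) =
      -surfGrad p (fun k => D.gamEps (z k)) := by
  -- Both gradients are multiples of the edge, so a scalar identity for nodal differences is enough.
  rw [surfGrad_segment hp, surfGrad_segment hp, smul_smul, ← neg_smul]
  congr 1
  have hl : (Fin.last 1) = (1 : Fin 2) := rfl
  simp only [Phys.psiStar, if_true, hl]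
  split_ifs with h
  · have h' : deriv D.Feps (z 1) - deriv D.Feps (z 0) ≠ 0 := sub_ne_zero.2 (Ne.symm h)
    field_simp
  -- In the second case of the definition the left side is zero whatever the value of `Ψ_⋆`, so
  -- `γ_ε` must agree at the two nodes.
  · rw [not_not] at h
    have : D.gamEps (z 0) = D.gamEps (z 1) := by
      rcases le_total (z 0) (z 1) with h' | h'
      · exact D.gamEps_eq_of_deriv_Feps_eq (hz 1) h' h
      · exact (D.gamEps_eq_of_deriv_Feps_eq (hz 0) h' h.symm).symm
    rw [h, this]
    simp

/-- The two gradients are parallel to the edge, and by monotonicity of `F_ε'` their coefficients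
never have opposite signs. -/
lemma inner_surfGrad_deriv_Feps_nonneg {D : Phys 1} {p : Fin 2 → Vec 1}
    (hp : AffineIndependent ℝ p) {z : Fin 2 → ℝ} (hz : ∀ k, z k ∈ D.belowInf) :
    0 ≤ inner ℝ (surfGrad p z) (surfGrad p (fun k => deriv D.Feps (z k))) := by
  rw [surfGrad_segment hp, surfGrad_segment hp, inner_smul_left, inner_smul_right,
    real_inner_self_eq_norm_sq, conj_trivial]
  have h : 0 ≤ (z 1 - z 0) * (deriv D.Feps (z 1) - deriv D.Feps (z 0)) := by
    rcases le_total (z 0) (z 1) with h' | h'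
    · exact mul_nonneg (sub_nonneg.2 h') (sub_nonneg.2 (D.monotoneOn_deriv_Feps (hz 0) (hz 1) h'))
    · exact mul_nonneg_of_nonpos_of_nonpos (sub_nonpos.2 h')
        (sub_nonpos.2 (D.monotoneOn_deriv_Feps (hz 1) (hz 0) h'))
  rw [show (z 1 - z 0) / ‖p 1 - p 0‖ ^ 2 * ((deriv D.Feps (z 1) - deriv D.Feps (z 0)) /
      ‖p 1 - p 0‖ ^ 2 * ‖p 1 - p 0‖ ^ 2) = (z 1 - z 0) * (deriv D.Feps (z 1) - deriv D.Feps (z 0)) *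
        (‖p 1 - p 0‖ ^ 2 / (‖p 1 - p 0‖ ^ 2 * ‖p 1 - p 0‖ ^ 2)) by ring]
  positivity

end RegularizedEnergy

/-! ### The energy inequality in two dimensions. -/

section Energy

lemma ae_hasDerivAt_of_absolutelyContinuous {n : ℕ} {T : ℝ} (hT : 0 < T) {f : ℝ → Vec n}
    (hf : AbsolutelyContinuousOnInterval f 0 T) :
    ∀ᵐ t ∂(volume.restrict (Ioo 0 T)), HasDerivAt f (deriv f t) t := by
  rw [ae_restrict_iff' measurableSet_Ioo]
  have h : ∀ i, ∀ᵐ t : ℝ, t ∈ uIcc 0 T → DifferentiableAt ℝ (fun s => f s i) t := fun i =>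
    (hf.contDiff_comp (g := fun x : Vec n => x i) (by fun_prop)).ae_differentiableAt
  filter_upwards [ae_all_iff.2 h] with t ht htm
  have htm' : t ∈ uIcc 0 T := by
    rw [uIcc_of_le hT.le]
    exact ⟨htm.1.le, htm.2.le⟩
  exact (differentiableAt_euclidean.2 fun i => ht i htm').hasDerivAt

lemma State.IsSolution.ae_hasDerivAt_q {n J K : ℕ} {S : Setup n} {D : Phys n}
    {m : SurfMesh n J K} {X : State S K} (hX : X.IsSolution D m) :
    ∀ᵐ t ∂(volume.restrict (Ioo 0 S.T)), ∀ k, HasDerivAt (fun s => X.q s k) (X.V t k) t :=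
  ae_all_iff.2 fun k => ae_hasDerivAt_of_absolutelyContinuous S.T_pos (hX.q_ac k)

lemma MemWT.hasDerivAt {K : ℕ} {T t : ℝ} {z : ℝ → Fin K → ℝ} (hz : MemWT T z)
    (ht : t ∈ Ioo 0 T) (k : Fin K) : HasDerivAt (fun s => z s k) (deriv (fun s => z s k) t) t :=
  (((contDiffOn_pi.1 hz k).contDiffAt (Icc_mem_nhds ht.1 ht.2)).differentiableAt
    one_ne_zero).hasDerivAt

variable {J K : ℕ}

/-- Discrete transport theorem: the product rule, with the change of length expressed by the
divergence of the mesh velocity. -/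
lemma SurfMesh.hasDerivAt_lumped {m : SurfMesh 1 J K} {q : ℝ → Fin K → Vec 1} {v : Fin K → Vec 1}
    {t : ℝ} (hq : ∀ k, HasDerivAt (fun s => q s k) (v k) t)
    (hp : ∀ j, AffineIndependent ℝ (m.loc (q t) j)) {z : ℝ → Fin K → ℝ} {z' : Fin K → ℝ}
    (hz : ∀ k, HasDerivAt (fun s => z s k) (z' k) t) :
    HasDerivAt (fun s => m.lumped (q s) fun j k => m.loc (z s) j k)
      (m.lumped (q t) fun j k =>
        surfDiv (m.loc (q t) j) (m.loc v j) * m.loc (z t) j k + m.loc z' j k) t := by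
  unfold SurfMesh.lumped
  refine HasDerivAt.const_mul _ ?_
  refine HasDerivAt.fun_sum fun j _ => ?_
  have h1 := hasDerivAt_area_segment (q := fun s => m.loc (q s) j) (v := m.loc v j) (t := t)
    (fun k => hq (m.vert j k)) (hp j)
  have h2 : HasDerivAt (fun s => ∑ k, m.loc (z s) j k) (∑ k, m.loc z' j k) t :=
    HasDerivAt.fun_sum fun k _ => hz (m.vert j k)
  refine (h1.mul h2).congr_deriv ?_
  rw [Finset.sum_add_distrib, ← Finset.mul_sum]
  ring

variable {S : Setup 1} {D : Phys 1} {m : SurfMesh 1 J K} {X : State S K}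

/-- The transport of the surface material density, tested with the kinetic energy density. -/
lemma State.IsSolution.kinetic_identity (hX : X.IsSolution D m) :
    ∀ᵐ t ∂(volume.restrict (Ioo 0 S.T)), HasDerivAt (fun s => 1 / 2 * X.surfMom m s (X.U s) (X.U s))
      (m.lumped (X.q t) (fun j k => m.loc (X.rhoG t) j k *
          inner ℝ (m.loc (X.nodal t (X.U t)) j k)
            (m.loc (fun k => deriv (fun s => X.nodal s (X.U s) k) t) j k))
        - ∑ i : Fin 2, m.lumped (X.q t) (fun j k =>
          rhoStar (m.loc (X.q t) j) (m.loc (X.rhoG t) j) *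
            inner ℝ (m.loc (X.V t) j k - m.loc (X.nodal t (X.U t)) j k)
              (WithLp.toLp 2
                (xiMat (m.loc (X.q t) j) (m.loc (fun k => X.nodal t (X.U t) k i) j) *ᵥ
                  (surfGrad (m.loc (X.q t) j)
                    (m.loc (fun k => X.nodal t (X.U t) k i) j)).ofLp)))) t := by
  -- The test function for (a) is the interpolant of `|U|²/2`; the required regularity in time is
  -- that of the velocity at the moving nodes.
  set ζ : ℝ → Fin K → ℝ := fun s k => 1 / 2 * ‖X.nodal s (X.U s) k‖ ^ 2 with hζdef
  have hζ : MemWT S.T ζ := by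
    refine contDiffOn_pi.2 fun k => ?_
    exact contDiffOn_const.mul ((hX.U_trace k).norm_sq ℝ)
  filter_upwards [hX.eq_a ζ hζ, ae_restrict_mem measurableSet_Ioo] with t ht htm
  have htI : t ∈ Icc 0 S.T := ⟨htm.1.le, htm.2.le⟩
  have hfun : (fun s => 1 / 2 * X.surfMom m s (X.U s) (X.U s)) =
      fun s => m.lumped (X.q s) fun j k => m.loc (X.rhoG s) j k * m.loc (ζ s) j k := by
    funext s
    rw [State.surfMom, ← SurfMesh.lumped_const_mul]
    congr 1
    funext j k
    simp only [hζdef, SurfMesh.loc, real_inner_self_eq_norm_sq]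
    ring
  rw [hfun]
  refine ht.congr_deriv ?_
  congr 1
  · congr 1
    funext j k
    congr 1
    have hd : DifferentiableAt ℝ (fun s => X.nodal s (X.U s) (m.vert j k)) t :=
      ((hX.U_trace (m.vert j k)).contDiffAt (Icc_mem_nhds htm.1 htm.2)).differentiableAt one_ne_zero
    have h1 := (hd.hasDerivAt.norm_sq).const_mul (1 / 2 : ℝ)
    have h2 := h1.deriv
    simp only [SurfMesh.loc, hζdef] at h2 ⊢
    rw [h2]
    ring
  · rw [← SurfMesh.lumped_sum]
    congr 1
    funext j k
    -- The chain rule `xiMat_mulVec_surfGrad` for each component of `U` sums to the surface gradient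
    -- of the interpolated `|U|²/2`.
    rw [← Finset.mul_sum, ← inner_sum]
    congr 2
    have hp := (hX.interface t htI).nondegenerate j
    simp_rw [xiMat_mulVec_surfGrad hp]
    rw [← surfGrad_sum]
    congr 1
    funext l
    simp only [SurfMesh.loc, hζdef, EuclideanSpace.norm_sq_eq, Finset.mul_sum, Real.norm_eq_abs,
      sq_abs]

/-- The evolution of the interfacial energy along solutions. -/
lemma State.IsSolution.surfaceEnergy_identity (hX : X.IsSolution D m)
    (hPsi : ∀ t ∈ Icc 0 S.T, ∀ k, X.Psi t k ∈ D.belowInf) :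
    ∀ᵐ t ∂(volume.restrict (Ioo 0 S.T)),
      ∃ c, HasDerivAt (fun s => m.lumped (X.q s) fun j k => D.Feps (m.loc (X.Psi s) j k)) c t ∧
        c + m.surfInt (X.q t) (fun j l =>
          lin (m.loc (fun k => D.gamEps (X.Psi t k) * X.kap t k) j) l *
            inner ℝ (unitNormal (m.loc (X.q t) j)) (X.U t (lin (m.loc (X.q t) j) l)))
        + m.lumped (X.q t) (fun j k =>
          inner ℝ (surfGrad (m.loc (X.q t) j) (m.loc (fun k => D.gamEps (X.Psi t k)) j))
            (m.loc (X.nodal t (X.U t)) j k)) ≤ 0 := by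
  -- Test function `F_ε'(Ψ)` for (f).
  have hχ : MemWT S.T fun s k => deriv D.Feps (X.Psi s k) :=
    contDiffOn_pi.2 fun k => D.contDiffOn_deriv_Feps.comp (contDiffOn_pi.1 hX.Psi_mem k)
      fun s hs => hPsi s hs k
  filter_upwards [hX.eq_d, hX.eq_e, hX.eq_f _ hχ, hX.ae_hasDerivAt_q,
    ae_restrict_mem measurableSet_Ioo] with t hd he hf hq htm
  have htI : t ∈ Icc 0 S.T := ⟨htm.1.le, htm.2.le⟩
  have hp := (hX.interface t htI).nondegenerate
  have hz := hPsi t htI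
  have hPsi' := fun k => hX.Psi_mem.hasDerivAt htm k
  have hγ : ∀ k, HasDerivAt (fun s => D.gamEps (X.Psi s k))
      (-(X.Psi t k * D.ddFeps (X.Psi t k)) * deriv (fun s => X.Psi s k) t) t := fun k =>
    HasDerivAt.comp (h₂ := D.gamEps) t (D.hasDerivAt_gamEps (hz k)) (hPsi' k)
  have hF : ∀ k, deriv (fun s => deriv D.Feps (X.Psi s k)) t =
      D.ddFeps (X.Psi t k) * deriv (fun s => X.Psi s k) t := fun k =>
    (HasDerivAt.comp (h₂ := deriv D.Feps) t (D.hasDerivAt_deriv_Feps (hz k)) (hPsi' k)).deriv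
  -- The energy is the sum of `γ_ε(Ψ)` and `Ψ F_ε'(Ψ)`: the first is differentiated by the transport
  -- theorem, the second by (f).
  have h1 := SurfMesh.hasDerivAt_lumped hq hp hγ
  have h2 := h1.add hf
  refine ⟨_, h2.congr_of_eventuallyEq ?_, ?_⟩
  · filter_upwards [Icc_mem_nhds htm.1 htm.2] with s hs
    simp only [Pi.add_apply]
    rw [← SurfMesh.lumped_add]
    congr 1
    funext j k
    have hmem := hPsi s hs (m.vert j k)
    simp only [SurfMesh.loc]
    rw [D.gamEps_eq hmem, D.deriv_Feps hmem]
    ring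
  set γ : Fin K → ℝ := fun k => D.gamEps (X.Psi t k) with hγdef
  set G : Fin J → Vec 1 := fun j => surfGrad (m.loc (X.q t) j) (m.loc γ j) with hG
  -- the curvature term
  have hK : m.surfInt (X.q t) (fun j l =>
        lin (m.loc (fun k => D.gamEps (X.Psi t k) * X.kap t k) j) l *
          inner ℝ (unitNormal (m.loc (X.q t) j)) (X.U t (lin (m.loc (X.q t) j) l)))
      = m.lumped (X.q t) (fun j k => inner ℝ (m.loc (X.kap t) j k • unitNormal (m.loc (X.q t) j))
          (m.loc (fun k => γ k • X.V t k) j k)) := by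
    -- Equation (d) with the interpolant of `γ_ε κ` exchanges the fluid velocity for the mesh
    -- velocity.
    have := hd fun k => γ k * X.kap t k
    simp only [inner_smul_right] at this
    rw [show (fun j l => lin (m.loc (fun k => D.gamEps (X.Psi t k) * X.kap t k) j) l *
          inner ℝ (unitNormal (m.loc (X.q t) j)) (X.U t (lin (m.loc (X.q t) j) l)))
        = (fun j l => lin (m.loc (fun k => γ k * X.kap t k) j) l *
          inner ℝ (X.U t (lin (m.loc (X.q t) j) l)) (unitNormal (m.loc (X.q t) j))) from by
        funext j l
        rw [real_inner_comm], ← this]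
    congr 1
    funext j k
    simp only [SurfMesh.loc, inner_smul_left, inner_smul_right, conj_trivial]
    rw [real_inner_comm]
    ring
  -- Equation (e) with the interpolant of `γ_ε 𝒱`, whose lumped term is the right-hand side of `hK`.
  have hE := he fun k => γ k • X.V t k
  -- the divergence of the interpolant of `γ V`
  have hdiv : m.surfInt (X.q t) (fun j _ =>
        frob (surfJac (m.loc (X.q t) j) (m.loc (X.q t) j))
          (surfJac (m.loc (X.q t) j) (m.loc (fun k => γ k • X.V t k) j)))
      = m.lumped (X.q t) (fun j k => surfDiv (m.loc (X.q t) j) (m.loc (X.V t) j) * m.loc γ j k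
          + inner ℝ (m.loc (X.V t) j k) (G j)) := by
    unfold SurfMesh.surfInt SurfMesh.lumped
    rw [Finset.mul_sum]
    refine Finset.sum_congr rfl fun j _ => ?_
    rw [simplexInt_const (Or.inl rfl), frob_surfJac_segment (hp j),
      sum_surfDiv_mul_add_inner (hp j)]
    simp only [Nat.cast_one]
    rw [show m.loc (fun k => γ k • X.V t k) j = fun k => m.loc γ j k • m.loc (X.V t) j k from rfl]
    ring
  -- The convective term becomes the Marangoni force of the momentum equation minus the term by
  -- which `hdiv` completes the divergence of `γ_ε 𝒱`.
  have hstar : m.lumped (X.q t) (fun j k => D.psiStar (m.loc (X.Psi t) j) k *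
        inner ℝ (m.loc (X.V t) j k - m.loc (X.nodal t (X.U t)) j k)
          (surfGrad (m.loc (X.q t) j) (m.loc (fun k => deriv D.Feps (X.Psi t k)) j)))
      = m.lumped (X.q t) (fun j k => inner ℝ (G j) (m.loc (X.nodal t (X.U t)) j k))
        - m.lumped (X.q t) (fun j k => inner ℝ (m.loc (X.V t) j k) (G j)) := by
    rw [← SurfMesh.lumped_sub]
    congr 1
    funext j k
    rw [← inner_smul_right (𝕜 := ℝ)]
    have := psiStar_mul_surfGrad (D := D) (hp j) (z := m.loc (X.Psi t) j)
      (fun k => hz (m.vert j k)) k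
    rw [show m.loc (fun k => deriv D.Feps (X.Psi t k)) j =
      fun k => deriv D.Feps (m.loc (X.Psi t) j k) from rfl, this,
      show (fun k => D.gamEps (m.loc (X.Psi t) j k)) = m.loc γ j from rfl, inner_neg_right,
      inner_sub_left, real_inner_comm (G j) (m.loc (X.nodal t (X.U t)) j k)]
    ring
  -- The time derivatives of `Ψ` cancel because `γ_ε' = -r F_ε''`.
  have hcancel : m.lumped (X.q t) (fun j k =>
        surfDiv (m.loc (X.q t) j) (m.loc (X.V t) j) * m.loc γ j k +
          m.loc (fun k => -(X.Psi t k * D.ddFeps (X.Psi t k)) * deriv (fun s => X.Psi s k) t) j k)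
      + m.lumped (X.q t) (fun j k => m.loc (X.Psi t) j k *
          m.loc (fun k => deriv (fun s => deriv D.Feps (X.Psi s k)) t) j k)
      = m.lumped (X.q t) (fun j k =>
          surfDiv (m.loc (X.q t) j) (m.loc (X.V t) j) * m.loc γ j k) := by
    rw [← SurfMesh.lumped_add]
    congr 1
    funext j k
    simp only [SurfMesh.loc, hF]
    ring
  -- The only term that is dropped; apart from it the balance is an equality.
  have hdiff : 0 ≤ D.diff * m.surfInt (X.q t) (fun j _ =>
      inner ℝ (surfGrad (m.loc (X.q t) j) (m.loc (X.Psi t) j))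
        (surfGrad (m.loc (X.q t) j) (m.loc (fun k => deriv D.Feps (X.Psi t k)) j))) := by
    refine mul_nonneg D.diff_nonneg (Finset.sum_nonneg fun j _ => ?_)
    rw [simplexInt_const (Or.inl rfl)]
    exact mul_nonneg (area_nonneg _) (inner_surfGrad_deriv_Feps_nonneg (D := D) (hp j)
      fun k => hz (m.vert j k))
  rw [hdiv, SurfMesh.lumped_add] at hE
  rw [hK, hstar]
  linarith [hcancel, hE, hdiff]

/-- The energy inequality. -/
lemma State.IsSolution.energy_inequality (hX : X.IsSolution D m)
    (hPsi : ∀ t ∈ Icc 0 S.T, ∀ k, (X.Psi t k : EReal) < D.psiInf) :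
    ∀ᵐ t ∂(volume.restrict (Ioo 0 S.T)), ∃ e : ℝ,
      HasDerivAt (fun s => X.energy D m s) e t ∧
      e + X.dissipation D m t ≤ X.forcing D t (X.U t) := by
  filter_upwards [hX.surfaceEnergy_identity hPsi, hX.kinetic_identity, hX.eq_b X.U hX.U_mem,
    hX.eq_c, hX.P_mem_Ph, ae_restrict_mem measurableSet_Ioo]
    with t ⟨c, hc, hcle⟩ hkin ⟨a, b, ha, hb, hmom⟩ hdiv hP htm
  have htI : t ∈ Icc 0 S.T := ⟨htm.1.le, htm.2.le⟩
  have hp := (hX.interface t htI).nondegenerate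
  have hrho : ∀ s x, 0 ≤ X.rhoh D s x := by
    intro s x
    unfold State.rhoh BulkMesh.coeff
    refine Finset.sum_nonneg fun j _ => indicator_nonneg (f := fun _ => (_ : ℝ)) (fun _ _ => ?_) _
    unfold elemCoeff
    have := D.rhoM_pos
    have := D.rhoP_pos
    split_ifs <;> linarith
  have hbulk : (fun s => 1 / 2 * ∫ x in S.Ω, ‖√(X.rhoh D s x) • X.U s x‖ ^ 2) =
      fun s => 1 / 2 * ∫ x in S.Ω, X.rhoh D s x * inner ℝ (X.U s x) (X.U s x) := by
    funext s
    congr 1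
    refine integral_congr_ae (Eventually.of_forall fun x => ?_)
    simp only
    rw [norm_smul, mul_pow, Real.norm_of_nonneg (Real.sqrt_nonneg _), Real.sq_sqrt (hrho s x),
      real_inner_self_eq_norm_sq]
  refine ⟨1 / 2 * a + 1 / 2 * b + c, ?_, ?_⟩
  · have h1 := ha.const_mul (1 / 2 : ℝ)
    rw [← hbulk] at h1
    exact (h1.add (hb.const_mul (1 / 2 : ℝ))).add hc
  -- The surface terms on the right of (b) equal half of `b`, so the other half of `b` remains as
  -- the derivative of the surface kinetic energy.
  have hbk := (hb.const_mul (1 / 2 : ℝ)).unique hkin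
  have hpress : ∫ x in S.Ω, X.P t x * divg (X.U t) x = 0 := by
    simp_rw [mul_comm]
    exact hdiv _ hP.1 hP.2
  have htd : ∫ x in S.Ω, X.rhoh D t x * inner ℝ (timeDeriv X.U t x) (X.U t x) =
      ∫ x in S.Ω, X.rhoh D t x * inner ℝ (X.U t x) (timeDeriv X.U t x) := by
    simp_rw [real_inner_comm]
  -- With the velocity as test function, the skew-symmetric convective integrand vanishes pointwise.
  simp only [sub_self, mul_zero, integral_zero] at hmom
  rw [hpress, htd] at hmom
  have hdis : 2 * m.lumped (X.q t) (fun j k => D.muS (m.loc (X.Psi t) j k) *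
          frob (surfD (m.loc (X.q t) j) (m.loc (X.nodal t (X.U t)) j))
            (surfD (m.loc (X.q t) j) (m.loc (X.nodal t (X.U t)) j)))
      + m.lumped (X.q t) (fun j k => D.lamS (m.loc (X.Psi t) j k) *
          (surfDiv (m.loc (X.q t) j) (m.loc (X.nodal t (X.U t)) j) *
            surfDiv (m.loc (X.q t) j) (m.loc (X.nodal t (X.U t)) j)))
      = 2 * m.lumped (X.q t) (fun j k => D.muS (m.loc (X.Psi t) j k) *
          frob (surfDdev (m.loc (X.q t) j) (m.loc (X.nodal t (X.U t)) j))
            (surfDdev (m.loc (X.q t) j) (m.loc (X.nodal t (X.U t)) j)))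
      + m.lumped (X.q t) (fun j k =>
          (D.lamS (m.loc (X.Psi t) j k) + 2 / ((1 : ℕ) : ℝ) * D.muS (m.loc (X.Psi t) j k)) *
          (surfDiv (m.loc (X.q t) j) (m.loc (X.nodal t (X.U t)) j) *
            surfDiv (m.loc (X.q t) j) (m.loc (X.nodal t (X.U t)) j))) := by
    rw [← SurfMesh.lumped_const_mul, ← SurfMesh.lumped_const_mul, ← SurfMesh.lumped_add,
      ← SurfMesh.lumped_add]
    congr 1
    funext j k
    rw [frob_surfD_self one_ne_zero (hp j)]
    ring
  unfold State.dissipation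
  linarith

end Energy

/-! ### The fundamental theorem of calculus on subsets of the line with finitely many boundary
points. -/

section Line

lemma _root_.IsPreconnected.subset_or_disjoint_of_disjoint_frontier {X : Type*}
    [TopologicalSpace X] {s B : Set X} (hs : IsPreconnected s) (h : ∀ x ∈ s, x ∉ frontier B) :
    s ⊆ B ∨ s ⊆ Bᶜ := by
  have hcov : s ⊆ interior B ∪ interior Bᶜ := by
    intro x hx
    have := h x hx
    rw [← mem_compl_iff, compl_frontier_eq_union_interior] at this
    exact this
  have hdis : Disjoint (interior B) (interior Bᶜ) :=
    disjoint_compl_right.mono interior_subset interior_subset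
  rcases hs.subset_or_subset isOpen_interior isOpen_interior hdis hcov with h1 | h1
  · exact Or.inl (h1.trans interior_subset)
  · exact Or.inr (h1.trans interior_subset)

variable {B : Set ℝ} {φ ψ σ : ℝ → ℝ}

/-- The countable exceptional set is there for finite element functions, which on a line are only
piecewise smooth. -/
lemma setIntegral_Ioo_eq_sub_of_subset {C : Set ℝ} (hC : C.Countable)
    (hφ : ContinuousOn φ (closure B)) (hd : ∀ r ∉ C, r ∈ B → HasDerivAt φ (ψ r) r)
    (hint : IntegrableOn ψ B) {a b : ℝ} (hab : a < b) (h : Ioo a b ⊆ B) :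
    ∫ r in Ioo a b, ψ r = φ b - φ a := by
  have hcl : Icc a b ⊆ closure B := by
    rw [← closure_Ioo hab.ne]
    exact closure_mono h
  rw [← integral_Ioc_eq_integral_Ioo, ← intervalIntegral.integral_of_le hab.le]
  refine integral_eq_of_hasDerivAt_off_countable_of_le φ ψ hab.le hC (hφ.mono hcl)
    (fun x hx => hd x hx.2 (h hx.1)) ?_
  rw [intervalIntegrable_iff_integrableOn_Ioo_of_le hab.le]
  exact hint.mono_set h

/-- Induction on the jump set, adding its largest element `a`. Between `a` and `R` the set is
everything or nothing, according to the direction of the jump at `a`. The extra term `φ R` records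
that the set is still running at `R`, and both alternatives at `R` are needed to carry the
induction. -/
lemma setIntegral_inter_Iio_of_jumps (hB : ∃ L, ∀ r ∈ B, L ≤ r) {C : Set ℝ} (hC : C.Countable)
    (hφ : ContinuousOn φ (closure B)) (hd : ∀ r ∉ C, r ∈ B → HasDerivAt φ (ψ r) r)
    (hint : IntegrableOn ψ B) (H : Finset ℝ) :
    ∀ R, (∀ h ∈ H, h < R) → (∀ r < R, r ∉ H → r ∉ frontier B) →
    (∀ h ∈ H, (σ h = 1 ∧ (∀ᶠ r in 𝓝[<] h, r ∈ B) ∧ ∀ᶠ r in 𝓝[>] h, r ∉ B) ∨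
      (σ h = -1 ∧ (∀ᶠ r in 𝓝[<] h, r ∉ B) ∧ ∀ᶠ r in 𝓝[>] h, r ∈ B)) →
    ((∀ᶠ r in 𝓝[<] R, r ∈ B) → ∫ r in B ∩ Iio R, ψ r = ∑ h ∈ H, σ h * φ h + φ R) ∧
    ((∀ᶠ r in 𝓝[<] R, r ∉ B) → ∫ r in B ∩ Iio R, ψ r = ∑ h ∈ H, σ h * φ h) := by
  induction H using Finset.induction_on_max with
  | empty =>
    intro R _ hfr _
    have hpc := isPreconnected_Iio (a := R)
    obtain ⟨L, hL⟩ := hB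
    -- Without jumps a whole half-line lies in `B` or in its complement; the lower bound on `B`
    -- excludes the former.
    have hsub : Iio R ⊆ Bᶜ := by
      rcases hpc.subset_or_disjoint_of_disjoint_frontier
        (fun x hx => hfr x hx (by simp)) with h | h
      · exfalso
        have h1 := hL (min L R - 1) (h (show min L R - 1 < R by linarith [min_le_right L R]))
        linarith [min_le_left L R]
      · exact h
    have hemp : B ∩ Iio R = ∅ := by
      ext r
      simp only [mem_inter_iff, mem_empty_iff_false, iff_false, not_and]
      exact fun h1 h2 => hsub h2 h1
    refine ⟨fun hl => ?_, fun _ => by simp [hemp]⟩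
    exfalso
    obtain ⟨r, hr1, hr2⟩ := (hl.and self_mem_nhdsWithin).exists
    exact hsub hr2 hr1
  | insert a s hmax ih =>
    intro R hHR hfr hj
    have haR : a < R := hHR a (by simp)
    have hnot : a ∉ s := fun h => lt_irrefl _ (hmax a h)
    have hfr' : ∀ r < a, r ∉ s → r ∉ frontier B := fun r hr hrs =>
      hfr r (hr.trans haR) (by simp [hr.ne, hrs])
    have ih' := ih a hmax hfr' fun h hh => hj h (by simp [hh])
    have hIoo : Ioo a R ⊆ B ∨ Ioo a R ⊆ Bᶜ :=
      isPreconnected_Ioo.subset_or_disjoint_of_disjoint_frontier fun x hx =>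
        hfr x hx.2 (by
          simp only [Finset.mem_insert, not_or]
          exact ⟨hx.1.ne', fun h => lt_asymm hx.1 (hmax x h)⟩)
    have hright : Ioo a R ∈ 𝓝[>] a := Ioo_mem_nhdsGT haR
    have hleft : Ioo a R ∈ 𝓝[<] R := Ioo_mem_nhdsLT haR
    rw [Finset.sum_insert hnot]
    rcases hj a (by simp) with ⟨hσ, hl, hr⟩ | ⟨hσ, hl, hr⟩
    · have hout : Ioo a R ⊆ Bᶜ := by
        rcases hIoo with h | h
        · obtain ⟨r, hr1, hr2⟩ := (hr.and hright).exists
          exact absurd (h hr2) hr1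
        · exact h
      have hae : (B ∩ Iio R : Set ℝ) =ᵐ[volume] (B ∩ Iio a : Set ℝ) := by
        have h0 : ∀ᵐ x : ℝ, x ≠ a := by simp [ae_iff]
        filter_upwards [h0] with x hx
        refine propext ⟨fun ⟨h1, h2⟩ => ⟨h1, ?_⟩, fun ⟨h1, h2⟩ => ⟨h1, h2.trans haR⟩⟩
        by_contra hcon
        exact hout ⟨lt_of_le_of_ne (not_lt.1 hcon) hx.symm, h2⟩ h1
      rw [setIntegral_congr_set hae, ih'.1 hl, hσ]
      refine ⟨fun h => ?_, fun _ => by ring⟩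
      obtain ⟨r, hr1, hr2⟩ := (h.and hleft).exists
      exact absurd hr1 (hout hr2)
    · have hin : Ioo a R ⊆ B := by
        rcases hIoo with h | h
        · exact h
        · obtain ⟨r, hr1, hr2⟩ := (hr.and hright).exists
          exact absurd hr1 (h hr2)
      have hae : (B ∩ Iio R : Set ℝ) =ᵐ[volume] ((B ∩ Iio a) ∪ Ioo a R : Set ℝ) := by
        have h0 : ∀ᵐ x : ℝ, x ≠ a := by simp [ae_iff]
        filter_upwards [h0] with x hx
        refine propext ⟨fun ⟨h1, h2⟩ => ?_, ?_⟩
        · rcases lt_or_gt_of_ne hx with h | h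
          · exact Or.inl ⟨h1, h⟩
          · exact Or.inr ⟨h, h2⟩
        · rintro (⟨h1, h2⟩ | h)
          · exact ⟨h1, h2.trans haR⟩
          · exact ⟨hin h, h.2⟩
      rw [setIntegral_congr_set hae, setIntegral_union _ measurableSet_Ioo
        (hint.mono_set inter_subset_left) (hint.mono_set hin), ih'.2 hl,
        setIntegral_Ioo_eq_sub_of_subset hC hφ hd hint haR hin, hσ]
      · refine ⟨fun _ => by ring, fun h => ?_⟩
        obtain ⟨r, hr1, hr2⟩ := (h.and hleft).exists
        exact absurd (hin hr2) hr1
      · exact disjoint_left.2 fun x hx hx' => lt_asymm hx.2 hx'.1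

/-- The fundamental theorem of calculus on a bounded set of reals with finitely many boundary
points, at each of which one side belongs to the set and the other does not. -/
lemma setIntegral_of_jumps (hB : Bornology.IsBounded B) {C : Set ℝ} (hC : C.Countable)
    (hφ : ContinuousOn φ (closure B)) (hd : ∀ r ∉ C, r ∈ B → HasDerivAt φ (ψ r) r)
    (hint : IntegrableOn ψ B) (H : Finset ℝ) (hfr : ∀ r ∉ H, r ∉ frontier B)
    (hj : ∀ h ∈ H, (σ h = 1 ∧ (∀ᶠ r in 𝓝[<] h, r ∈ B) ∧ ∀ᶠ r in 𝓝[>] h, r ∉ B) ∨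
      (σ h = -1 ∧ (∀ᶠ r in 𝓝[<] h, r ∉ B) ∧ ∀ᶠ r in 𝓝[>] h, r ∈ B)) :
    ∫ r in B, ψ r = ∑ h ∈ H, σ h * φ h := by
  obtain ⟨c, hc⟩ := (hB.union H.finite_toSet.isBounded).subset_closedBall 0
  have hc' : ∀ r ∈ B ∪ H, |r| ≤ c := fun r hr => by simpa using hc hr
  -- The set and its jumps lie in `[-c, c]`, so at `c + 2` the cut removes nothing and the set is
  -- absent on the left.
  have h := (setIntegral_inter_Iio_of_jumps (σ := σ)
    ⟨-c, fun r hr => (abs_le.1 (hc' r (Or.inl hr))).1⟩ hC hφ hd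
    hint H (c + 2) (fun h hh => by linarith [(abs_le.1 (hc' h (Or.inr hh))).2])
    (fun r _ hr => hfr r hr) hj).2 (by
      filter_upwards [Ioo_mem_nhdsLT (show c + 1 < c + 2 by linarith)] with r hr hrB
      linarith [hr.1, (abs_le.1 (hc' r (Or.inl hrB))).2])
  rwa [inter_eq_left.2] at h
  intro r hr
  have := (abs_le.1 (hc' r (Or.inl hr))).2
  exact show r < c + 2 by linarith

end Line

/-! ### Lines parallel to a coordinate axis, and Fubini along them. -/

section Lines

variable {n : ℕ}

/-- The point with `i`-th coordinate `r` and the other coordinates `y`. -/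
def linePt (i : Fin (n + 1)) (y : Fin n → ℝ) (r : ℝ) : Vec n :=
  WithLp.toLp 2 (i.insertNth (α := fun _ => ℝ) r y)

/-- The projection along the `i`-th coordinate direction. -/
noncomputable def dropCoord (i : Fin (n + 1)) : Vec n →L[ℝ] (Fin n → ℝ) :=
  ContinuousLinearMap.pi fun k => EuclideanSpace.proj (i.succAbove k)

@[simp] lemma dropCoord_apply (i : Fin (n + 1)) (x : Vec n) (k : Fin n) :
    dropCoord i x k = x (i.succAbove k) := rfl

@[simp] lemma linePt_self (i : Fin (n + 1)) (y : Fin n → ℝ) (r : ℝ) : linePt i y r i = r := by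
  simp [linePt]

@[simp] lemma linePt_succAbove (i : Fin (n + 1)) (y : Fin n → ℝ) (r : ℝ) (k : Fin n) :
    linePt i y r (i.succAbove k) = y k := by
  simp [linePt]

@[simp] lemma dropCoord_linePt (i : Fin (n + 1)) (y : Fin n → ℝ) (r : ℝ) :
    dropCoord i (linePt i y r) = y := by
  funext k
  simp

lemma linePt_dropCoord (i : Fin (n + 1)) (x : Vec n) : linePt i (dropCoord i x) (x i) = x := by
  ext k
  rcases eq_or_ne k i with rfl | h
  · simp
  · obtain ⟨l, rfl⟩ := Fin.exists_succAbove_eq h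
    simp

lemma linePt_eq_of_dropCoord_eq {i : Fin (n + 1)} {x : Vec n} {y : Fin n → ℝ}
    (h : dropCoord i x = y) : linePt i y (x i) = x := by
  rw [← h, linePt_dropCoord]

lemma linePt_sub_linePt (i : Fin (n + 1)) (y : Fin n → ℝ) (r r' : ℝ) :
    linePt i y r - linePt i y r' = (r - r') • EuclideanSpace.single i (1 : ℝ) := by
  ext k
  rcases eq_or_ne k i with rfl | h
  · simp
  · obtain ⟨l, rfl⟩ := Fin.exists_succAbove_eq h
    simp [h]

lemma linePt_eq_add (i : Fin (n + 1)) (y : Fin n → ℝ) (r : ℝ) :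
    linePt i y r = linePt i y 0 + r • EuclideanSpace.single i (1 : ℝ) := by
  have := linePt_sub_linePt i y r 0
  rw [sub_zero] at this
  rw [← this]
  abel

lemma continuous_linePt (i : Fin (n + 1)) (y : Fin n → ℝ) : Continuous (linePt i y) := by
  rw [show linePt i y = fun r => linePt i y 0 + r • EuclideanSpace.single i (1 : ℝ) from
    funext (linePt_eq_add i y)]
  fun_prop

lemma hasDerivAt_linePt (i : Fin (n + 1)) (y : Fin n → ℝ) (r : ℝ) :
    HasDerivAt (linePt i y) (EuclideanSpace.single i (1 : ℝ)) r := by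
  rw [show linePt i y = fun r => linePt i y 0 + r • EuclideanSpace.single i (1 : ℝ) from
    funext (linePt_eq_add i y)]
  simpa using ((hasDerivAt_id r).smul_const (EuclideanSpace.single i (1 : ℝ))).const_add
    (linePt i y 0)

/-- Points as pairs of the `i`-th coordinate and the remaining ones. -/
noncomputable def lineEquiv (i : Fin (n + 1)) : ℝ × (Fin n → ℝ) ≃ᵐ Vec n :=
  (MeasurableEquiv.piFinSuccAbove (fun _ => ℝ) i).symm.trans
    (MeasurableEquiv.toLp 2 (Fin (n + 1) → ℝ))

lemma measurePreserving_lineEquiv (i : Fin (n + 1)) :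
    MeasurePreserving (lineEquiv i) (volume : Measure (ℝ × (Fin n → ℝ))) volume :=
  (PiLp.volume_preserving_toLp (Fin (n + 1))).comp
    (volume_preserving_piFinSuccAbove (fun _ => ℝ) i).symm

lemma integral_eq_integral_lines (i : Fin (n + 1)) {f : Vec n → ℝ} (hf : Integrable f) :
    ∫ x, f x = ∫ y, ∫ r, f (linePt i y r) := by
  rw [← (measurePreserving_lineEquiv i).integral_comp (lineEquiv i).measurableEmbedding f,
    Measure.volume_eq_prod, integral_prod_symm]
  · rfl
  · exact ((measurePreserving_lineEquiv i).integrable_comp_emb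
      (lineEquiv i).measurableEmbedding).2 hf

lemma ae_integrable_line (i : Fin (n + 1)) {f : Vec n → ℝ} (hf : Integrable f) :
    ∀ᵐ y : Fin n → ℝ, Integrable fun r => f (linePt i y r) := by
  have h := ((measurePreserving_lineEquiv i).integrable_comp_emb
      (lineEquiv i).measurableEmbedding).2 hf
  rw [Measure.volume_eq_prod] at h
  exact h.prod_left_ae

end Lines

/-! ### The open reference simplex and the projection of a simplex along an axis. -/

section OpenRef

/-- The open reference simplex. -/
def openRef (n : ℕ) : Set (Fin n → ℝ) := {y | (∀ i, 0 < y i) ∧ ∑ i, y i < 1}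

lemma isOpen_openRef (n : ℕ) : IsOpen (openRef n) := by
  have h : openRef n = (⋂ i, {y | 0 < y i}) ∩ {y | ∑ i, y i < 1} := by
    ext y
    simp [openRef]
  rw [h]
  refine IsOpen.inter (isOpen_iInter_of_finite fun i => ?_) ?_
  · exact isOpen_lt continuous_const (continuous_apply i)
  · exact isOpen_lt (by fun_prop) continuous_const

lemma openRef_subset_refSimplex (n : ℕ) : openRef n ⊆ refSimplex n :=
  fun _ hy => ⟨fun i => (hy.1 i).le, hy.2.le⟩

lemma convex_openRef (n : ℕ) : Convex ℝ (openRef n) := by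
  rintro x ⟨hx, hx1⟩ y ⟨hy, hy1⟩ a b ha hb hab
  refine ⟨fun i => ?_, ?_⟩
  · have h1 := hx i
    have h2 := hy i
    simp only [Pi.add_apply, Pi.smul_apply, smul_eq_mul]
    rcases ha.eq_or_lt with rfl | ha'
    · rw [zero_add] at hab
      subst hab
      simpa using h2
    · have := mul_pos ha' h1
      have := mul_nonneg hb h2.le
      linarith
  · simp only [Pi.add_apply, Pi.smul_apply, smul_eq_mul, Finset.sum_add_distrib, ← Finset.mul_sum]
    rcases ha.eq_or_lt with rfl | ha'
    · rw [zero_add] at hab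
      subst hab
      simpa using hy1
    · nlinarith

/-- The barycenter of the reference simplex. -/
noncomputable def refCenter (n : ℕ) : Fin n → ℝ := fun _ => 1 / ((n : ℝ) + 1)

lemma refCenter_mem (n : ℕ) : refCenter n ∈ openRef n := by
  refine ⟨fun i => by unfold refCenter; positivity, ?_⟩
  simp only [refCenter, Finset.sum_const, Finset.card_univ, Fintype.card_fin, nsmul_eq_mul]
  rw [mul_one_div, div_lt_one (by positivity)]
  linarith

lemma refSimplex_subset_closure (n : ℕ) : refSimplex n ⊆ closure (openRef n) := by
  intro y hy
  have hc : Tendsto (fun ε : ℝ => (1 - ε) • y + ε • refCenter n) (𝓝[>] 0) (𝓝 y) := by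
    have : Continuous fun ε : ℝ => (1 - ε) • y + ε • refCenter n := by fun_prop
    have h := this.tendsto 0
    simp only [sub_zero, one_smul, zero_smul, add_zero] at h
    exact h.mono_left nhdsWithin_le_nhds
  refine mem_closure_of_tendsto hc ?_
  filter_upwards [Ioo_mem_nhdsGT (show (0 : ℝ) < 1 by norm_num)] with ε hε
  have hcm := refCenter_mem n
  refine ⟨fun i => ?_, ?_⟩
  · have h1 := hy.1 i
    have h2 := hcm.1 i
    simp only [Pi.add_apply, Pi.smul_apply, smul_eq_mul]
    have := mul_pos hε.1 h2
    have := mul_nonneg (sub_nonneg.2 hε.2.le) h1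
    linarith
  · simp only [Pi.add_apply, Pi.smul_apply, smul_eq_mul, Finset.sum_add_distrib, ← Finset.mul_sum]
    have h1 := hy.2
    have h2 := hcm.2
    nlinarith [hε.1, hε.2]

/-- The difference lies in the frontier of a convex set, which is null. -/
lemma openRef_ae_eq_refSimplex (n : ℕ) : openRef n =ᵐ[volume] refSimplex n := by
  have h := (convex_openRef n).addHaar_frontier volume
  refine (ae_le_set.2 ?_).antisymm (ae_le_set.2 ?_)
  · rw [sdiff_eq_empty.2 (openRef_subset_refSimplex n), measure_empty]
  · refine measure_mono_null ?_ h
    rw [(isOpen_openRef n).frontier_eq]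
    exact sdiff_subset_sdiff_left (refSimplex_subset_closure n)

lemma setIntegral_openRef {n : ℕ} (f : (Fin n → ℝ) → ℝ) :
    ∫ y in openRef n, f y = ∫ y in refSimplex n, f y :=
  setIntegral_congr_set (openRef_ae_eq_refSimplex n)

variable {n : ℕ}

lemma bary_pos {y : Fin n → ℝ} (hy : y ∈ openRef n) (k : Fin (n + 1)) : 0 < bary y k := by
  refine Fin.cases ?_ (fun k => ?_) k
  · simpa [bary] using hy.2
  · simpa [bary] using hy.1 k

lemma lin_bary {α : Type*} [AddCommGroup α] [Module ℝ α] (z : Fin (n + 1) → α) (y : Fin n → ℝ) :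
    lin z (bary y) = z 0 + ∑ k : Fin n, y k • (z k.succ - z 0) := by
  rw [lin, Fin.sum_univ_succ]
  simp only [bary, Fin.cons_zero, Fin.cons_succ, sub_smul, one_smul, smul_sub,
    Finset.sum_sub_distrib, Finset.sum_smul]
  abel

lemma exists_bary {l : Fin (n + 1) → ℝ} (hl : ∑ k, l k = 1) : l = bary (Fin.tail l) := by
  funext k
  refine Fin.cases ?_ (fun k => ?_) k
  · simp only [bary, Fin.cons_zero, Fin.tail]
    rw [Fin.sum_univ_succ] at hl
    linarith
  · simp [bary, Fin.tail]

lemma openSimplex_eq_image (p : Fin (n + 1) → Vec n) :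
    openSimplex p = (fun y => lin p (bary y)) '' openRef n := by
  ext x
  constructor
  · rintro ⟨l, hl, hs, rfl⟩
    have h := exists_bary hs
    refine ⟨Fin.tail l, ⟨fun i => hl i.succ, ?_⟩, ?_⟩
    · have := hl 0
      rw [Fin.sum_univ_succ] at hs
      have h2 : ∑ i, Fin.tail l i = ∑ i : Fin n, l i.succ := rfl
      linarith
    · change lin p (bary (Fin.tail l)) = lin p l
      rw [← h]
  · rintro ⟨y, hy, rfl⟩
    exact ⟨bary y, bary_pos hy, sum_bary y, rfl⟩

/-- The projected edge matrix, as a linear map of `ℝ^{d-1}`. -/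
noncomputable def shadowLin (p : Fin (n + 1) → Vec n) (i : Fin (n + 1)) :
    (Fin n → ℝ) →L[ℝ] (Fin n → ℝ) :=
  LinearMap.toContinuousLinearMap (Matrix.toLin' ((edgeMat p).submatrix id i.succAbove)ᵀ)

/-- The Jacobian of the projected parameterization is a component of the normal; this is how the
normal enters the divergence theorem. -/
lemma abs_det_shadowLin (p : Fin (n + 1) → Vec n) (i : Fin (n + 1)) :
    |(shadowLin p i).det| = |normalVec p i| := by
  rw [normalVec_apply, abs_mul, abs_pow, abs_neg, abs_one, one_pow, one_mul, shadowLin,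
    LinearMap.det_toContinuousLinearMap, LinearMap.det_toLin', Matrix.det_transpose]

/-- The parameterization of the projection of a simplex along a coordinate direction. -/
noncomputable def shadow (p : Fin (n + 1) → Vec n) (i : Fin (n + 1)) (y : Fin n → ℝ) :
    Fin n → ℝ := dropCoord i (lin p (bary y))

lemma shadow_eq (p : Fin (n + 1) → Vec n) (i : Fin (n + 1)) (y : Fin n → ℝ) :
    shadow p i y = dropCoord i (p 0) + shadowLin p i y := by
  rw [shadow, lin_bary, map_add, map_sum]
  congr 1
  funext k
  simp [shadowLin, Matrix.mulVec, dotProduct, edgeMat, Finset.sum_apply, mul_comm]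

lemma hasFDerivAt_shadow (p : Fin (n + 1) → Vec n) (i : Fin (n + 1)) (y : Fin n → ℝ) :
    HasFDerivAt (shadow p i) (shadowLin p i) y := by
  rw [show shadow p i = fun y => dropCoord i (p 0) + shadowLin p i y from
    funext (shadow_eq p i)]
  exact (shadowLin p i).hasFDerivAt.const_add _

lemma injective_shadow {p : Fin (n + 1) → Vec n} {i : Fin (n + 1)} (h : normalVec p i ≠ 0) :
    Function.Injective (shadow p i) := by
  intro y y' hyy
  rw [shadow_eq, shadow_eq, add_right_inj] at hyy
  have hdet : (Matrix.toLin' ((edgeMat p).submatrix id i.succAbove)ᵀ).det ≠ 0 := by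
    rw [LinearMap.det_toLin', Matrix.det_transpose]
    rw [normalVec_apply] at h
    exact right_ne_zero_of_mul h
  exact (LinearEquiv.ofIsUnitDet (f := Matrix.toLin' ((edgeMat p).submatrix id i.succAbove)ᵀ)
    (v := Pi.basisFun ℝ _) (v' := Pi.basisFun ℝ _) (by
      rw [LinearMap.toMatrix_eq_toMatrix', LinearMap.det_toMatrix']
      exact isUnit_iff_ne_zero.2 hdet)).injective hyy

/-- A simplex parallel to the `i`-th axis is seen by almost no line in that direction. -/
lemma volume_shadow_image_eq_zero {p : Fin (n + 1) → Vec n} {i : Fin (n + 1)}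
    (h : normalVec p i = 0) (s : Set (Fin n → ℝ)) : volume (shadow p i '' s) = 0 := by
  have h1 : shadow p i '' s = (fun z => dropCoord i (p 0) + z) '' (shadowLin p i '' s) := by
    rw [image_image]
    exact image_congr fun y _ => shadow_eq p i y
  rw [h1]
  have h2 : (shadowLin p i).det = 0 := by
    rw [← abs_eq_zero, abs_det_shadowLin, h, abs_zero]
  rw [image_add_left, measure_preimage_add, Measure.addHaar_image_continuousLinearMap,
    show LinearMap.det (shadowLin p i : (Fin n → ℝ) →ₗ[ℝ] Fin n → ℝ) = 0 from h2]
  simp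

end OpenRef

/-! ### The divergence theorem on bounded sets with flat boundary pieces. -/

section Divergence

variable {n : ℕ}

open Classical in
/-- The integrand of a surface integral, transported to the projection of the simplex. -/
noncomputable def shadowVal (p : Fin (n + 1) → Vec n) (i : Fin (n + 1)) (φ : Vec n → ℝ)
    (z : Fin n → ℝ) : ℝ :=
  if h : z ∈ shadow p i '' openRef n then φ (lin p (bary h.choose)) else 0

lemma shadowVal_of_mem {p : Fin (n + 1) → Vec n} {i : Fin (n + 1)} (hN : normalVec p i ≠ 0)
    (φ : Vec n → ℝ) {y : Fin n → ℝ} (hy : y ∈ openRef n) :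
    shadowVal p i φ (shadow p i y) = φ (lin p (bary y)) := by
  have h : shadow p i y ∈ shadow p i '' openRef n := mem_image_of_mem _ hy
  rw [shadowVal, dif_pos h, injective_shadow hN h.choose_spec.2]

lemma shadowVal_of_notMem {p : Fin (n + 1) → Vec n} {i : Fin (n + 1)} (φ : Vec n → ℝ)
    {z : Fin n → ℝ} (hz : z ∉ shadow p i '' openRef n) : shadowVal p i φ z = 0 := by
  rw [shadowVal, dif_neg hz]

lemma measurableSet_shadow_image {p : Fin (n + 1) → Vec n} {i : Fin (n + 1)}
    (hN : normalVec p i ≠ 0) : MeasurableSet (shadow p i '' openRef n) :=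
  measurable_image_of_fderivWithin (isOpen_openRef n).measurableSet
    (fun y _ => (hasFDerivAt_shadow p i y).hasFDerivWithinAt) (injective_shadow hN).injOn

lemma continuous_linBary (p : Fin (n + 1) → Vec n) : Continuous fun y => lin p (bary y) :=
  (continuous_lin p).comp (continuous_bary n)

lemma linBary_mem_closure {A : Set (Vec n)} {p : Fin (n + 1) → Vec n}
    (h : openSimplex p ⊆ closure A) {y : Fin n → ℝ} (hy : y ∈ refSimplex n) :
    lin p (bary y) ∈ closure A := by
  have h1 : (fun y => lin p (bary y)) '' closure (openRef n) ⊆ closure A := by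
    refine (image_closure_subset_closure_image (continuous_linBary p)).trans ?_
    rw [← openSimplex_eq_image]
    exact closure_minimal h isClosed_closure
  exact h1 (mem_image_of_mem _ (refSimplex_subset_closure n hy))

lemma integrableOn_comp_linBary {A : Set (Vec n)} {φ : Vec n → ℝ} (hφ : ContinuousOn φ (closure A))
    {p : Fin (n + 1) → Vec n} (h : openSimplex p ⊆ closure A) :
    IntegrableOn (fun y => φ (lin p (bary y))) (refSimplex n) :=
  (hφ.comp (continuous_linBary p).continuousOn fun _ hy =>
    linBary_mem_closure h hy).integrableOn_compact (isCompact_refSimplex n)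

lemma integrable_shadowVal {A : Set (Vec n)} {φ : Vec n → ℝ} (hφ : ContinuousOn φ (closure A))
    {p : Fin (n + 1) → Vec n} (h : openSimplex p ⊆ closure A) {i : Fin (n + 1)}
    (hN : normalVec p i ≠ 0) : Integrable (shadowVal p i φ) := by
  have hind : shadowVal p i φ = (shadow p i '' openRef n).indicator (shadowVal p i φ) := by
    funext z
    by_cases hz : z ∈ shadow p i '' openRef n
    · rw [indicator_of_mem hz]
    · rw [indicator_of_notMem hz, shadowVal_of_notMem φ hz]
  rw [hind, integrable_indicator_iff (measurableSet_shadow_image hN),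
    integrableOn_image_iff_integrableOn_abs_det_fderiv_smul volume
      (isOpen_openRef n).measurableSet
      (fun y _ => (hasFDerivAt_shadow p i y).hasFDerivWithinAt) (injective_shadow hN).injOn]
  have h1 : IntegrableOn (fun y => |(shadowLin p i).det| • φ (lin p (bary y))) (openRef n) :=
    ((integrableOn_comp_linBary hφ h).mono_set (openRef_subset_refSimplex n)).smul
      (|(shadowLin p i).det|)
  refine h1.congr_fun (fun y hy => ?_) (isOpen_openRef n).measurableSet
  simp only [shadowVal_of_mem hN φ hy]

/-- Change of variables from the projected simplex back to the reference simplex. -/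
lemma integral_shadowVal {φ : Vec n → ℝ} {p : Fin (n + 1) → Vec n} {i : Fin (n + 1)}
    (hN : normalVec p i ≠ 0) :
    ∫ z, shadowVal p i φ z = |normalVec p i| * ∫ y in refSimplex n, φ (lin p (bary y)) := by
  have hind : shadowVal p i φ = (shadow p i '' openRef n).indicator (shadowVal p i φ) := by
    funext z
    by_cases hz : z ∈ shadow p i '' openRef n
    · rw [indicator_of_mem hz]
    · rw [indicator_of_notMem hz, shadowVal_of_notMem φ hz]
  rw [hind, integral_indicator (measurableSet_shadow_image hN),
    integral_image_eq_integral_abs_det_fderiv_smul volume (isOpen_openRef n).measurableSet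
      (fun y _ => (hasFDerivAt_shadow p i y).hasFDerivWithinAt) (injective_shadow hN).injOn,
    ← setIntegral_openRef]
  rw [← integral_const_mul]
  refine setIntegral_congr_fun (isOpen_openRef n).measurableSet fun y hy => ?_
  simp only [shadowVal_of_mem hN φ hy, abs_det_shadowLin, smul_eq_mul]

/-- The behaviour of a set on a coordinate line through a flat boundary point. -/
lemma IsOuterNormal.eventually_line {A : Set (Vec n)} {i : Fin (n + 1)} {y : Fin n → ℝ} {h : ℝ}
    {e : Vec n} (he : IsOuterNormal A (linePt i y h) e) :
    ∀ᶠ r in 𝓝 h, linePt i y r ∈ A ↔ (r - h) * e i < 0 := by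
  obtain ⟨_, ρ, hρ, hA⟩ := he
  have hc : ∀ᶠ r in 𝓝 h, linePt i y r ∈ Metric.ball (linePt i y h) ρ :=
    (continuous_linePt i y).continuousAt (Metric.ball_mem_nhds _ hρ)
  filter_upwards [hc] with r hr
  rw [hA _ hr, linePt_sub_linePt, inner_smul_left, EuclideanSpace.inner_single_left]
  simp

/-- A bounded set whose boundary consists of flat pieces and of a set with a null projection. -/
structure FlatBoundary {ι : Type*} (A : Set (Vec n)) (p : ι → Fin (n + 1) → Vec n) (s : ι → ℝ)
    (Z : Set (Vec n)) : Prop where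
  measurableSet : MeasurableSet A
  isBounded : Bornology.IsBounded A
  sign : ∀ j, s j = 1 ∨ s j = -1
  null : ∀ i, volume (dropCoord i '' Z) = 0
  frontier_subset : frontier A ⊆ (⋃ j, openSimplex (p j)) ∪ Z
  disjoint : ∀ j j', j ≠ j' → Disjoint (openSimplex (p j)) (openSimplex (p j'))
  normal : ∀ j, ∀ x ∈ openSimplex (p j), IsOuterNormal A x (s j • unitNormal (p j))

lemma IsOuterNormal.mem_closure {A : Set (Vec n)} {x e : Vec n} (h : IsOuterNormal A x e) :
    x ∈ closure A := by
  obtain ⟨he, ρ, hρ, hA⟩ := h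
  have hc : Tendsto (fun ε : ℝ => x - ε • e) (𝓝[>] 0) (𝓝 x) := by
    have : Continuous fun ε : ℝ => x - ε • e := by fun_prop
    have h := this.tendsto 0
    simp only [zero_smul, sub_zero] at h
    exact h.mono_left nhdsWithin_le_nhds
  refine mem_closure_of_tendsto hc ?_
  filter_upwards [hc (Metric.ball_mem_nhds x hρ), self_mem_nhdsWithin] with ε h1 h2
  rw [hA _ h1, sub_sub_cancel_left, inner_neg_left, inner_smul_left, real_inner_self_eq_norm_sq, he]
  simpa using h2

variable {ι : Type*} {A : Set (Vec n)} {p : ι → Fin (n + 1) → Vec n} {s : ι → ℝ}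
  {Z : Set (Vec n)}

lemma FlatBoundary.openSimplex_subset (hA : FlatBoundary A p s Z) (j : ι) :
    openSimplex (p j) ⊆ closure A := fun x hx => (hA.normal j x hx).mem_closure

variable [Fintype ι]

-- A line that avoids `Z` and every piece parallel to it meets the boundary in finitely many points,
-- one for each piece that it hits. There it passes from inside to outside or conversely according
-- to the sign of the `i`-th component of the outer normal, so `setIntegral_of_jumps` applies.
open Classical in
lemma FlatBoundary.setIntegral_line (hA : FlatBoundary A p s Z) (i : Fin (n + 1))
    {φ ψ : Vec n → ℝ} (hφ : ContinuousOn φ (closure A)) {y : Fin n → ℝ}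
    (hyZ : y ∉ dropCoord i '' Z)
    (hyd : ∀ j, normalVec (p j) i = 0 → y ∉ shadow (p j) i '' openRef n)
    (hint : IntegrableOn (fun r => ψ (linePt i y r)) (linePt i y ⁻¹' A))
    (hd : ∃ C : Set ℝ, C.Countable ∧ ∀ r ∉ C, linePt i y r ∈ A →
      HasDerivAt (fun r => φ (linePt i y r)) (ψ (linePt i y r)) r) :
    ∫ r in linePt i y ⁻¹' A, ψ (linePt i y r) =
      ∑ j, s j * SignType.sign (normalVec (p j) i) * shadowVal (p j) i φ y := by
  obtain ⟨C, hC, hd⟩ := hd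
  set B := linePt i y ⁻¹' A with hBdef
  -- The pieces that the line crosses; `h j` below is the height of the crossing, and different
  -- pieces are crossed at different heights because they are disjoint.
  set I : Finset ι := Finset.univ.filter fun j => y ∈ shadow (p j) i '' openRef n with hI
  have hmemI : ∀ {j}, j ∈ I ↔ ∃ u ∈ openRef n, shadow (p j) i u = y := fun {j} => by
    simp [hI]
  have hch : ∀ j : ι, ∃ u, j ∈ I → u ∈ openRef n ∧ shadow (p j) i u = y := fun j => by
    by_cases hj : j ∈ I
    · obtain ⟨u, hu⟩ := hmemI.1 hj
      exact ⟨u, fun _ => hu⟩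
    · exact ⟨0, fun h => absurd h hj⟩
  choose u hu using hch
  set h : ι → ℝ := fun j => lin (p j) (bary (u j)) i with hh
  have hN : ∀ j ∈ I, normalVec (p j) i ≠ 0 := fun j hj h0 => by
    refine hyd j h0 ?_
    obtain ⟨v, hv⟩ := hmemI.1 hj
    exact ⟨v, hv⟩
  have hpt : ∀ j ∈ I, linePt i y (h j) = lin (p j) (bary (u j)) := fun j hj =>
    linePt_eq_of_dropCoord_eq (hu j hj).2
  have hmemS : ∀ j ∈ I, linePt i y (h j) ∈ openSimplex (p j) := fun j hj => by
    rw [hpt j hj, openSimplex_eq_image]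
    exact ⟨u j, (hu j hj).1, rfl⟩
  have hinj : Set.InjOn h I := by
    intro j hj j' hj' hjj
    by_contra hne
    have h1 := hmemS j hj
    have h2 := hmemS j' hj'
    rw [← hjj] at h2
    exact disjoint_left.1 (hA.disjoint j j' hne) h1 h2
  -- The one-dimensional lemma indexes signs by points of the line, so the sign is read off from the
  -- set itself and matched with that of the piece in `hτj`.
  set τ : ℝ → ℝ := fun r => if ∀ᶠ r' in 𝓝[<] r, r' ∈ B then 1 else -1 with hτ
  have hjump : ∀ j ∈ I,
      (s j * SignType.sign (normalVec (p j) i) = 1 ∧ (∀ᶠ r in 𝓝[<] h j, r ∈ B) ∧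
        ∀ᶠ r in 𝓝[>] h j, r ∉ B) ∨
      (s j * SignType.sign (normalVec (p j) i) = -1 ∧ (∀ᶠ r in 𝓝[<] h j, r ∉ B) ∧
        ∀ᶠ r in 𝓝[>] h j, r ∈ B) := by
    intro j hj
    have hev := (hA.normal j _ (hmemS j hj)).eventually_line
    have hpos : 0 < ‖normalVec (p j)‖⁻¹ := by
      refine inv_pos.2 (norm_pos_iff.2 fun h0 => hN j hj ?_)
      rw [h0]
      rfl
    have hl : ∀ᶠ r in 𝓝[<] h j, r < h j := self_mem_nhdsWithin
    have hr : ∀ᶠ r in 𝓝[>] h j, h j < r := self_mem_nhdsWithin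
    have hev1 := hev.filter_mono (nhdsWithin_le_nhds (s := Iio (h j)))
    have hev2 := hev.filter_mono (nhdsWithin_le_nhds (s := Ioi (h j)))
    have he : (s j • unitNormal (p j)) i = s j * (‖normalVec (p j)‖⁻¹ * normalVec (p j) i) := rfl
    have key : ∀ c : ℝ, 0 < c → (s j • unitNormal (p j)) i = c →
        (∀ᶠ r in 𝓝[<] h j, r ∈ B) ∧ ∀ᶠ r in 𝓝[>] h j, r ∉ B := by
      intro c hc hec
      constructor
      · filter_upwards [hl, hev1] with r h1 h2
        exact h2.2 (by rw [hec]; exact mul_neg_of_neg_of_pos (sub_neg.2 h1) hc)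
      · filter_upwards [hr, hev2] with r h1 h2 h3
        have := h2.1 h3
        rw [hec] at this
        exact lt_asymm this (mul_pos (sub_pos.2 h1) hc)
    have key' : ∀ c : ℝ, c < 0 → (s j • unitNormal (p j)) i = c →
        (∀ᶠ r in 𝓝[<] h j, r ∉ B) ∧ ∀ᶠ r in 𝓝[>] h j, r ∈ B := by
      intro c hc hec
      constructor
      · filter_upwards [hl, hev1] with r h1 h2 h3
        have := h2.1 h3
        rw [hec] at this
        exact lt_asymm this (mul_pos_of_neg_of_neg (sub_neg.2 h1) hc)
      · filter_upwards [hr, hev2] with r h1 h2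
        exact h2.2 (by rw [hec]; exact mul_neg_of_pos_of_neg (sub_pos.2 h1) hc)
    rcases hA.sign j with hs | hs <;> rcases lt_or_gt_of_ne (hN j hj) with hlt | hgt
    · right
      refine ⟨by rw [hs, sign_neg hlt]; simp, key' _ ?_ he⟩
      rw [hs, one_mul]
      exact mul_neg_of_pos_of_neg hpos hlt
    · left
      refine ⟨by rw [hs, sign_pos hgt]; simp, key _ ?_ he⟩
      rw [hs, one_mul]
      exact mul_pos hpos hgt
    · left
      refine ⟨by rw [hs, sign_neg hlt]; simp, key _ ?_ he⟩
      rw [hs]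
      nlinarith [mul_neg_of_pos_of_neg hpos hlt]
    · right
      refine ⟨by rw [hs, sign_pos hgt]; simp, key' _ ?_ he⟩
      rw [hs]
      nlinarith [mul_pos hpos hgt]
  have hτj : ∀ j ∈ I, τ (h j) = s j * SignType.sign (normalVec (p j) i) := by
    intro j hj
    rcases hjump j hj with ⟨h1, h2, h3⟩ | ⟨h1, h2, h3⟩
    · rw [hτ]
      simp only
      rw [if_pos h2, h1]
    · rw [hτ]
      simp only
      rw [if_neg, h1]
      intro h4
      obtain ⟨r, hr1, hr2⟩ := (h2.and h4).exists
      exact hr1 hr2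
  have hBb : Bornology.IsBounded B := by
    obtain ⟨c, hc⟩ := hA.isBounded.subset_closedBall 0
    refine (Metric.isBounded_closedBall (x := (0 : ℝ)) (r := c)).subset fun r hr => ?_
    have h1 := hc hr
    rw [mem_closedBall_zero_iff] at h1 ⊢
    have h2 := PiLp.norm_apply_le (linePt i y r) i
    rw [linePt_self] at h2
    exact h2.trans h1
  have hmain := setIntegral_of_jumps (σ := τ) hBb hC
    (hφ.comp (continuous_linePt i y).continuousOn
      (fun r hr => (continuous_linePt i y).closure_preimage_subset A hr)) hd hint (I.image h)
    (fun r hr hfr => by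
      have h1 := (continuous_linePt i y).frontier_preimage_subset A hfr
      rcases hA.frontier_subset h1 with h2 | h2
      · obtain ⟨j, hj⟩ := mem_iUnion.1 h2
        rw [openSimplex_eq_image] at hj
        obtain ⟨v, hv, hve⟩ := hj
        have hsv : shadow (p j) i v = y := by
          rw [shadow]
          simp only at hve
          rw [hve, dropCoord_linePt]
        have hjI : j ∈ I := hmemI.2 ⟨v, hv, hsv⟩
        refine hr (Finset.mem_image.2 ⟨j, hjI, ?_⟩)
        have huv : u j = v := injective_shadow (hN j hjI) ((hu j hjI).2.trans hsv.symm)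
        rw [hh]
        simp only at hve ⊢
        rw [huv, hve, linePt_self]
      · exact hyZ ⟨_, h2, dropCoord_linePt i y r⟩)
    (fun r hr => by
      obtain ⟨j, hj, rfl⟩ := Finset.mem_image.1 hr
      rw [hτj j hj]
      exact hjump j hj)
  rw [hmain, Finset.sum_image hinj]
  have hsub : ∑ j, s j * SignType.sign (normalVec (p j) i) * shadowVal (p j) i φ y
      = ∑ j ∈ I, s j * SignType.sign (normalVec (p j) i) * shadowVal (p j) i φ y := by
    refine (Finset.sum_subset (Finset.subset_univ I) fun j _ hj => ?_).symm
    rw [shadowVal_of_notMem, mul_zero]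
    intro hmem
    exact hj (hmemI.2 hmem)
  rw [hsub]
  refine Finset.sum_congr rfl fun j hj => ?_
  rw [hτj j hj]
  congr 1
  simp only [Function.comp]
  rw [hpt j hj, ← shadowVal_of_mem (hN j hj) φ (hu j hj).1, (hu j hj).2]

/-- The divergence theorem for one partial derivative on a bounded set with flat boundary pieces. -/
theorem FlatBoundary.integral_partialDeriv (hA : FlatBoundary A p s Z) (i : Fin (n + 1))
    {φ ψ : Vec n → ℝ} (hφ : ContinuousOn φ (closure A)) (hψ : IntegrableOn ψ A)
    (hd : ∀ᵐ y : Fin n → ℝ, ∃ C : Set ℝ, C.Countable ∧ ∀ r ∉ C, linePt i y r ∈ A →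
      HasDerivAt (fun r => φ (linePt i y r)) (ψ (linePt i y r)) r) :
    ∫ x in A, ψ x =
      ∑ j, s j * (normalVec (p j) i * ∫ y in refSimplex n, φ (lin (p j) (bary y))) := by
  have hψ' : Integrable (A.indicator ψ) := (integrable_indicator_iff hA.measurableSet).2 hψ
  have hBm : ∀ y, MeasurableSet (linePt i y ⁻¹' A) := fun y =>
    (continuous_linePt i y).measurable hA.measurableSet
  have hcomp : ∀ y, (fun r => A.indicator ψ (linePt i y r)) =
      (linePt i y ⁻¹' A).indicator fun r => ψ (linePt i y r) := fun y => rfl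
  rw [← integral_indicator hA.measurableSet, integral_eq_integral_lines i hψ']
  -- Almost every line avoids `Z` and the pieces parallel to it.
  have hnullZ : ∀ᵐ y : Fin n → ℝ, y ∉ dropCoord i '' Z :=
    measure_eq_zero_iff_ae_notMem.1 (hA.null i)
  have hnulld : ∀ᵐ y : Fin n → ℝ, ∀ j, normalVec (p j) i = 0 →
      y ∉ shadow (p j) i '' openRef n := by
    refine ae_all_iff.2 fun j => ?_
    by_cases hj : normalVec (p j) i = 0
    · filter_upwards [measure_eq_zero_iff_ae_notMem.1
        (volume_shadow_image_eq_zero hj (openRef n))] with y hy _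
      exact hy
    · exact Eventually.of_forall fun y h => absurd h hj
  have hae : (fun y => ∫ r, A.indicator ψ (linePt i y r)) =ᵐ[volume]
      fun y => ∑ j, s j * SignType.sign (normalVec (p j) i) * shadowVal (p j) i φ y := by
    filter_upwards [hnullZ, hnulld, ae_integrable_line i hψ', hd] with y h1 h2 h3 h4
    rw [hcomp, integral_indicator (hBm y)]
    rw [hcomp, integrable_indicator_iff (hBm y)] at h3
    exact hA.setIntegral_line i hφ h1 h2 h3 h4
  rw [integral_congr_ae hae, integral_finsetSum]
  · refine Finset.sum_congr rfl fun j _ => ?_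
    rw [integral_const_mul]
    by_cases hj : normalVec (p j) i = 0
    · simp [hj]
    -- The sign of the crossing and the Jacobian `|N_i|` combine to `N_i`.
    · rw [integral_shadowVal hj, ← mul_assoc, mul_assoc (s j), sign_mul_abs, mul_assoc]
  · intro j _
    by_cases hj : normalVec (p j) i = 0
    · simp [hj]
    · exact (integrable_shadowVal hφ (hA.openSimplex_subset j) hj).const_mul _

end Divergence

/-! ### Convex hulls and barycentric weights. -/

section Barycentric

variable {ι E : Type*} [Fintype ι] [AddCommGroup E] [Module ℝ E]

lemma sum_smul_mem_convexHull {p : ι → E} {l : ι → ℝ} (h0 : ∀ k, 0 ≤ l k)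
    (h1 : ∑ k, l k = 1) {T : Set ι} (hT : ∀ k ∉ T, l k = 0) :
    ∑ k, l k • p k ∈ convexHull ℝ (p '' T) := by
  classical
  have e1 : ∑ k ∈ Finset.univ.filter (· ∈ T), l k • p k = ∑ k, l k • p k :=
    Finset.sum_subset (Finset.subset_univ _) fun k _ hk => by
      rw [hT k (by simpa using hk), zero_smul]
  have e2 : ∑ k ∈ Finset.univ.filter (· ∈ T), l k = ∑ k, l k :=
    Finset.sum_subset (Finset.subset_univ _) fun k _ hk => hT k (by simpa using hk)
  rw [← e1]
  refine (convex_convexHull ℝ _).sum_mem (fun x _ => h0 x) (e2.trans h1) fun x hx => ?_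
  exact subset_convexHull ℝ _ ⟨x, by simpa using hx, rfl⟩

lemma exists_weights_of_mem_convexHull_image {p : ι → E} {T : Set ι} {x : E}
    (hx : x ∈ convexHull ℝ (p '' T)) :
    ∃ l : ι → ℝ, (∀ k, 0 ≤ l k) ∧ ∑ k, l k = 1 ∧ x = ∑ k, l k • p k ∧ ∀ k ∉ T, l k = 0 := by
  classical
  have hconv : Convex ℝ ((Fintype.linearCombination ℝ p) ''
      (stdSimplex ℝ ι ∩ {l | ∀ k ∉ T, l k = 0})) := by
    refine Convex.linear_image ((convex_stdSimplex ℝ ι).inter ?_) _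
    intro a ha b hb s t _ _ _ k hk
    simp [ha k hk, hb k hk]
  have hsub : p '' T ⊆ (Fintype.linearCombination ℝ p) ''
      (stdSimplex ℝ ι ∩ {l | ∀ k ∉ T, l k = 0}) := by
    rintro _ ⟨k, hk, rfl⟩
    refine ⟨Pi.single k 1, ⟨single_mem_stdSimplex ℝ k, fun k' hk' => ?_⟩, ?_⟩
    · have : k' ≠ k := fun h => hk' (h ▸ hk)
      simp [this]
    · simp [Fintype.linearCombination_apply, Pi.single_apply]
  obtain ⟨l, ⟨⟨h0, h1⟩, h2⟩, rfl⟩ := convexHull_min hsub hconv hx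
  exact ⟨l, h0, h1, by rw [Fintype.linearCombination_apply], h2⟩

lemma exists_weights_of_mem_convexHull_range {p : ι → E} {x : E}
    (hx : x ∈ convexHull ℝ (range p)) :
    ∃ l : ι → ℝ, (∀ k, 0 ≤ l k) ∧ ∑ k, l k = 1 ∧ x = ∑ k, l k • p k := by
  rw [← image_univ] at hx
  obtain ⟨l, h0, h1, h2, _⟩ := exists_weights_of_mem_convexHull_image hx
  exact ⟨l, h0, h1, h2⟩

lemma weights_unique {p : ι → E} (hp : AffineIndependent ℝ p) {l l' : ι → ℝ}
    (h : ∑ k, l k = ∑ k, l' k) (h' : ∑ k, l k • p k = ∑ k, l' k • p k) : l = l' := by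
  funext k
  have := (affineIndependent_iff.1 hp) Finset.univ (fun k => l k - l' k)
    (by rw [Finset.sum_sub_distrib, h, sub_self])
    (by simp only [sub_smul, Finset.sum_sub_distrib]; rw [h', sub_self]) k (Finset.mem_univ k)
  exact sub_eq_zero.1 this

/-- The vertices that carry a positive weight of a point belong to every face containing it. -/
lemma mem_of_pos_of_mem_convexHull {p : ι → E} (hp : AffineIndependent ℝ p) {l : ι → ℝ}
    (h1 : ∑ k, l k = 1) {T : Set ι} (hx : ∑ k, l k • p k ∈ convexHull ℝ (p '' T)) {k : ι}
    (hk : 0 < l k) : k ∈ T := by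
  by_contra hkT
  obtain ⟨l', h0', h1', he, hT⟩ := exists_weights_of_mem_convexHull_image hx
  have := congrFun (weights_unique hp (h1.trans h1'.symm) he) k
  rw [hT k hkT] at this
  exact hk.ne' this

end Barycentric

/-! ### Faces of simplices have null projections. -/

section Faces

variable {n : ℕ}

/-- `n` points of `ℝⁿ` span an affine subspace of dimension at most `n - 1`; for `n = 0` the hull is
empty. -/
lemma volume_convexHull_range_eq_zero (f : Fin n → Fin n → ℝ) :
    volume (convexHull ℝ (range f)) = 0 := by
  rcases n with _ | n
  · simp
  · refine measure_mono_null (convexHull_subset_affineSpan _)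
      (Measure.addHaar_affineSubspace volume _ fun htop => ?_)
    have h1 := finrank_vectorSpan_range_le ℝ f (n := n) (by simp)
    have h2 : vectorSpan ℝ (range f) = ⊤ := by
      rw [← direction_affineSpan, htop, AffineSubspace.direction_top]
    rw [h2, finrank_top, Module.finrank_fin_fun] at h1
    omega

lemma convexHull_compl_eq (p : Fin (n + 1) → Vec n) (k : Fin (n + 1)) :
    convexHull ℝ (p '' {k}ᶜ) = convexHull ℝ (range fun l => p (k.succAbove l)) := by
  rw [← Fin.range_succAbove, ← range_comp]
  rfl

lemma volume_dropCoord_range_eq_zero (i : Fin (n + 1)) (f : Fin n → Vec n) :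
    volume (dropCoord i '' convexHull ℝ (range f)) = 0 := by
  have h := (dropCoord i).toLinearMap.image_convexHull (range f)
  rw [← range_comp] at h
  rw [show dropCoord i '' convexHull ℝ (range f) = _ from h]
  exact volume_convexHull_range_eq_zero _

lemma volume_dropCoord_face_eq_zero (i : Fin (n + 1)) (p : Fin (n + 1) → Vec n)
    (k : Fin (n + 1)) : volume (dropCoord i '' convexHull ℝ (p '' {k}ᶜ)) = 0 := by
  rw [convexHull_compl_eq]
  exact volume_dropCoord_range_eq_zero i _

lemma convexHull_subset_openSimplex_union (p : Fin (n + 1) → Vec n) :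
    convexHull ℝ (range p) ⊆ openSimplex p ∪ ⋃ k, convexHull ℝ (p '' {k}ᶜ) := by
  intro x hx
  obtain ⟨l, h0, h1, rfl⟩ := exists_weights_of_mem_convexHull_range hx
  by_cases h : ∀ k, 0 < l k
  · exact Or.inl ⟨l, h, h1, rfl⟩
  · push Not at h
    obtain ⟨k, hk⟩ := h
    refine Or.inr (mem_iUnion.2 ⟨k, sum_smul_mem_convexHull h0 h1 fun k' hk' => ?_⟩)
    rw [notMem_compl_iff, mem_singleton_iff] at hk'
    rw [hk']
    exact le_antisymm hk (h0 k)

lemma openSimplex_subset_convexHull (p : Fin (n + 1) → Vec n) :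
    openSimplex p ⊆ convexHull ℝ (range p) := by
  rintro x ⟨l, hl, h1, rfl⟩
  rw [← image_univ]
  exact sum_smul_mem_convexHull (fun k => (hl k).le) h1 fun k hk => absurd (mem_univ k) hk

end Faces

/-! ### The interface as a flat boundary, and the volume that it encloses. -/

section Interface

variable {n J K : ℕ} {m : SurfMesh n J K} {Ω : Set (Vec n)} {q : Fin K → Vec n} {Om : Set (Vec n)}

/-- By conformity the point lies in the hull of the common vertices, and barycentric weights are
unique, so all its positive weights sit on common vertices. -/
lemma SurfMesh.IsInterface.mem_range_of_pos (h : m.IsInterface Ω q Om) {j j' : Fin J}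
    {l : Fin (n + 1) → ℝ} (h0 : ∀ k, 0 ≤ l k) (h1 : ∑ k, l k = 1)
    (hx : lin (m.loc q j) l ∈ convexHull ℝ (range (m.loc q j'))) {k : Fin (n + 1)}
    (hk : 0 < l k) : m.vert j k ∈ range (m.vert j') := by
  have hmem : lin (m.loc q j) l ∈ convexHull ℝ (range (m.loc q j)) := by
    rw [← image_univ]
    exact sum_smul_mem_convexHull h0 h1 fun k hk => absurd (mem_univ k) hk
  have h2 := mem_inter hmem hx
  rw [h.conforming j j'] at h2
  have h3 : q '' (range (m.vert j) ∩ range (m.vert j')) =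
      m.loc q j '' {k | m.vert j k ∈ range (m.vert j')} := by
    ext x
    constructor
    · rintro ⟨_, ⟨⟨k, rfl⟩, hk⟩, rfl⟩
      exact ⟨k, hk, rfl⟩
    · rintro ⟨k, hk, rfl⟩
      exact ⟨_, ⟨⟨k, rfl⟩, hk⟩, rfl⟩
  rw [h3] at h2
  exact mem_of_pos_of_mem_convexHull (h.nondegenerate j) h1 h2 hk

lemma SurfMesh.eq_of_range_subset (m : SurfMesh n J K) {j j' : Fin J}
    (h : ∀ k, m.vert j k ∈ range (m.vert j')) : j = j' := by
  refine m.distinct ?_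
  have hsub : range (m.vert j) ⊆ range (m.vert j') := by
    rintro _ ⟨k, rfl⟩
    exact h k
  refine Set.eq_of_subset_of_ncard_le hsub ?_ (finite_range _)
  rw [Set.ncard_range_of_injective (m.vert_inj j), Set.ncard_range_of_injective (m.vert_inj j')]

/-- A point of an open simplex has positive weight at every vertex; in a second simplex it would
force the two vertex sets to agree. -/
lemma SurfMesh.IsInterface.disjoint_openSimplex (h : m.IsInterface Ω q Om) {j j' : Fin J}
    (hne : j ≠ j') : Disjoint (openSimplex (m.loc q j)) (openSimplex (m.loc q j')) := by
  refine disjoint_left.2 fun x hx hx' => hne (m.eq_of_range_subset fun k => ?_)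
  have h2 := openSimplex_subset_convexHull _ hx'
  obtain ⟨l, hl, h1, rfl⟩ := hx
  exact h.mem_range_of_pos (fun k => (hl k).le) h1 h2 (hl k)

lemma SurfMesh.IsInterface.flatBoundary (h : m.IsInterface Ω q Om)
    (hΩ : Bornology.IsBounded Ω) :
    FlatBoundary Om (m.loc q) (fun _ => 1) (⋃ j, ⋃ k, convexHull ℝ (m.loc q j '' {k}ᶜ)) where
  measurableSet := h.isOpen.measurableSet
  isBounded := hΩ.subset (subset_closure.trans h.subset)
  sign _ := Or.inl rfl
  null i := by
    simp only [image_iUnion, measure_iUnion_null_iff]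
    exact fun j k => volume_dropCoord_face_eq_zero i _ k
  frontier_subset := by
    rw [h.frontier_eq]
    refine iUnion_subset fun j => (convexHull_subset_openSimplex_union _).trans ?_
    exact union_subset_union (subset_iUnion (fun j => openSimplex (m.loc q j)) j)
      (subset_iUnion (fun j => ⋃ k, convexHull ℝ (m.loc q j '' {k}ᶜ)) j)
  disjoint _ _ hne := h.disjoint_openSimplex hne
  normal j x hx := by
    rw [one_smul]
    exact h.normal j x hx

/-- The volume enclosed by a polyhedral surface. -/
lemma SurfMesh.IsInterface.volume_eq (hn : n = 1 ∨ n = 2) (h : m.IsInterface Ω q Om)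
    (hΩ : Bornology.IsBounded Ω) :
    (volume Om).toReal = 1 / ((n + 1).factorial : ℝ) *
      ∑ j, inner ℝ (normalVec (m.loc q j)) (q (m.vert j 0)) := by
  have hA := h.flatBoundary hΩ
  have hfin : volume Om ≠ ⊤ := hA.isBounded.measure_lt_top.ne
  -- The divergence theorem for `φ = x_i`, whose derivative is one. Summing over the `d` directions
  -- gives the symmetric formula with `x · N`.
  have hi : ∀ i : Fin (n + 1), (volume Om).toReal = ∑ j, normalVec (m.loc q j) i *
      (1 / ((n + 1).factorial : ℝ) * ∑ k, m.loc q j k i) := by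
    intro i
    have h1 := hA.integral_partialDeriv i (φ := fun x => x i) (ψ := fun _ => 1)
      (by fun_prop) (integrableOn_const hfin)
      (Eventually.of_forall fun y => ⟨∅, countable_empty, fun r _ _ => by
        simp only [linePt_self]
        exact hasDerivAt_id r⟩)
    rw [setIntegral_const, smul_eq_mul, mul_one, measureReal_def] at h1
    rw [h1]
    refine Finset.sum_congr rfl fun j _ => ?_
    rw [one_mul, ← integral_lin_bary hn]
    congr 2
    funext y
    simp [lin]
  have hd : ((n : ℝ) + 1) * (volume Om).toReal = ∑ i : Fin (n + 1), (volume Om).toReal := by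
    simp
  have hkey : ((n : ℝ) + 1) * (volume Om).toReal = ((n : ℝ) + 1) *
      (1 / ((n + 1).factorial : ℝ) *
        ∑ j, inner ℝ (normalVec (m.loc q j)) (q (m.vert j 0))) := by
    rw [hd]
    conv_lhs => enter [2, i]; rw [hi i]
    rw [Finset.sum_comm, Finset.mul_sum, Finset.mul_sum]
    refine Finset.sum_congr rfl fun j _ => ?_
    -- `x · N` is constant on a flat simplex, so one vertex represents all.
    have h2 : ∀ k, inner ℝ (normalVec (m.loc q j)) (m.loc q j k) =
        inner ℝ (normalVec (m.loc q j)) (q (m.vert j 0)) := fun k => by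
      have := inner_normalVec_edge (m.loc q j) k
      rw [inner_sub_right, sub_eq_zero] at this
      exact this
    have h3 : ∑ i, normalVec (m.loc q j) i * (1 / ((n + 1).factorial : ℝ) * ∑ k, m.loc q j k i)
        = 1 / ((n + 1).factorial : ℝ) * ∑ k, inner ℝ (normalVec (m.loc q j)) (m.loc q j k) := by
      simp only [PiLp.inner_apply, RCLike.inner_apply, conj_trivial]
      rw [Finset.sum_comm, Finset.mul_sum]
      refine Finset.sum_congr rfl fun i _ => ?_
      rw [← Finset.sum_mul]
      ring
    rw [h3, Finset.sum_congr rfl fun k _ => h2 k]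
    simp
    ring
  exact mul_left_cancel₀ (by positivity) hkey

end Interface

/-! ### Determinants of vertex tuples and their relation to the normal vector. -/

section Determinants

variable {n : ℕ}

/-- The determinant of the matrix whose rows are the given points. -/
noncomputable def detM (p : Fin (n + 1) → Vec n) : ℝ := Matrix.det (Matrix.of fun k => (p k).ofLp)

lemma detM_comp_perm (p : Fin (n + 1) → Vec n) (π : Equiv.Perm (Fin (n + 1))) :
    detM (p ∘ π) = (Equiv.Perm.sign π : ℤ) * detM p :=
  Matrix.det_permute π (Matrix.of fun k => (p k).ofLp)

lemma detM_eq_zero {p : Fin (n + 1) → Vec n} {k l : Fin (n + 1)} (hkl : k ≠ l)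
    (h : p k = p l) : detM p = 0 :=
  Matrix.det_zero_of_row_eq hkl (congrArg WithLp.ofLp h)

lemma normalVec_triangle (p : Fin 3 → Vec 2) : normalVec p =
    !₂[(p 1 1 - p 0 1) * (p 2 2 - p 0 2) - (p 1 2 - p 0 2) * (p 2 1 - p 0 1),
      (p 1 2 - p 0 2) * (p 2 0 - p 0 0) - (p 1 0 - p 0 0) * (p 2 2 - p 0 2),
      (p 1 0 - p 0 0) * (p 2 1 - p 0 1) - (p 1 1 - p 0 1) * (p 2 0 - p 0 0)] := by
  ext i
  rw [normalVec_apply, Matrix.det_fin_two]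
  fin_cases i <;> simp [edgeMat, Fin.succAbove]

/-- Multilinear expansion of the determinant of `w` and the edges `p_k - p_0`. It writes the normal
without a distinguished vertex, which makes permutations of the vertices transparent. -/
lemma inner_normalVec_eq_sum (hn : n = 1 ∨ n = 2) (p : Fin (n + 1) → Vec n) (w : Vec n) :
    inner ℝ (normalVec p) w = ∑ i, detM (Function.update p i w) := by
  rcases hn with rfl | rfl
  · rw [normalVec_segment, PiLp.inner_apply]
    simp [Fin.sum_univ_two, detM, Matrix.det_fin_two]
    ring
  · rw [normalVec_triangle, PiLp.inner_apply]
    simp [Fin.sum_univ_three, detM, Matrix.det_fin_three]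
    ring

lemma inner_normalVec_zero (hn : n = 1 ∨ n = 2) (p : Fin (n + 1) → Vec n) :
    inner ℝ (normalVec p) (p 0) = detM p := by
  rw [inner_normalVec_eq_sum hn, Finset.sum_eq_single 0]
  · rw [Function.update_eq_self]
  · intro k _ hk
    exact detM_eq_zero hk (by simp [hk.symm])
  · simp

lemma normalVec_comp_perm (hn : n = 1 ∨ n = 2) (p : Fin (n + 1) → Vec n)
    (π : Equiv.Perm (Fin (n + 1))) :
    normalVec (p ∘ π) = ((Equiv.Perm.sign π : ℤ) : ℝ) • normalVec p := by
  refine ext_inner_right ℝ fun w => ?_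
  rw [inner_smul_left, inner_normalVec_eq_sum hn, inner_normalVec_eq_sum hn, Finset.mul_sum,
    ← Equiv.sum_comp π fun k => (starRingEnd ℝ) ((Equiv.Perm.sign π : ℤ) : ℝ) *
      detM (Function.update p k w)]
  refine Finset.sum_congr rfl fun k _ => ?_
  rw [conj_trivial, ← detM_comp_perm, Function.update_comp_equiv, Equiv.symm_apply_apply]

/-- Up to sign, both sides are the determinant of the edges of the `d`-simplex spanned by `p` and
`c`; exchanging `p i` and `c` reverses its orientation. -/
lemma inner_normalVec_update (hn : n = 1 ∨ n = 2) (p : Fin (n + 1) → Vec n) (c : Vec n)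
    {i l : Fin (n + 1)} (hl : l ≠ i) :
    inner ℝ (normalVec (Function.update p i c)) (p i - p l) =
      -inner ℝ (normalVec p) (c - p l) := by
  rcases hn with rfl | rfl
  · rw [normalVec_segment, normalVec_segment, PiLp.inner_apply, PiLp.inner_apply]
    fin_cases i <;> fin_cases l <;> first | exact absurd rfl hl | skip
    all_goals
      simp [Fin.sum_univ_two]
      ring
  · rw [normalVec_triangle, normalVec_triangle, PiLp.inner_apply, PiLp.inner_apply]
    fin_cases i <;> fin_cases l <;> first | exact absurd rfl hl | skip
    all_goals
      simp [Fin.sum_univ_three]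
      ring

/-- Moving one vertex within the plane of the simplex scales the oriented area by the barycentric
weight at that vertex; the sign of the weight tells on which side of the opposite facet the new
vertex lies. -/
lemma normalVec_update_sum (hn : n = 1 ∨ n = 2) (p : Fin (n + 1) → Vec n) {α : Fin (n + 1) → ℝ}
    (hα : ∑ k, α k = 1) (i : Fin (n + 1)) :
    normalVec (Function.update p i (∑ k, α k • p k)) = α i • normalVec p := by
  rcases hn with rfl | rfl
  · rw [normalVec_segment, normalVec_segment]
    rw [Fin.sum_univ_two] at hα ⊢
    have h0 : α 0 = 1 - α 1 := by linarith
    ext l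
    fin_cases i <;> fin_cases l <;> simp [h0] <;> ring
  · rw [normalVec_triangle, normalVec_triangle]
    rw [Fin.sum_univ_three] at hα ⊢
    have h0 : α 0 = 1 - α 1 - α 2 := by linarith
    ext l
    fin_cases i <;> fin_cases l <;> simp [h0] <;> ring

lemma exists_weights_of_inner_normalVec {p : Fin (n + 1) → Vec n} (hp : AffineIndependent ℝ p)
    {c : Vec n} (hc : inner ℝ (normalVec p) (c - p 0) = 0) :
    ∃ α : Fin (n + 1) → ℝ, ∑ k, α k = 1 ∧ c = ∑ k, α k • p k := by
  have hu : IsUnit (frameT p)ᵀ.det := by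
    rw [Matrix.det_transpose]
    exact isUnit_det_frameT hp
  set a : Fin (n + 1) → ℝ := ((frameT p)ᵀ)⁻¹ *ᵥ (c - p 0).ofLp with ha
  have h1 : (frameT p)ᵀ *ᵥ a = (c - p 0).ofLp := by
    rw [ha, Matrix.mulVec_mulVec, Matrix.mul_nonsing_inv _ hu, Matrix.one_mulVec]
  have h2 : c - p 0 = a 0 • normalVec p + ∑ k : Fin n, a k.succ • (p k.succ - p 0) := by
    ext l
    have := congrFun h1 l
    rw [← this]
    simp [Matrix.mulVec, dotProduct, frameT, Fin.sum_univ_succ, mul_comm]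
  have h3 : a 0 = 0 := by
    rw [h2, inner_add_right, inner_sum, inner_smul_right, Finset.sum_eq_zero, add_zero,
      real_inner_self_eq_norm_sq] at hc
    · have := norm_ne_zero_iff.2 (normalVec_ne_zero hp)
      rcases mul_eq_zero.1 hc with h | h
      · exact h
      · exact absurd h (pow_ne_zero 2 this)
    · intro k _
      rw [inner_smul_right, inner_normalVec_edge, mul_zero]
  rw [h3, zero_smul, zero_add] at h2
  refine ⟨bary fun k : Fin n => a k.succ, sum_bary _, ?_⟩
  have h4 := lin_bary p fun k : Fin n => a k.succ
  rw [lin] at h4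
  rw [h4, ← h2]
  abel

end Determinants

/-! ### Outward normals force opposite orientations along a common facet. -/

section Orientation

variable {n : ℕ}

lemma IsOuterNormal.eventually {A : Set (Vec n)} {x e : Vec n} (h : IsOuterNormal A x e) :
    ∀ᶠ z in 𝓝 x, (z ∈ A ↔ inner ℝ (z - x) e < 0) := by
  obtain ⟨_, ρ, hρ, hA⟩ := h
  filter_upwards [Metric.ball_mem_nhds x hρ] with z hz using hA z hz

lemma inner_unitNormal_neg_iff {p : Fin (n + 1) → Vec n} (hp : AffineIndependent ℝ p) (w : Vec n) :
    inner ℝ w (unitNormal p) < 0 ↔ inner ℝ (normalVec p) w < 0 := by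
  have hpos : 0 < ‖normalVec p‖⁻¹ := inv_pos.2 (norm_pos_iff.2 (normalVec_ne_zero hp))
  rw [unitNormal, inner_smul_right, real_inner_comm]
  constructor
  · intro h
    by_contra hcon
    exact absurd (mul_nonneg hpos.le (not_lt.1 hcon)) (not_le.2 h)
  · exact fun h => mul_neg_of_pos_of_neg hpos h

lemma inner_normalVec_of_mem_convexHull {p : Fin (n + 1) → Vec n} {x z : Vec n}
    (hz : z ∈ convexHull ℝ (range p)) (hx : ∀ k, inner ℝ (normalVec p) (p k - x) = 0) :
    inner ℝ (normalVec p) (z - x) = 0 := by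
  obtain ⟨l, h0, h1, rfl⟩ := exists_weights_of_mem_convexHull_range hz
  have : ∑ k, l k • p k - x = ∑ k, l k • (p k - x) := by
    simp only [smul_sub, Finset.sum_sub_distrib, ← Finset.sum_smul, h1, one_smul]
  rw [this, inner_sum]
  exact Finset.sum_eq_zero fun k _ => by rw [inner_smul_right, hx, mul_zero]

/-- The barycenter of the facet opposite to the `i`-th vertex. -/
noncomputable def facetCenter (p : Fin (n + 1) → Vec n) (i : Fin (n + 1)) : Vec n :=
  ∑ k, (if k = i then 0 else 1 / (n : ℝ)) • p k

lemma sum_facetWeights (hn : n ≠ 0) (i : Fin (n + 1)) :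
    ∑ k, (if k = i then 0 else 1 / (n : ℝ)) = 1 := by
  have hn' : (n : ℝ) ≠ 0 := by exact_mod_cast hn
  rw [← Finset.add_sum_erase _ _ (Finset.mem_univ i), if_pos rfl, zero_add,
    Finset.sum_congr rfl fun k hk => if_neg (Finset.ne_of_mem_erase hk)]
  simp
  field_simp

lemma facetCenter_update (p : Fin (n + 1) → Vec n) (i : Fin (n + 1)) (c : Vec n) :
    facetCenter (Function.update p i c) i = facetCenter p i := by
  refine Finset.sum_congr rfl fun k _ => ?_
  by_cases hk : k = i
  · simp [hk]
  · simp [hk]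

lemma facetCenter_add_mem_openSimplex (hn : n ≠ 0) (p : Fin (n + 1) → Vec n) (i : Fin (n + 1))
    {ε : ℝ} (h0 : 0 < ε) (h1 : ε < 1) :
    facetCenter p i + ε • (p i - facetCenter p i) ∈ openSimplex p := by
  have hn' : (0 : ℝ) < n := by exact_mod_cast Nat.pos_of_ne_zero hn
  refine ⟨fun k => (1 - ε) * (if k = i then 0 else 1 / (n : ℝ)) + ε * (if k = i then 1 else 0),
    fun k => ?_, ?_, ?_⟩
  · by_cases hk : k = i
    · simp [hk, h0]
    · simp only [hk, if_false, mul_zero, add_zero]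
      exact mul_pos (sub_pos.2 h1) (by positivity)
  · rw [Finset.sum_add_distrib, ← Finset.mul_sum, ← Finset.mul_sum, sum_facetWeights hn]
    simp
  · rw [lin]
    simp only [add_smul, Finset.sum_add_distrib, mul_smul, ← Finset.smul_sum]
    simp only [ite_smul, one_smul, zero_smul, Finset.sum_ite_eq', Finset.mem_univ, if_true]
    rw [facetCenter]
    simp only [ite_smul, zero_smul]
    module

lemma inner_normalVec_sub_facetCenter (hn : n ≠ 0) (p : Fin (n + 1) → Vec n)
    (i k : Fin (n + 1)) : inner ℝ (normalVec p) (p k - facetCenter p i) = 0 := by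
  have : p k - facetCenter p i = ∑ l, (if l = i then 0 else 1 / (n : ℝ)) • (p k - p l) := by
    simp only [smul_sub, Finset.sum_sub_distrib, ← Finset.sum_smul, sum_facetWeights hn, one_smul]
    rfl
  rw [this, inner_sum]
  exact Finset.sum_eq_zero fun l _ => by rw [inner_smul_right, inner_normalVec_sub, mul_zero]

/-- Two simplices that share a facet, and that are ordered in the same way along it, cannot both
have outward unit normals. -/
lemma false_of_outward_of_update (hn : n = 1 ∨ n = 2) {A : Set (Vec n)} {p : Fin (n + 1) → Vec n}
    {i : Fin (n + 1)} {c : Vec n} (hp : AffineIndependent ℝ p)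
    (hp' : AffineIndependent ℝ (Function.update p i c))
    (hdisj : Disjoint (openSimplex p) (openSimplex (Function.update p i c)))
    (hN : ∀ x ∈ openSimplex p, IsOuterNormal A x (unitNormal p))
    (hN' : ∀ x ∈ openSimplex (Function.update p i c),
      IsOuterNormal A x (unitNormal (Function.update p i c)))
    {ρ : ℝ} (hρ : 0 < ρ) (hfr : ∀ z ∈ Metric.ball (facetCenter p i) ρ, z ∈ frontier A →
      z ∈ convexHull ℝ (range p) ∨ z ∈ convexHull ℝ (range (Function.update p i c))) : False := by
  have hn0 : n ≠ 0 := by omega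
  obtain ⟨l₀, hl₀⟩ : ∃ l : Fin (n + 1), l ≠ i := by
    have : Nontrivial (Fin (n + 1)) := Fin.nontrivial_iff_two_le.2 (by omega)
    exact exists_ne i
  set p' := Function.update p i c with hp'def
  set x := facetCenter p i with hx
  have hx' : facetCenter p' i = x := facetCenter_update p i c
  have hNp := inner_normalVec_sub_facetCenter hn0 p i
  have hNp' := inner_normalVec_sub_facetCenter hn0 p' i
  rw [hx'] at hNp'
  rw [← hx] at hNp
  have hp'i : p' i = c := by simp [hp'def]
  have hp'l : p' l₀ = p l₀ := by simp [hp'def, hl₀]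
  set u := p i - x with hu
  set v := c - x with hv
  have hNu : inner ℝ (normalVec p) u = 0 := hNp i
  have hN'v : inner ℝ (normalVec p') v = 0 := by rw [hv, ← hp'i]; exact hNp' i
  -- The base point is moved from the facet center to the common vertex `l₀`, which changes nothing
  -- since both normals are orthogonal to the facet.
  have hswap : inner ℝ (normalVec p') u = -inner ℝ (normalVec p) v := by
    have h1 := inner_normalVec_update hn p c hl₀
    have h2 : u = (p i - p l₀) + (p' l₀ - x) := by rw [hp'l, hu]; abel
    have h3 : v = (c - p l₀) + (p l₀ - x) := by rw [hv]; abel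
    rw [h2, h3, inner_add_right, inner_add_right, hNp', hNp, add_zero, add_zero]
    exact h1
  have hyc : ∀ w : Vec n, Tendsto (fun ε : ℝ => x + ε • w) (𝓝[>] 0) (𝓝 x) := fun w => by
    have : Continuous fun ε : ℝ => x + ε • w := by fun_prop
    have h := this.tendsto 0
    simp only [zero_smul, add_zero] at h
    exact h.mono_left nhdsWithin_le_nhds
  have hball := Metric.ball_mem_nhds x hρ
  have h01 : Ioo (0 : ℝ) 1 ∈ 𝓝[>] (0 : ℝ) := Ioo_mem_nhdsGT one_pos
  by_cases hcop : inner ℝ (normalVec p) v = 0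
  · -- coplanar simplices
    have hc0 : inner ℝ (normalVec p) (c - p 0) = 0 := by
      have : c - p 0 = v - (p 0 - x) := by rw [hv]; abel
      rw [this, inner_sub_right, hcop, hNp, sub_zero]
    obtain ⟨α, hα1, hαc⟩ := exists_weights_of_inner_normalVec hp hc0
    have hNN : normalVec p' = α i • normalVec p := by
      rw [hp'def, hαc]
      exact normalVec_update_sum hn p hα1 i
    -- Weight zero would make the second simplex degenerate; a positive weight would place both
    -- simplices on the same side of the facet, where they overlap near its center.
    have hαi : α i < 0 := by
      by_contra hcon
      rcases (not_lt.1 hcon).eq_or_lt with h0 | hpos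
      · exact normalVec_ne_zero hp' (by rw [hNN, ← h0, zero_smul])
      · have hn' : (0 : ℝ) < n := by exact_mod_cast Nat.pos_of_ne_zero hn0
        have hw : ∀ k, ∀ᶠ ε : ℝ in 𝓝[>] 0,
            0 < (1 - ε) * (if k = i then 0 else 1 / (n : ℝ)) + ε * α k := by
          intro k
          by_cases hk : k = i
          · filter_upwards [self_mem_nhdsWithin] with ε hε
            rw [if_pos hk, hk, mul_zero, zero_add]
            exact mul_pos hε hpos
          · simp only [if_neg hk]
            have hcont : Continuous fun ε : ℝ => (1 - ε) * (1 / (n : ℝ)) + ε * α k := by fun_prop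
            have h := hcont.tendsto 0
            simp only [sub_zero, one_mul, zero_mul, add_zero] at h
            exact (h.mono_left nhdsWithin_le_nhds).eventually (lt_mem_nhds (by positivity))
        obtain ⟨ε, hε, hε01⟩ := ((eventually_all.2 hw).and h01).exists
        have hmem : x + ε • v ∈ openSimplex p' := by
          have := facetCenter_add_mem_openSimplex hn0 p' i hε01.1 hε01.2
          rwa [hx', hp'i] at this
        refine disjoint_left.1 hdisj ⟨_, hε, ?_, ?_⟩ hmem
        · rw [Finset.sum_add_distrib, ← Finset.mul_sum, ← Finset.mul_sum, sum_facetWeights hn0, hα1]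
          ring
        · rw [lin]
          simp only [add_smul, Finset.sum_add_distrib, mul_smul, ← Finset.smul_sum]
          rw [← hαc, hv, hx, facetCenter]
          module
    -- A half ball over the common plane contains no boundary points, so it lies in `A` or in the
    -- complement. The normals point in opposite directions, so just above the first simplex it is
    -- outside and just above the second it is inside.
    set S : Set (Vec n) := Metric.ball x ρ ∩ {z | 0 < inner ℝ (normalVec p) (z - x)} with hS
    have hSc : IsPreconnected S := by
      refine ((convex_ball x ρ).inter ?_).isPreconnected
      intro a ha b hb s t hs ht hst
      simp only [mem_ofPred_eq] at ha hb ⊢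
      have : s • a + t • b - x = s • (a - x) + t • (b - x) := by
        have : x = (s + t) • x := by rw [hst, one_smul]
        nth_rewrite 1 [this]
        module
      rw [this, inner_add_right, inner_smul_right, inner_smul_right]
      rcases hs.eq_or_lt with rfl | hs'
      · rw [zero_add] at hst
        rw [hst]
        linarith
      · have := mul_pos hs' ha
        have := mul_nonneg ht hb.le
        linarith
    have hSfr : ∀ z ∈ S, z ∉ frontier A := by
      intro z hz hzf
      rcases hfr z hz.1 hzf with h | h
      · exact hz.2.ne' (inner_normalVec_of_mem_convexHull h hNp)
      · have h1 := inner_normalVec_of_mem_convexHull h hNp'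
        rw [hNN, inner_smul_left, conj_trivial] at h1
        exact (mul_ne_zero hαi.ne hz.2.ne') h1
    obtain ⟨ε, ⟨h1, h2⟩, hε⟩ :=
      (((hyc u).eventually hball).and ((hyc v).eventually hball)).and h01 |>.exists
    have hy : x + ε • u ∈ openSimplex p := facetCenter_add_mem_openSimplex hn0 p i hε.1 hε.2
    have hy' : x + ε • v ∈ openSimplex p' := by
      have := facetCenter_add_mem_openSimplex hn0 p' i hε.1 hε.2
      rwa [hx', hp'i] at this
    have hshift : ∀ y : Vec n, Tendsto (fun δ : ℝ => y + δ • normalVec p) (𝓝[>] 0) (𝓝 y) :=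
      fun y => by
        have : Continuous fun δ : ℝ => y + δ • normalVec p := by fun_prop
        have h := this.tendsto 0
        simp only [zero_smul, add_zero] at h
        exact h.mono_left nhdsWithin_le_nhds
    have hNpos : 0 < inner ℝ (normalVec p) (normalVec p) := by
      rw [real_inner_self_eq_norm_sq]
      exact pow_pos (norm_pos_iff.2 (normalVec_ne_zero hp)) 2
    have hpos : ∀ᶠ δ : ℝ in 𝓝[>] 0, 0 < δ := self_mem_nhdsWithin
    obtain ⟨δ, ⟨hδ0, hδb⟩, hδA⟩ := ((hpos.and ((hshift _).eventually
      (Metric.isOpen_ball.mem_nhds h1))).and ((hshift _).eventually (hN _ hy).eventually)).exists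
    obtain ⟨δ', ⟨hδ0', hδb'⟩, hδA'⟩ := ((hpos.and ((hshift _).eventually
      (Metric.isOpen_ball.mem_nhds h2))).and ((hshift _).eventually (hN' _ hy').eventually)).exists
    have hmem : x + ε • u + δ • normalVec p ∈ S := by
      refine ⟨hδb, ?_⟩
      simp only [mem_ofPred_eq]
      rw [add_assoc, add_sub_cancel_left, inner_add_right, inner_smul_right, inner_smul_right, hNu,
        mul_zero, zero_add]
      exact mul_pos hδ0 hNpos
    have hmem' : x + ε • v + δ' • normalVec p ∈ S := by
      refine ⟨hδb', ?_⟩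
      simp only [mem_ofPred_eq]
      rw [add_assoc, add_sub_cancel_left, inner_add_right, inner_smul_right, inner_smul_right, hcop,
        mul_zero, zero_add]
      exact mul_pos hδ0' hNpos
    have hout : x + ε • u + δ • normalVec p ∉ A := fun h => by
      have := hδA.1 h
      rw [add_sub_cancel_left, inner_unitNormal_neg_iff hp, inner_smul_right] at this
      exact lt_asymm this (mul_pos hδ0 hNpos)
    have hin : x + ε • v + δ' • normalVec p ∈ A := by
      refine hδA'.2 ?_
      rw [add_sub_cancel_left, inner_unitNormal_neg_iff hp', inner_smul_right, hNN, inner_smul_left,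
        conj_trivial]
      exact mul_neg_of_pos_of_neg hδ0' (mul_neg_of_neg_of_pos hαi hNpos)
    rcases hSc.subset_or_disjoint_of_disjoint_frontier hSfr with h | h
    · exact hout (h hmem)
    · exact h hmem' hin
  · -- the segment between two points close to the common facet
    obtain ⟨ε, ⟨h1, h2⟩, hε⟩ :=
      (((hyc u).eventually hball).and ((hyc v).eventually hball)).and h01 |>.exists
    have hy : x + ε • u ∈ openSimplex p := facetCenter_add_mem_openSimplex hn0 p i hε.1 hε.2
    have hy' : x + ε • v ∈ openSimplex p' := by
      have := facetCenter_add_mem_openSimplex hn0 p' i hε.1 hε.2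
      rwa [hx', hp'i] at this
    set g : ℝ → Vec n := fun s => (1 - s) • (x + ε • u) + s • (x + ε • v) with hg
    have hgc : Continuous g := by fun_prop
    have hgx : ∀ s, g s - x = ε • ((1 - s) • u + s • v) := fun s => by rw [hg]; module
    have hgy : ∀ s, g s - (x + ε • u) = (ε * s) • (v - u) := fun s => by rw [hg]; module
    have hgy' : ∀ s, g s - (x + ε • v) = (ε * (1 - s)) • (u - v) := fun s => by rw [hg]; module
    have hSc : IsPreconnected (g '' Ioo 0 1) := isPreconnected_Ioo.image g hgc.continuousOn
    have hSfr : ∀ z ∈ g '' Ioo 0 1, z ∉ frontier A := by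
      rintro _ ⟨s, hs, rfl⟩ hzf
      have hgb : g s ∈ Metric.ball x ρ :=
        (convex_ball x ρ) h1 h2 (sub_nonneg.2 hs.2.le) hs.1.le (by ring)
      rcases hfr _ hgb hzf with h | h
      · have h3 := inner_normalVec_of_mem_convexHull h hNp
        rw [hgx, inner_smul_right, inner_add_right, inner_smul_right, inner_smul_right, hNu,
          mul_zero, zero_add] at h3
        exact mul_ne_zero hε.1.ne' (mul_ne_zero hs.1.ne' hcop) h3
      · have h3 := inner_normalVec_of_mem_convexHull h hNp'
        rw [hgx, inner_smul_right, inner_add_right, inner_smul_right, inner_smul_right, hN'v,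
          mul_zero, add_zero, hswap] at h3
        exact mul_ne_zero hε.1.ne' (mul_ne_zero (sub_pos.2 hs.2).ne' (neg_ne_zero.2 hcop)) h3
    have ht0 : Tendsto g (𝓝[>] 0) (𝓝 (x + ε • u)) := by
      have h := hgc.tendsto 0
      simp only [hg, sub_zero, one_smul, zero_smul, add_zero] at h
      exact h.mono_left nhdsWithin_le_nhds
    have ht1 : Tendsto g (𝓝[<] 1) (𝓝 (x + ε • v)) := by
      have h := hgc.tendsto 1
      simp only [hg, sub_self, one_smul, zero_smul, zero_add] at h
      exact h.mono_left nhdsWithin_le_nhds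
    obtain ⟨s, hs, hsA⟩ := ((show ∀ᶠ s : ℝ in 𝓝[>] 0, s ∈ Ioo (0 : ℝ) 1 from h01).and
      (ht0.eventually (hN _ hy).eventually)).exists
    obtain ⟨s', hs', hsA'⟩ := ((show ∀ᶠ s : ℝ in 𝓝[<] 1, s ∈ Ioo (0 : ℝ) 1 from
      Ioo_mem_nhdsLT one_pos).and (ht1.eventually (hN' _ hy').eventually)).exists
    rw [hgy, inner_unitNormal_neg_iff hp, inner_smul_right, inner_sub_right, hNu, sub_zero] at hsA
    rw [hgy', inner_unitNormal_neg_iff hp', inner_smul_right, inner_sub_right, hN'v, sub_zero,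
      hswap] at hsA'
    have hc1 : 0 < ε * s := mul_pos hε.1 hs.1
    have hc2 : 0 < ε * (1 - s') := mul_pos hε.1 (sub_pos.2 hs'.2)
    -- Near its start the segment is in `A` exactly if `⟨N, v⟩ < 0`, near its end exactly if `⟨N, v⟩
    -- > 0`; yet it never meets the boundary in between.
    rcases hSc.subset_or_disjoint_of_disjoint_frontier hSfr with h | h
    · have e1 := hsA.1 (h ⟨s, hs, rfl⟩)
      have e2 := hsA'.1 (h ⟨s', hs', rfl⟩)
      nlinarith
    · have e1 := mt hsA.2 (h ⟨s, hs, rfl⟩)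
      have e2 := mt hsA'.2 (h ⟨s', hs', rfl⟩)
      rcases lt_or_gt_of_ne hcop with h3 | h3
      · exact e1 (mul_neg_of_pos_of_neg hc1 h3)
      · exact e2 (mul_neg_of_pos_of_neg hc2 (neg_lt_zero.2 h3))

end Orientation

/-! ### Adjacent simplices of the surface, and cancellation over facets. -/

section Adjacency

variable {n J K : ℕ} {m : SurfMesh n J K}

/-- The facet of `σ_a` opposite to its vertex `i` is the facet of `σ_b` opposite to `k`, where the
arguments are the pairs `(a, i)` and `(b, k)`. -/
def SurfMesh.FacetAdj (m : SurfMesh n J K) (a b : Fin J × Fin (n + 1)) : Prop :=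
  b.1 ≠ a.1 ∧ m.vert a.1 '' {a.2}ᶜ = m.vert b.1 '' {b.2}ᶜ

lemma SurfMesh.FacetAdj.symm {a b : Fin J × Fin (n + 1)} (h : m.FacetAdj a b) :
    m.FacetAdj b a := ⟨h.1.symm, h.2.symm⟩

lemma SurfMesh.ncard_facet (m : SurfMesh n J K) (a : Fin J × Fin (n + 1)) :
    (m.vert a.1 '' {a.2}ᶜ).ncard = n := by
  rw [Set.ncard_image_of_injective _ (m.vert_inj a.1), Set.ncard_compl, Set.ncard_singleton,
    Nat.card_eq_fintype_card, Fintype.card_fin, Nat.add_sub_cancel]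

lemma SurfMesh.facet_subset_of_forall {a : Fin J × Fin (n + 1)} {j : Fin J}
    (h : ∀ l, l ≠ a.2 → m.vert a.1 l ∈ range (m.vert j)) :
    m.vert a.1 '' {a.2}ᶜ ⊆ range (m.vert j) := by
  rintro _ ⟨l, hl, rfl⟩
  exact h l hl

/-- `closed` provides the neighbouring simplex; by counting, exactly one of its vertices is off the
common facet. -/
lemma SurfMesh.existsUnique_facetAdj (m : SurfMesh n J K) (a : Fin J × Fin (n + 1)) :
    ∃! b, m.FacetAdj a b := by
  obtain ⟨j, ⟨hne, hj⟩, huniq⟩ := m.closed a.1 a.2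
  obtain ⟨i, hi⟩ : ∃ i, m.vert j i ∉ m.vert a.1 '' {a.2}ᶜ := by
    by_contra hcon
    push Not at hcon
    have hsub : range (m.vert j) ⊆ m.vert a.1 '' {a.2}ᶜ := by
      rintro _ ⟨k, rfl⟩
      exact hcon k
    have h1 := Set.ncard_le_ncard hsub (toFinite _)
    rw [m.ncard_facet, Set.ncard_range_of_injective (m.vert_inj j), Nat.card_eq_fintype_card,
      Fintype.card_fin] at h1
    omega
  have hadj : m.FacetAdj a (j, i) := by
    refine ⟨hne, Set.eq_of_subset_of_ncard_le ?_ ?_ (toFinite _)⟩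
    · intro x hx
      obtain ⟨k, rfl⟩ := facet_subset_of_forall hj hx
      refine ⟨k, fun hk => hi ?_, rfl⟩
      rw [mem_singleton_iff] at hk
      have hk' : k = i := hk
      rwa [← hk']
    · rw [m.ncard_facet, m.ncard_facet]
  refine ⟨(j, i), hadj, fun b hb => ?_⟩
  have hb1 : b.1 = j := huniq b.1 ⟨hb.1, fun l hl => by
    have : m.vert a.1 l ∈ m.vert a.1 '' {a.2}ᶜ := ⟨l, hl, rfl⟩
    rw [hb.2] at this
    obtain ⟨k, _, hk⟩ := this
    exact ⟨k, hk⟩⟩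
  obtain ⟨b1, b2⟩ := b
  simp only at hb1
  subst hb1
  have h1 := hb.2.symm.trans hadj.2
  rw [(m.vert_inj b1).image_injective.eq_iff, compl_inj_iff, singleton_eq_singleton_iff] at h1
  exact Prod.ext rfl h1

lemma SurfMesh.FacetAdj.exists_perm {a b : Fin J × Fin (n + 1)} (h : m.FacetAdj a b) :
    ∃ π : Equiv.Perm (Fin (n + 1)), π a.2 = b.2 ∧
      ∀ l, l ≠ a.2 → m.vert b.1 (π l) = m.vert a.1 l := by
  have hch : ∀ l, ∃ k, l ≠ a.2 → k ≠ b.2 ∧ m.vert b.1 k = m.vert a.1 l := by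
    intro l
    by_cases hl : l = a.2
    · exact ⟨0, fun h => absurd hl h⟩
    · have : m.vert a.1 l ∈ m.vert a.1 '' {a.2}ᶜ := ⟨l, hl, rfl⟩
      rw [h.2] at this
      obtain ⟨k, hk, hk'⟩ := this
      exact ⟨k, fun _ => ⟨hk, hk'⟩⟩
  choose f hf using hch
  have hinj : Function.Injective fun l => if l = a.2 then b.2 else f l := by
    intro l l' hll
    by_cases h1 : l = a.2 <;> by_cases h2 : l' = a.2 <;>
      simp only [h1, h2, if_true, if_false] at hll
    · rw [h1, h2]
    · exact absurd hll.symm (hf l' h2).1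
    · exact absurd hll (hf l h1).1
    · refine m.vert_inj a.1 ?_
      rw [← (hf l h1).2, ← (hf l' h2).2, hll]
  refine ⟨Equiv.ofBijective _ (Finite.injective_iff_bijective.1 hinj), ?_, fun l hl => ?_⟩
  · simp
  · simp [hl, (hf l hl).2]

variable {Ω : Set (Vec n)} {q : Fin K → Vec n} {Om : Set (Vec n)}

lemma SurfMesh.FacetAdj.loc_comp_perm {a b : Fin J × Fin (n + 1)} {π : Equiv.Perm (Fin (n + 1))}
    (hπ : ∀ l, l ≠ a.2 → m.vert b.1 (π l) = m.vert a.1 l) (q : Fin K → Vec n) :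
    m.loc q b.1 ∘ π = Function.update (m.loc q a.1) a.2 (m.loc q b.1 (π a.2)) := by
  funext l
  by_cases hl : l = a.2
  · rw [hl]
    simp
  · simp [hl, SurfMesh.loc, hπ l hl]

lemma openSimplex_comp_perm (p : Fin (n + 1) → Vec n) (π : Equiv.Perm (Fin (n + 1))) :
    openSimplex (p ∘ π) = openSimplex p := by
  ext x
  constructor
  · rintro ⟨l, hl, h1, rfl⟩
    refine ⟨l ∘ π.symm, fun k => hl _, ?_, ?_⟩
    · rw [← h1, ← Equiv.sum_comp π]
      simp
    · rw [lin, lin, ← Equiv.sum_comp π fun k => (l ∘ π.symm) k • p k]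
      simp
  · rintro ⟨l, hl, h1, rfl⟩
    refine ⟨l ∘ π, fun k => hl _, ?_, ?_⟩
    · rw [← h1, ← Equiv.sum_comp π l]
      rfl
    · rw [lin, lin, ← Equiv.sum_comp π fun k => l k • p k]
      rfl

/-- Adjacent simplices of a polyhedral interface are oriented consistently. -/
lemma SurfMesh.IsInterface.sign_eq_neg_one (hn : n = 1 ∨ n = 2) (h : m.IsInterface Ω q Om)
    {a b : Fin J × Fin (n + 1)} (hab : m.FacetAdj a b) {π : Equiv.Perm (Fin (n + 1))}
    (hπ : ∀ l, l ≠ a.2 → m.vert b.1 (π l) = m.vert a.1 l) : Equiv.Perm.sign π = -1 := by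
  have hn0 : n ≠ 0 := by omega
  -- For an even permutation the renumbered neighbour keeps its outward normal and differs from the
  -- first simplex in one vertex only, which `false_of_outward_of_update` excludes.
  rcases Int.units_eq_one_or (Equiv.Perm.sign π) with hs | hs
  swap
  · exact hs
  exfalso
  have hp' := SurfMesh.FacetAdj.loc_comp_perm hπ q
  have hNN : normalVec (m.loc q b.1 ∘ π) = normalVec (m.loc q b.1) := by
    rw [normalVec_comp_perm hn, hs]
    simp
  have hnn : unitNormal (m.loc q b.1 ∘ π) = unitNormal (m.loc q b.1) := by
    rw [unitNormal, hNN, unitNormal]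
  have hos := openSimplex_comp_perm (m.loc q b.1) π
  have hrange : range (m.loc q b.1 ∘ π) = range (m.loc q b.1) := π.surjective.range_comp _
  have hai := (h.nondegenerate b.1).comp_embedding π.toEmbedding
  change AffineIndependent ℝ (m.loc q b.1 ∘ π) at hai
  set x := facetCenter (m.loc q a.1) a.2 with hx
  -- A third simplex through the facet center would contain the whole facet, but a facet belongs to
  -- exactly two simplices. Near the center the boundary therefore consists of the two neighbours.
  have hev : ∀ᶠ z in 𝓝 x, ∀ j, j ≠ a.1 → j ≠ b.1 → z ∉ convexHull ℝ (range (m.loc q j)) := by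
    refine eventually_all.2 fun j => ?_
    by_cases hj : j ≠ a.1 ∧ j ≠ b.1
    · have hcl : IsClosed (convexHull ℝ (range (m.loc q j))) :=
        (finite_range _).isClosed_convexHull ℝ
      have hxj : x ∉ convexHull ℝ (range (m.loc q j)) := by
        intro hxm
        have hvert : ∀ l, l ≠ a.2 → m.vert a.1 l ∈ range (m.vert j) := fun l hl =>
          h.mem_range_of_pos (l := fun k => if k = a.2 then 0 else 1 / (n : ℝ))
            (fun k => by split_ifs <;> positivity) (sum_facetWeights hn0 a.2) hxm (by
              simp only [hl, if_false]
              have : (0 : ℝ) < n := by exact_mod_cast Nat.pos_of_ne_zero hn0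
              positivity)
        have hvertb : ∀ l, l ≠ a.2 → m.vert a.1 l ∈ range (m.vert b.1) := fun l hl =>
          ⟨π l, hπ l hl⟩
        exact hj.2 ((m.closed a.1 a.2).unique ⟨hj.1, hvert⟩ ⟨hab.1, hvertb⟩)
      filter_upwards [hcl.isOpen_compl.mem_nhds hxj] with z hz _ _ using hz
    · refine Eventually.of_forall fun z h1 h2 => absurd ⟨h1, h2⟩ hj
  obtain ⟨ρ, hρ, hball⟩ := Metric.eventually_nhds_iff_ball.1 hev
  rw [hp'] at hai hos hrange hnn
  refine false_of_outward_of_update hn (A := Om) (h.nondegenerate a.1) hai ?_ (h.normal a.1) ?_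
    hρ fun z hz hzf => ?_
  · rw [hos]
    exact h.disjoint_openSimplex hab.1.symm
  · rw [hos, hnn]
    exact h.normal b.1
  · rw [h.frontier_eq] at hzf
    obtain ⟨j, hj⟩ := mem_iUnion.1 hzf
    rw [hrange]
    by_cases h1 : j = a.1
    · exact Or.inl (h1 ▸ hj)
    · by_cases h2 : j = b.1
      · exact Or.inr (h2 ▸ hj)
      · exact absurd hj (hball z hz j h1 h2)

/-- After replacing the opposite vertices by `w`, both determinants have the same rows up to the odd
permutation that matches the two numberings. -/
lemma SurfMesh.IsInterface.detM_update_adj (hn : n = 1 ∨ n = 2) (h : m.IsInterface Ω q Om)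
    {a b : Fin J × Fin (n + 1)} (hab : m.FacetAdj a b) (w : Vec n) :
    detM (Function.update (m.loc q a.1) a.2 w) = -detM (Function.update (m.loc q b.1) b.2 w) := by
  obtain ⟨π, hπa, hπ⟩ := hab.exists_perm
  have h1 := detM_comp_perm (Function.update (m.loc q b.1) b.2 w) π
  rw [h.sign_eq_neg_one hn hab hπ, Function.update_comp_equiv, ← hπa, Equiv.symm_apply_apply,
    SurfMesh.FacetAdj.loc_comp_perm hπ q, Function.update_idem] at h1
  rw [h1, hπa]
  simp

lemma detM_update_sum {ι : Type*} (s : Finset ι) (p : Fin (n + 1) → Vec n) (i : Fin (n + 1))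
    (w : ι → Vec n) :
    detM (Function.update p i (∑ k ∈ s, w k)) = ∑ k ∈ s, detM (Function.update p i (w k)) := by
  have h : ∀ w : Vec n, detM (Function.update p i w) =
      Matrix.detRowAlternating (Function.update (fun k => (p k).ofLp) i w.ofLp) := by
    intro w
    rw [detM]
    change Matrix.det _ = Matrix.det _
    congr 1
    funext k
    by_cases hk : k = i
    · subst hk
      change (Function.update p k w k).ofLp = _
      rw [Function.update_self, Function.update_self]
    · change (Function.update p i w k).ofLp = _
      rw [Function.update_of_ne hk, Function.update_of_ne hk]
  simp only [h, WithLp.ofLp_sum]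
  exact (Matrix.detRowAlternating (R := ℝ)).toMultilinearMap.map_update_sum s i _ _

/-- The combinatorial form of the first variation of the enclosed volume. -/
lemma SurfMesh.IsInterface.sum_inner_normalVec (hn : n = 1 ∨ n = 2) (h : m.IsInterface Ω q Om)
    (v : Fin K → Vec n) :
    ∑ j, ∑ k, inner ℝ (normalVec (m.loc q j)) (m.loc v j k) =
      ∑ j, ∑ i, detM (Function.update (m.loc q j) i (m.loc v j i)) := by
  classical
  -- The terms of the expanded normal in which the replaced vertex and the velocity node differ,
  -- grouped by facet. Such a term depends on the facet and its orientation only.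
  set F : Fin J × Fin (n + 1) → ℝ := fun a =>
    detM (Function.update (m.loc q a.1) a.2 (∑ k ∈ Finset.univ.erase a.2, m.loc v a.1 k)) with hF
  have hsplit : ∀ j, ∑ k, inner ℝ (normalVec (m.loc q j)) (m.loc v j k) =
      ∑ i, detM (Function.update (m.loc q j) i (m.loc v j i)) + ∑ i, F (j, i) := by
    intro j
    simp only [inner_normalVec_eq_sum hn, hF, detM_update_sum]
    rw [Finset.sum_comm, ← Finset.sum_add_distrib]
    refine Finset.sum_congr rfl fun i _ => ?_
    rw [Finset.add_sum_erase _ (fun k => detM (Function.update (m.loc q j) i (m.loc v j k)))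
      (Finset.mem_univ i)]
  have hfacet : ∀ a : Fin J × Fin (n + 1), ∑ k ∈ Finset.univ.erase a.2, m.loc v a.1 k =
      ∑ x ∈ (m.vert a.1 '' {a.2}ᶜ).toFinset, v x := by
    intro a
    have h1 : (m.vert a.1 '' {a.2}ᶜ).toFinset = (Finset.univ.erase a.2).image (m.vert a.1) := by
      ext x
      simp
    rw [h1, Finset.sum_image fun x _ y _ hxy => m.vert_inj a.1 hxy]
    rfl
  choose g hg hgu using m.existsUnique_facetAdj
  have hFg : ∀ a, F a + F (g a) = 0 := by
    intro a
    have h1 : ∑ x ∈ (m.vert a.1 '' {a.2}ᶜ).toFinset, v x =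
        ∑ x ∈ (m.vert (g a).1 '' {(g a).2}ᶜ).toFinset, v x := by
      congr 1
      exact Set.toFinset_congr (hg a).2
    simp only [hF, hfacet, h1]
    rw [h.detM_update_adj hn (hg a)]
    ring
  have hzero : ∑ a, F a = 0 := by
    -- Each facet occurs twice, with opposite orientations, so the terms cancel in pairs.
    refine Finset.sum_involution (fun a _ => g a) (fun a _ => hFg a) (fun a _ _ hga => ?_)
      (fun a _ => Finset.mem_univ _) fun a _ => ?_
    · exact (hg a).1 (by rw [hga])
    · exact (hgu (g a) a (hg a).symm).symm
  rw [Fintype.sum_prod_type] at hzero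
  rw [Finset.sum_congr rfl fun j _ => hsplit j, Finset.sum_add_distrib, hzero, add_zero]

end Adjacency

/-! ### Time derivative of the enclosed volume. -/

section VolumeDerivative

variable {n J K : ℕ} {m : SurfMesh n J K}

lemma contDiff_detM : ContDiff ℝ 1 (detM : (Fin (n + 1) → Vec n) → ℝ) :=
  contDiff_det_comp fun i j => by
    simp only [Matrix.of_apply]
    fun_prop

/-- Product rule in the Leibniz formula: one row is differentiated at a time. -/
lemma hasDerivAt_detM {p : ℝ → Fin (n + 1) → Vec n} {v : Fin (n + 1) → Vec n} {t : ℝ}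
    (hp : ∀ k, HasDerivAt (fun s => p s k) (v k) t) :
    HasDerivAt (fun s => detM (p s)) (∑ i, detM (Function.update (p t) i (v i))) t := by
  have hc : ∀ k l, HasDerivAt (fun s => p s k l) (v k l) t := fun k l =>
    (EuclideanSpace.proj l : Vec n →L[ℝ] ℝ).hasFDerivAt.comp_hasDerivAt t (hp k)
  have hdet : ∀ p : Fin (n + 1) → Vec n, detM p = ∑ σ : Equiv.Perm (Fin (n + 1)),
      ((Equiv.Perm.sign σ : ℤ) : ℝ) * ∏ i, p i (σ i) := fun p => by
    rw [detM, ← Matrix.det_transpose, Matrix.det_apply']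
    rfl
  simp only [hdet]
  rw [Finset.sum_comm]
  refine HasDerivAt.fun_sum fun σ _ => ?_
  rw [← Finset.mul_sum]
  refine HasDerivAt.const_mul _ ?_
  refine (HasDerivAt.fun_finsetProd fun i _ => hc i (σ i)).congr_deriv ?_
  refine Finset.sum_congr rfl fun i _ => ?_
  rw [← Finset.prod_erase_mul _ _ (Finset.mem_univ i), Function.update_self, smul_eq_mul]
  congr 1
  refine Finset.prod_congr rfl fun k hk => ?_
  rw [Function.update_of_ne (Finset.ne_of_mem_erase hk)]

lemma BulkMesh.isBounded_domain (M : BulkMesh n) : Bornology.IsBounded M.domain := by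
  refine Bornology.IsBounded.subset ?_ interior_subset
  refine (Bornology.isBounded_iUnion).2 fun j => ?_
  exact isBounded_convexHull.2 (finite_range _).isBounded

variable {S : Setup n} {D : Phys n} {X : State S K}

lemma State.IsSolution.vol_eq (hn : n = 1 ∨ n = 2) (hX : X.IsSolution D m) {t : ℝ}
    (ht : t ∈ Icc 0 S.T) :
    X.vol t = 1 / ((n + 1).factorial : ℝ) * ∑ j, detM (m.loc (X.q t) j) := by
  rw [State.vol, (hX.interface t ht).volume_eq hn S.mesh.isBounded_domain]
  congr 1
  exact Finset.sum_congr rfl fun j _ => inner_normalVec_zero hn (m.loc (X.q t) j)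

/-- The first variation of the enclosed volume. -/
lemma State.IsSolution.hasDerivAt_vol (hn : n = 1 ∨ n = 2) (hX : X.IsSolution D m) {t : ℝ}
    (ht : t ∈ Ioo 0 S.T) (hq : ∀ k, HasDerivAt (fun s => X.q s k) (X.V t k) t) :
    HasDerivAt (fun s => X.vol s) (m.lumped (X.q t) fun j k =>
      inner ℝ (m.loc (X.V t) j k) (unitNormal (m.loc (X.q t) j))) t := by
  have htI : t ∈ Icc 0 S.T := ⟨ht.1.le, ht.2.le⟩
  have h1 : HasDerivAt (fun s => 1 / ((n + 1).factorial : ℝ) * ∑ j, detM (m.loc (X.q s) j)) _ t :=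
    (HasDerivAt.fun_sum fun j _ => hasDerivAt_detM fun k => hq (m.vert j k)).const_mul _
  refine (h1.congr_of_eventuallyEq ?_).congr_deriv ?_
  · filter_upwards [Icc_mem_nhds ht.1 ht.2] with s hs
    exact hX.vol_eq hn hs
  · have h2 := (hX.interface t htI).sum_inner_normalVec hn (X.V t)
    have h3 :
      ∑ j, ∑ i, detM (Function.update (fun k => X.q t (m.vert j k)) i (X.V t (m.vert j i))) =
      ∑ j, ∑ i, detM (Function.update (m.loc (X.q t) j) i (m.loc (X.V t) j i)) := rfl
    rw [h3, ← h2, SurfMesh.lumped, Finset.mul_sum, Finset.mul_sum]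
    refine Finset.sum_congr rfl fun j _ => ?_
    rw [Finset.mul_sum, Finset.mul_sum, Finset.mul_sum]
    refine Finset.sum_congr rfl fun k _ => ?_
    rw [← normalVec_eq_norm_smul ((hX.interface t htI).nondegenerate j), real_inner_smul_left,
      real_inner_comm, area, Nat.factorial_succ]
    have : (n.factorial : ℝ) ≠ 0 := by positivity
    push_cast
    field_simp

lemma State.IsSolution.vol_const (hn : n = 1 ∨ n = 2) (hX : X.IsSolution D m)
    (h : ∀ᵐ t ∂(volume.restrict (Ioo 0 S.T)), HasDerivAt (fun s => X.vol s) 0 t) :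
    ∀ t ∈ Icc 0 S.T, X.vol t = X.vol 0 := by
  -- The determinant formula is visibly absolutely continuous and agrees with the volume on `[0,
  -- T]`.
  set G : ℝ → ℝ := fun s => 1 / ((n + 1).factorial : ℝ) * ∑ j, detM (m.loc (X.q s) j) with hG
  have hac : AbsolutelyContinuousOnInterval G 0 S.T :=
    (AbsolutelyContinuousOnInterval.finsetSum _ fun j _ =>
      (m.loc_comp_absolutelyContinuous hX.q_ac j).contDiff_comp contDiff_detM).const_mul _
  have hd : ∀ᵐ t ∂(volume.restrict (Ioo 0 S.T)), HasDerivAt G 0 t := by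
    filter_upwards [h, ae_restrict_mem measurableSet_Ioo] with t ht htm
    refine ht.congr_of_eventuallyEq ?_
    filter_upwards [Icc_mem_nhds htm.1 htm.2] with s hs
    exact (hX.vol_eq hn hs).symm
  intro t ht
  rw [hX.vol_eq hn ht, hX.vol_eq hn ⟨le_rfl, S.T_pos.le⟩]
  exact eq_initial_of_ae_hasDerivAt_zero S.T_pos hac hd t ht

end VolumeDerivative

/-! ### Local geometry of an element near a point of an open face. -/

section ElementFaces

variable {n : ℕ} {b : AffineBasis (Fin (n + 2)) ℝ (Vec n)} {p : Fin (n + 1) → Vec n}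
  {i : Fin (n + 2)} {x : Vec n}

lemma affineMap_lin (f : Vec n →ᵃ[ℝ] ℝ) (p : Fin (n + 1) → Vec n) {l : Fin (n + 1) → ℝ}
    (h1 : ∑ k, l k = 1) : f (lin p l) = ∑ k, l k * f (p k) := by
  have h : ∀ y, f y = f.linear y + f 0 := fun y => by
    have := f.map_vadd 0 y
    simpa using this
  rw [h, lin, map_sum]
  simp only [h (p _), mul_add, Finset.sum_add_distrib, ← Finset.sum_mul, h1, one_mul, map_smul,
    smul_eq_mul]

lemma coord_eq_zero_of_mem_openSimplex (hp : range p = b '' {i}ᶜ) (hx : x ∈ openSimplex p) :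
    b.coord i x = 0 := by
  obtain ⟨l, hl, h1, rfl⟩ := hx
  rw [affineMap_lin _ _ h1]
  refine Finset.sum_eq_zero fun m _ => ?_
  obtain ⟨k, hk, hkm⟩ : p m ∈ b '' {i}ᶜ := hp ▸ mem_range_self m
  rw [← hkm, b.coord_apply, if_neg (fun h => hk h.symm), mul_zero]

lemma coord_pos_of_mem_openSimplex (hp : range p = b '' {i}ᶜ) (hx : x ∈ openSimplex p)
    {k : Fin (n + 2)} (hk : k ≠ i) : 0 < b.coord k x := by
  obtain ⟨l, hl, h1, rfl⟩ := hx
  rw [affineMap_lin _ _ h1]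
  obtain ⟨m, hm⟩ : b k ∈ range p := hp ▸ mem_image_of_mem _ hk
  have h0 : ∀ m, 0 ≤ b.coord k (p m) := fun m => by
    obtain ⟨k', _, hkm⟩ : p m ∈ b '' {i}ᶜ := hp ▸ mem_range_self m
    rw [← hkm, b.coord_apply]
    split_ifs <;> norm_num
  refine Finset.sum_pos' (fun m _ => mul_nonneg (hl m).le (h0 m)) ⟨m, Finset.mem_univ _, ?_⟩
  rw [hm, b.coord_apply_eq, mul_one]
  exact hl m

/-- The signed distance to the plane of a face is a multiple of the barycentric coordinate of the
opposite vertex: both are affine and vanish on the face. -/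
lemma inner_normalVec_eq_coord (hp : range p = b '' {i}ᶜ) (y : Vec n) :
    inner ℝ (normalVec p) (y - p 0) = inner ℝ (normalVec p) (b i - p 0) * b.coord i y := by
  have hy : y - p 0 = ∑ k, b.coord k y • (b k - p 0) := by
    simp only [smul_sub, Finset.sum_sub_distrib, ← Finset.sum_smul, b.sum_coord_apply_eq_one,
      one_smul, b.linear_combination_coord_eq_self]
  rw [hy, inner_sum, Finset.sum_eq_single i]
  · rw [real_inner_smul_right, mul_comm]
  · intro k _ hk
    obtain ⟨m, hm⟩ : b k ∈ range p := hp ▸ mem_image_of_mem _ hk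
    rw [real_inner_smul_right, ← hm, inner_normalVec_edge, mul_zero]
  · exact fun h => absurd (Finset.mem_univ i) h

lemma inner_normalVec_opposite_ne_zero (hpi : AffineIndependent ℝ p) (hp : range p = b '' {i}ᶜ) :
    inner ℝ (normalVec p) (b i - p 0) ≠ 0 := by
  intro h0
  have h := inner_normalVec_eq_coord hp (p 0 + normalVec p)
  rw [h0, zero_mul, add_sub_cancel_left, inner_self_eq_zero] at h
  exact normalVec_ne_zero hpi h

lemma inner_normalVec_sub_eq_coord (hp : range p = b '' {i}ᶜ) (hx : x ∈ openSimplex p)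
    (y : Vec n) :
    inner ℝ (normalVec p) (y - x) = inner ℝ (normalVec p) (b i - p 0) * b.coord i y := by
  rw [← sub_sub_sub_cancel_right y x (p 0), inner_sub_right, inner_normalVec_eq_coord hp y,
    inner_normalVec_eq_coord hp x, coord_eq_zero_of_mem_openSimplex hp hx]
  ring

lemma eventually_coord_pos (hp : range p = b '' {i}ᶜ) (hx : x ∈ openSimplex p) :
    ∀ᶠ y in 𝓝 x, ∀ k, k ≠ i → 0 < b.coord k y := by
  refine eventually_all.2 fun k => ?_
  by_cases hk : k = i
  · exact Eventually.of_forall fun y h => absurd hk h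
  · filter_upwards [(continuous_barycentric_coord b k).continuousAt.eventually_const_lt
      (coord_pos_of_mem_openSimplex hp hx hk)] with y hy _ using hy

lemma eventually_mem_convexHull_iff (hp : range p = b '' {i}ᶜ) (hx : x ∈ openSimplex p) :
    ∀ᶠ y in 𝓝 x, (y ∈ convexHull ℝ (range b) ↔ 0 ≤ b.coord i y) := by
  filter_upwards [eventually_coord_pos hp hx] with y hy
  rw [b.convexHull_eq_nonneg_coord]
  refine ⟨fun h => h i, fun h k => ?_⟩
  by_cases hk : k = i
  · exact hk ▸ h
  · exact (hy k hk).le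

lemma eventually_mem_interior_convexHull_iff (hp : range p = b '' {i}ᶜ)
    (hx : x ∈ openSimplex p) :
    ∀ᶠ y in 𝓝 x, (y ∈ interior (convexHull ℝ (range b)) ↔ 0 < b.coord i y) := by
  filter_upwards [eventually_coord_pos hp hx] with y hy
  rw [b.interior_convexHull]
  refine ⟨fun h => h i, fun h k => ?_⟩
  by_cases hk : k = i
  · exact hk ▸ h
  · exact hy k hk

/-- Two simplices with a common facet and disjoint interiors lie on opposite sides of it. -/
lemma union_mem_nhds_of_common_facet (hpi : AffineIndependent ℝ p)
    {b' : AffineBasis (Fin (n + 2)) ℝ (Vec n)} {i' : Fin (n + 2)} (hp : range p = b '' {i}ᶜ)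
    (hp' : range p = b' '' {i'}ᶜ) (hx : x ∈ openSimplex p)
    (hd : Disjoint (interior (convexHull ℝ (range b))) (interior (convexHull ℝ (range b')))) :
    convexHull ℝ (range b) ∪ convexHull ℝ (range b') ∈ 𝓝 x := by
  set β := inner ℝ (normalVec p) (b i - p 0) with hβ
  set β' := inner ℝ (normalVec p) (b' i' - p 0) with hβ'
  have hβ0 : β ≠ 0 := inner_normalVec_opposite_ne_zero hpi hp
  have hβ0' : β' ≠ 0 := inner_normalVec_opposite_ne_zero hpi hp'
  have hc : ∀ y, β * b.coord i y = β' * b'.coord i' y := fun y => by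
    rw [← inner_normalVec_sub_eq_coord hp hx, ← inner_normalVec_sub_eq_coord hp' hx]
  -- If both opposite vertices lay on the same side, points slightly inward from the face would
  -- belong to both interiors.
  have hsign : β * β' < 0 := by
    by_contra hcon
    have hpos : 0 < β * β' := lt_of_le_of_ne (not_lt.1 hcon) (mul_ne_zero hβ0 hβ0').symm
    have hlim : Tendsto (fun t : ℝ => x + t • (b i - x)) (𝓝[>] 0) (𝓝 x) := by
      have h : Continuous fun t : ℝ => x + t • (b i - x) := by fun_prop
      have h := h.tendsto 0
      simp only [zero_smul, add_zero] at h
      exact h.mono_left nhdsWithin_le_nhds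
    obtain ⟨t, ⟨h1, h2⟩, ht⟩ :=
      ((hlim.eventually (eventually_mem_interior_convexHull_iff hp hx)).and
      (hlim.eventually (eventually_mem_interior_convexHull_iff hp' hx))).and
        self_mem_nhdsWithin |>.exists
    have ht : 0 < t := ht
    have hval : 0 < b.coord i (x + t • (b i - x)) := by
      have h3 := inner_normalVec_sub_eq_coord hp hx (x + t • (b i - x))
      have h4 := inner_normalVec_sub_eq_coord hp hx (b i)
      rw [add_sub_cancel_left, real_inner_smul_right, h4, b.coord_apply_eq, mul_one, ← hβ,
        mul_comm] at h3
      rw [← mul_left_cancel₀ hβ0 h3]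
      exact ht
    have hval' : 0 < b'.coord i' (x + t • (b i - x)) := by
      have h3 := hc (x + t • (b i - x))
      have h5 : 0 < β * β' * b'.coord i' (x + t • (b i - x)) := by
        rw [mul_assoc, ← h3, ← mul_assoc]
        exact mul_pos (mul_self_pos.2 hβ0) hval
      exact (mul_pos_iff_of_pos_left hpos).1 h5
    exact disjoint_left.1 hd (h1.2 hval) (h2.2 hval')
  filter_upwards [eventually_mem_convexHull_iff hp hx, eventually_mem_convexHull_iff hp' hx]
    with y h1 h2
  by_cases h : 0 ≤ b.coord i y
  · exact Or.inl (h1.2 h)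
  · refine Or.inr (h2.2 ?_)
    have h3 : β * β' * b'.coord i' y ≤ 0 := by
      rw [mul_assoc, ← hc y, ← mul_assoc]
      exact mul_nonpos_of_nonneg_of_nonpos (mul_self_nonneg β) (not_le.1 h).le
    by_contra h4
    exact absurd (mul_pos_of_neg_of_neg hsign (not_le.1 h4)) (not_lt.2 h3)

end ElementFaces

/-! ### The boundary of the polyhedral domain consists of the boundary faces of its mesh. -/

section MeshBoundary

variable {n : ℕ} (M : BulkMesh n)

/-- The vertices of the face of the element `f.1` opposite to its vertex `f.2`. -/
noncomputable def BulkMesh.facePts (f : Fin M.J × Fin (n + 2)) : Fin (n + 1) → Vec n :=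
  fun l => M.elem f.1 (f.2.succAbove l)

/-- The face belongs to no other element. -/
def BulkMesh.IsBoundaryFace (f : Fin M.J × Fin (n + 2)) : Prop :=
  ∀ j, j ≠ f.1 → ¬ range (M.facePts f) ⊆ range (M.elem j)

/-- The lower dimensional faces. -/
def BulkMesh.skeleton : Set (Vec n) :=
  ⋃ f : Fin M.J × Fin (n + 2), ⋃ k, convexHull ℝ (M.facePts f '' {k}ᶜ)

variable {M} {f : Fin M.J × Fin (n + 2)} {x : Vec n}

lemma BulkMesh.range_facePts (f : Fin M.J × Fin (n + 2)) :
    range (M.facePts f) = M.elem f.1 '' {f.2}ᶜ := by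
  rw [← Fin.range_succAbove, ← range_comp]
  rfl

lemma BulkMesh.affineIndependent_facePts (f : Fin M.J × Fin (n + 2)) :
    AffineIndependent ℝ (M.facePts f) :=
  (M.elem f.1).ind.comp_embedding (Fin.succAboveEmb f.2)

lemma BulkMesh.convexHull_facePts_subset (f : Fin M.J × Fin (n + 2)) :
    convexHull ℝ (range (M.facePts f)) ⊆ M.closedElem f.1 := by
  refine convexHull_mono ?_
  rw [M.range_facePts]
  exact image_subset_range _ _

lemma BulkMesh.isClosed_closedElem (j : Fin M.J) : IsClosed (M.closedElem j) :=
  (finite_range _).isClosed_convexHull ℝ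

lemma BulkMesh.isClosed_iUnion_closedElem : IsClosed (⋃ j, M.closedElem j) :=
  isClosed_iUnion_of_finite M.isClosed_closedElem

lemma BulkMesh.isOpen_domain : IsOpen M.domain := isOpen_interior

lemma BulkMesh.closure_domain_subset : closure M.domain ⊆ ⋃ j, M.closedElem j :=
  closure_minimal interior_subset M.isClosed_iUnion_closedElem

lemma BulkMesh.openElem_subset_domain (j : Fin M.J) : M.openElem j ⊆ M.domain :=
  interior_mono (subset_iUnion _ j)

lemma BulkMesh.mem_openElem_or_face {j : Fin M.J} (hx : x ∈ M.closedElem j) :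
    x ∈ M.openElem j ∨ ∃ i, x ∈ convexHull ℝ (range (M.facePts (j, i))) := by
  by_cases h : ∀ k, 0 < (M.elem j).coord k x
  · left
    rw [BulkMesh.openElem, BulkMesh.closedElem, (M.elem j).interior_convexHull]
    exact h
  · push Not at h
    obtain ⟨i, hi⟩ := h
    right
    refine ⟨i, ?_⟩
    rw [BulkMesh.closedElem, (M.elem j).convexHull_eq_nonneg_coord] at hx
    rw [M.range_facePts]
    have h1 := sum_smul_mem_convexHull (p := M.elem j) (T := {i}ᶜ) hx
      ((M.elem j).sum_coord_apply_eq_one x) (fun k hk => by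
        rw [mem_compl_iff, not_not] at hk
        rw [mem_singleton_iff.1 hk]
        exact le_antisymm hi (hx i))
    rwa [(M.elem j).linear_combination_coord_eq_self] at h1

lemma BulkMesh.convexHull_facePts_subset_union (f : Fin M.J × Fin (n + 2)) :
    convexHull ℝ (range (M.facePts f)) ⊆ openSimplex (M.facePts f) ∪ M.skeleton :=
  (convexHull_subset_openSimplex_union _).trans
    (union_subset_union_right _
      (subset_iUnion (fun f => ⋃ k, convexHull ℝ (M.facePts f '' {k}ᶜ)) f))

/-- Conformity again: all vertices of the face carry positive weight in `x`, so they are common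
vertices of the two elements. -/
lemma BulkMesh.range_facePts_subset {j : Fin M.J} (hx : x ∈ openSimplex (M.facePts f))
    (hj : x ∈ M.closedElem j) : range (M.facePts f) ⊆ range (M.elem j) := by
  have h1 : x ∈ convexHull ℝ (range (M.elem f.1) ∩ range (M.elem j)) := by
    rw [← M.conforming]
    exact ⟨M.convexHull_facePts_subset f (openSimplex_subset_convexHull _ hx), hj⟩
  have h2 : range (M.elem f.1) ∩ range (M.elem j) =
      M.elem f.1 '' (M.elem f.1 ⁻¹' range (M.elem j)) := by
    rw [image_preimage_eq_inter_range, inter_comm]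
  rw [h2, ← (M.elem f.1).linear_combination_coord_eq_self x] at h1
  rw [M.range_facePts]
  rintro _ ⟨k, hk, rfl⟩
  exact mem_of_pos_of_mem_convexHull (M.elem f.1).ind ((M.elem f.1).sum_coord_apply_eq_one x) h1
    (coord_pos_of_mem_openSimplex (M.range_facePts f) hx hk)

lemma BulkMesh.IsBoundaryFace.notMem (h : M.IsBoundaryFace f) {j : Fin M.J} (hj : j ≠ f.1)
    (hx : x ∈ openSimplex (M.facePts f)) : x ∉ M.closedElem j := fun hxj =>
  h j hj (M.range_facePts_subset hx hxj)

/-- The two elements on either side of a shared face together fill a neighbourhood of its relative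
interior, which is then inside the domain. -/
lemma BulkMesh.isBoundaryFace_of_notMem_domain (hx : x ∈ openSimplex (M.facePts f))
    (hxΩ : x ∉ M.domain) : M.IsBoundaryFace f := by
  intro j hj hsub
  obtain ⟨i, hi⟩ : ∃ i, M.elem j i ∉ range (M.facePts f) := by
    by_contra hcon
    push Not at hcon
    have hs : range (M.elem j) ⊆ range (M.facePts f) := by
      rintro _ ⟨k, rfl⟩
      exact hcon k
    have h1 := Set.ncard_le_ncard hs (finite_range _)
    rw [Set.ncard_range_of_injective (M.elem j).ind.injective,
      Set.ncard_range_of_injective (M.affineIndependent_facePts f).injective,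
      Nat.card_eq_fintype_card, Nat.card_eq_fintype_card, Fintype.card_fin, Fintype.card_fin] at h1
    omega
  have hr : range (M.facePts f) = M.elem j '' {i}ᶜ := by
    refine Set.eq_of_subset_of_ncard_le ?_ ?_ (toFinite _)
    · rintro y hy
      obtain ⟨k, rfl⟩ := hsub hy
      exact ⟨k, fun hk => hi (mem_singleton_iff.1 hk ▸ hy), rfl⟩
    · rw [Set.ncard_range_of_injective (M.affineIndependent_facePts f).injective,
        Set.ncard_image_of_injective _ (M.elem j).ind.injective, Set.ncard_compl,
        Set.ncard_singleton, Nat.card_eq_fintype_card, Nat.card_eq_fintype_card, Fintype.card_fin,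
        Fintype.card_fin]
      omega
  have h1 := union_mem_nhds_of_common_facet (M.affineIndependent_facePts f) (M.range_facePts f) hr
    hx (M.disjoint _ _ hj.symm)
  refine hxΩ (mem_interior_iff_mem_nhds.2 (mem_of_superset h1 (union_subset ?_ ?_)))
  · exact subset_iUnion M.closedElem f.1
  · exact subset_iUnion M.closedElem j

open Classical in
/-- The sign that turns the normal of a boundary face outward. -/
noncomputable def BulkMesh.faceSign (M : BulkMesh n) (f : Fin M.J × Fin (n + 2)) : ℝ :=
  if 0 < inner ℝ (normalVec (M.facePts f)) (M.elem f.1 f.2 - M.facePts f 0) then -1 else 1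

/-- The domain is the interior of the union of the closed elements, so the description by a closed
half space has to be passed to the interior. The direction `v`, along which `g` increases, excludes
points with `g = 0`. -/
lemma eventually_mem_interior_iff {s : Set (Vec n)} {g : Vec n → ℝ} {v : Vec n} {c : ℝ}
    (hc : 0 < c) (hg : Continuous g) (hv : ∀ y t, g (y + t • v) = g y + t * c)
    (h : ∀ᶠ y in 𝓝 x, (y ∈ s ↔ 0 ≤ g y)) : ∀ᶠ y in 𝓝 x, (y ∈ interior s ↔ 0 < g y) := by
  filter_upwards [h.eventually_nhds] with y hy
  rw [mem_interior_iff_mem_nhds]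
  constructor
  · intro hs
    by_contra hcon
    have hlim : Tendsto (fun t : ℝ => y + t • v) (𝓝[<] 0) (𝓝 y) := by
      have h : Continuous fun t : ℝ => y + t • v := by fun_prop
      have h := h.tendsto 0
      simp only [zero_smul, add_zero] at h
      exact h.mono_left nhdsWithin_le_nhds
    obtain ⟨t, ⟨h1, h2⟩, ht⟩ := ((hlim.eventually hy).and (hlim.eventually hs)).and
      self_mem_nhdsWithin |>.exists
    have h3 := h1.1 h2
    rw [hv] at h3
    have : t * c < 0 := mul_neg_of_neg_of_pos ht hc
    linarith [not_lt.1 hcon]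
  · intro h0
    filter_upwards [hy, hg.continuousAt.eventually_const_lt h0] with z hz hz'
    exact hz.2 hz'.le

lemma BulkMesh.IsBoundaryFace.isOuterNormal (h : M.IsBoundaryFace f)
    (hx : x ∈ openSimplex (M.facePts f)) :
    IsOuterNormal M.domain x (M.faceSign f • unitNormal (M.facePts f)) := by
  have hpi := M.affineIndependent_facePts f
  have hp := M.range_facePts f
  set p := M.facePts f with hpdef
  set β := inner ℝ (normalVec p) (M.elem f.1 f.2 - p 0) with hβ
  have hβ0 : β ≠ 0 := inner_normalVec_opposite_ne_zero hpi hp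
  have hev : ∀ᶠ y in 𝓝 x, ∀ j, j ≠ f.1 → y ∉ M.closedElem j := by
    refine eventually_all.2 fun j => ?_
    by_cases hj : j = f.1
    · exact Eventually.of_forall fun y h => absurd hj h
    · filter_upwards [(M.isClosed_closedElem j).isOpen_compl.mem_nhds (h.notMem hj hx)]
        with y hy _ using hy
  have h1 : ∀ᶠ y in 𝓝 x, (y ∈ ⋃ j, M.closedElem j ↔ 0 ≤ (M.elem f.1).coord f.2 y) := by
    filter_upwards [hev, eventually_mem_convexHull_iff hp hx] with y hy hy'
    rw [← hy', mem_iUnion]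
    refine ⟨fun ⟨j, hj⟩ => ?_, fun h => ⟨f.1, h⟩⟩
    by_cases hjf : j = f.1
    · exact hjf ▸ hj
    · exact absurd hj (hy j hjf)
  have h2 : ∀ᶠ y in 𝓝 x, (y ∈ M.domain ↔ 0 < (M.elem f.1).coord f.2 y) := by
    have hN : 0 < inner ℝ (normalVec p) (normalVec p) :=
      real_inner_self_pos.2 (normalVec_ne_zero hpi)
    -- The coordinate is the inner product with the normal divided by `β`, so along `β⁻¹ N` it grows
    -- at the positive rate `β⁻² |N|²`.
    refine eventually_mem_interior_iff (v := (β⁻¹) • normalVec p)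
      (c := β⁻¹ * (β⁻¹ * inner ℝ (normalVec p) (normalVec p)))
      ?_ (continuous_barycentric_coord _ _) (fun y t => ?_) h1
    · rw [← mul_assoc]
      exact mul_pos (mul_self_pos.2 (inv_ne_zero hβ0)) hN
    · have e1 := inner_normalVec_sub_eq_coord hp hx y
      have e2 := inner_normalVec_sub_eq_coord hp hx (y + t • β⁻¹ • normalVec p)
      rw [add_sub_right_comm, inner_add_right, e1, real_inner_smul_right, real_inner_smul_right,
        ← hβ] at e2
      refine mul_left_cancel₀ hβ0 ?_
      rw [← e2]
      field_simp
  have hsgn : M.faceSign f = 1 ∨ M.faceSign f = -1 := by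
    rw [BulkMesh.faceSign]
    split_ifs <;> simp
  have hneg : M.faceSign f * β < 0 := by
    rw [BulkMesh.faceSign, ← hpdef, ← hβ]
    split_ifs with h0
    · linarith
    · have := lt_of_le_of_ne (not_lt.1 h0) hβ0
      linarith
  refine ⟨?_, ?_⟩
  · rw [norm_smul, norm_unitNormal hpi, mul_one]
    rcases hsgn with h | h <;> rw [h] <;> simp
  · obtain ⟨r, hr, hball⟩ := Metric.eventually_nhds_iff_ball.1 h2
    refine ⟨r, hr, fun y hy => ?_⟩
    have hpos : 0 < ‖normalVec p‖⁻¹ := inv_pos.2 (norm_pos_iff.2 (normalVec_ne_zero hpi))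
    rw [hball y hy, real_inner_comm, real_inner_smul_left, unitNormal, real_inner_smul_left,
      inner_normalVec_sub_eq_coord hp hx, ← hβ]
    have e : M.faceSign f * (‖normalVec p‖⁻¹ * (β * (M.elem f.1).coord f.2 y)) =
        (M.faceSign f * β * ‖normalVec p‖⁻¹) * (M.elem f.1).coord f.2 y := by ring
    rw [e]
    have hc : M.faceSign f * β * ‖normalVec p‖⁻¹ < 0 := mul_neg_of_neg_of_pos hneg hpos
    constructor
    · exact fun h => mul_neg_of_neg_of_pos hc h
    · intro h
      by_contra hcon
      exact absurd (mul_nonneg_of_nonpos_of_nonpos hc.le (not_lt.1 hcon)) (not_le.2 h)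

/-- A polyhedral domain with a conforming simplicial mesh is bounded by the boundary faces. -/
lemma BulkMesh.flatBoundary (M : BulkMesh n) :
    FlatBoundary M.domain (fun f : {f // M.IsBoundaryFace f} => M.facePts f)
      (fun f => M.faceSign f) M.skeleton where
  measurableSet := M.isOpen_domain.measurableSet
  isBounded := M.isBounded_domain
  sign f := by
    rw [BulkMesh.faceSign]
    split_ifs <;> simp
  null i := by
    rw [BulkMesh.skeleton, image_iUnion, measure_iUnion_null_iff]
    intro f
    rw [image_iUnion, measure_iUnion_null_iff]
    exact fun k => volume_dropCoord_face_eq_zero i _ k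
  frontier_subset := by
    intro x hx
    have hxΩ : x ∉ M.domain := by
      rw [M.isOpen_domain.frontier_eq] at hx
      exact hx.2
    obtain ⟨j, hj⟩ := mem_iUnion.1 (M.closure_domain_subset (frontier_subset_closure hx))
    rcases M.mem_openElem_or_face hj with h | ⟨i, hi⟩
    · exact absurd (M.openElem_subset_domain j h) hxΩ
    · rcases M.convexHull_facePts_subset_union _ hi with h | h
      · exact Or.inl (mem_iUnion.2 ⟨⟨(j, i), M.isBoundaryFace_of_notMem_domain h hxΩ⟩, h⟩)
      · exact Or.inr h
  disjoint := by
    rintro ⟨f, hf⟩ ⟨g, hg⟩ hne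
    refine disjoint_left.2 fun x hx hx' => ?_
    have h1 := M.convexHull_facePts_subset g (openSimplex_subset_convexHull _ hx')
    -- Two faces of one element are separated by a coordinate that vanishes on one and is positive
    -- on the other; a boundary face does not meet any other element.
    by_cases hfg : g.1 = f.1
    · have h2 : g.2 ≠ f.2 := fun h => hne (Subtype.ext (Prod.ext hfg.symm h.symm))
      obtain ⟨f1, f2⟩ := f
      obtain ⟨g1, g2⟩ := g
      simp only at hfg h2
      subst hfg
      have h3 := coord_eq_zero_of_mem_openSimplex (M.range_facePts (g1, f2)) hx
      have h4 := coord_pos_of_mem_openSimplex (M.range_facePts (g1, g2)) hx' (k := f2) h2.symm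
      exact h4.ne' h3
    · exact hf.notMem hfg hx h1
  normal f x hx := f.2.isOuterNormal hx

end MeshBoundary

/-! ### Finite element functions satisfy the hypotheses of the divergence theorem. -/

section FiniteElements

variable {n : ℕ} {M : BulkMesh n} {k : ℕ} {u : Vec n → Vec n}

lemma BulkMesh.domain_ae_le : M.domain ≤ᵐ[volume] ⋃ j, M.openElem j := by
  have h0 : volume (⋃ j, frontier (M.closedElem j)) = 0 :=
    measure_iUnion_null fun j => (convex_convexHull ℝ _).addHaar_frontier volume
  refine ae_le_set.2 (measure_mono_null ?_ h0)
  rintro x ⟨hx, hx'⟩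
  obtain ⟨j, hj⟩ := mem_iUnion.1 (interior_subset hx)
  refine mem_iUnion.2 ⟨j, subset_closure hj, fun h => hx' (mem_iUnion.2 ⟨j, h⟩)⟩

/-- On each open element a finite element function coincides with a smooth vector field. -/
lemma BulkMesh.IsFE.exists_contDiff (hu : M.IsFE k u) (j : Fin M.J) :
    ∃ G : Vec n → Vec n, ContDiff ℝ 1 G ∧ EqOn u G (M.closedElem j) := by
  choose p _ hp using hu.2 j
  refine ⟨fun x => WithLp.toLp 2 fun i => MvPolynomial.eval (fun l => x l) (p i), ?_,
    fun x hx => ?_⟩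
  · refine contDiff_euclidean.2 fun i => ?_
    exact contDiffOn_univ.1 (AnalyticOnNhd.eval_continuousLinearMap'
      (fun l => (EuclideanSpace.proj l : Vec n →L[ℝ] ℝ)) (p i)).contDiffOn_of_completeSpace
  · ext i
    exact hp i x hx

lemma BulkMesh.IsFE.differentiableAt (hu : M.IsFE k u) {j : Fin M.J} {x : Vec n}
    (hx : x ∈ M.openElem j) : DifferentiableAt ℝ u x := by
  obtain ⟨G, hG, he⟩ := hu.exists_contDiff j
  refine (hG.differentiable one_ne_zero x).congr_of_eventuallyEq ?_
  filter_upwards [isOpen_interior.mem_nhds hx] with y hy using he (interior_subset hy)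

/-- On each open element the derivative is that of a polynomial, bounded on the compact closed
element; the element boundaries are null. -/
lemma BulkMesh.IsFE.integrableOn_fderiv (hu : M.IsFE k u) (v : Vec n) (i : Fin (n + 1)) :
    IntegrableOn (fun x => fderiv ℝ u x v i) M.domain := by
  have h : IntegrableOn (fun x => fderiv ℝ u x v i) (⋃ j, M.openElem j) := by
    refine integrableOn_finite_iUnion.2 fun j => ?_
    obtain ⟨G, hG, he⟩ := hu.exists_contDiff j
    have hc : Continuous fun x => fderiv ℝ G x v i :=
      (EuclideanSpace.proj i : Vec n →L[ℝ] ℝ).continuous.comp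
        ((hG.continuous_fderiv one_ne_zero).clm_apply continuous_const)
    have hK : IsCompact (M.closedElem j) := (finite_range (M.elem j)).isCompact_convexHull ℝ
    have h1 : IntegrableOn (fun x => fderiv ℝ G x v i) (M.openElem j) :=
      (hc.continuousOn.integrableOn_compact hK).mono_set interior_subset
    refine h1.congr_fun (fun x hx => ?_) isOpen_interior.measurableSet
    have h2 : u =ᶠ[𝓝 x] G := by
      filter_upwards [isOpen_interior.mem_nhds hx] with y hy using he (interior_subset hy)
    simp only [h2.fderiv_eq]
  exact h.mono_set_ae M.domain_ae_le

/-- Almost every line parallel to an axis meets a flat simplex in at most countably many points. -/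
lemma ae_countable_line_inter (p : Fin (n + 1) → Vec n) (i : Fin (n + 1)) :
    ∀ᵐ y : Fin n → ℝ,
      {r : ℝ | linePt i y r ∈ convexHull ℝ (range p)}.Countable := by
  -- Either the simplex is parallel to the axis and has a null projection, or the line crosses its
  -- plane at most once.
  by_cases hN : normalVec p i = 0
  · have h0 : ∀ᵐ y : Fin n → ℝ, y ∉ shadow p i '' univ :=
      measure_eq_zero_iff_ae_notMem.1 (volume_shadow_image_eq_zero hN univ)
    filter_upwards [h0] with y hy
    convert countable_empty
    refine eq_empty_iff_forall_notMem.2 fun r hr => hy ?_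
    obtain ⟨l, _, h1, h2⟩ := exists_weights_of_mem_convexHull_range hr
    refine ⟨Fin.tail l, mem_univ _, ?_⟩
    rw [shadow, ← exists_bary h1, lin, ← h2, dropCoord_linePt]
  · refine Eventually.of_forall fun y => Set.Subsingleton.countable fun r hr r' hr' => ?_
    have h1 := inner_normalVec_of_mem_convexHull (x := p 0) hr fun k => inner_normalVec_edge p k
    have h2 := inner_normalVec_of_mem_convexHull (x := p 0) hr' fun k => inner_normalVec_edge p k
    have h3 : inner ℝ (normalVec p) (linePt i y r - linePt i y r') = 0 := by
      rw [← sub_sub_sub_cancel_right _ _ (p 0), inner_sub_right, h1, h2, sub_zero]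
    rw [linePt_sub_linePt, real_inner_smul_right, EuclideanSpace.inner_single_right] at h3
    simp only [one_mul, conj_trivial, mul_eq_zero, hN, or_false] at h3
    exact sub_eq_zero.1 h3

/-- The exceptional points on a line are its intersections with the element faces; elsewhere in the
domain it runs inside open elements, where `u` is smooth. -/
lemma BulkMesh.IsFE.ae_hasDerivAt_line (hu : M.IsFE k u) (i : Fin (n + 1)) :
    ∀ᵐ y : Fin n → ℝ, ∃ C : Set ℝ, C.Countable ∧ ∀ r ∉ C, linePt i y r ∈ M.domain →
      HasDerivAt (fun r => u (linePt i y r) i)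
        (fderiv ℝ u (linePt i y r) (EuclideanSpace.single i 1) i) r := by
  have h : ∀ᵐ y : Fin n → ℝ, ∀ f : Fin M.J × Fin (n + 2),
      {r : ℝ | linePt i y r ∈ convexHull ℝ (range (M.facePts f))}.Countable :=
    ae_all_iff.2 fun f => ae_countable_line_inter _ i
  filter_upwards [h] with y hy
  refine ⟨_, countable_iUnion hy, fun r hr hrΩ => ?_⟩
  obtain ⟨j, hj⟩ := mem_iUnion.1 (interior_subset hrΩ)
  rcases M.mem_openElem_or_face hj with h1 | ⟨l, hl⟩
  · exact (EuclideanSpace.proj i : Vec n →L[ℝ] ℝ).hasFDerivAt.comp_hasDerivAt r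
      ((hu.differentiableAt h1).hasFDerivAt.comp_hasDerivAt r (hasDerivAt_linePt i y r))
  · exact absurd (mem_iUnion.2 ⟨(j, l), hl⟩) hr

lemma BulkMesh.IsFE.integrableOn_divg (hu : M.IsFE k u) : IntegrableOn (divg u) M.domain :=
  integrable_finsetSum Finset.univ fun i _ => hu.integrableOn_fderiv (EuclideanSpace.single i 1) i

/-- The divergence theorem for finite element functions. -/
theorem BulkMesh.IsFE.integral_divg {ι : Type*} [Fintype ι] {A : Set (Vec n)}
    {p : ι → Fin (n + 1) → Vec n} {s : ι → ℝ} {Z : Set (Vec n)} (hu : M.IsFE k u)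
    (hA : FlatBoundary A p s Z) (hAΩ : A ⊆ M.domain) :
    ∫ x in A, divg u x =
      ∑ j, s j * ∫ y in refSimplex n, inner ℝ (normalVec (p j)) (u (lin (p j) (bary y))) := by
  have hc : ∀ i, ContinuousOn (fun x => u x i) (closure A) := fun i =>
    (EuclideanSpace.proj i : Vec n →L[ℝ] ℝ).continuous.comp_continuousOn
      (hu.1.mono (closure_mono hAΩ))
  have h1 : ∀ i : Fin (n + 1), _ := fun i =>
    hA.integral_partialDeriv i (hc i)
      ((hu.integrableOn_fderiv (EuclideanSpace.single i 1) i).mono_set hAΩ)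
      ((hu.ae_hasDerivAt_line i).mono fun y ⟨C, hC, h⟩ => ⟨C, hC, fun r hr hrA => h r hr (hAΩ hrA)⟩)
  have h2 : ∫ x in A, divg u x =
      ∑ i : Fin (n + 1), ∫ x in A, fderiv ℝ u x (EuclideanSpace.single i 1) i := by
    simp only [divg, jac, Matrix.trace, Matrix.diag, Matrix.of_apply]
    exact integral_finsetSum _ fun i _ =>
      (hu.integrableOn_fderiv (EuclideanSpace.single i 1) i).mono_set hAΩ
  rw [h2, Finset.sum_congr rfl fun i _ => h1 i, Finset.sum_comm]
  refine Finset.sum_congr rfl fun j _ => ?_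
  rw [← Finset.mul_sum]
  congr 1
  simp only [PiLp.inner_apply, RCLike.inner_apply, conj_trivial]
  rw [integral_finsetSum]
  · refine Finset.sum_congr rfl fun i _ => ?_
    rw [← integral_const_mul]
    simp only [mul_comm]
  · intro i _
    exact (integrableOn_comp_linBary (hc i) (hA.openSimplex_subset j)).mul_const _

end FiniteElements

/-! ### Conservation of the volume of the inner phase. -/

section VolumeConservation

variable {n J K : ℕ} {m : SurfMesh n J K} {S : Setup n} {D : Phys n} {X : State S K}

/-- Both the no-slip and the free-slip condition make the normal component vanish on the flat part
of the boundary, which is all that the divergence theorem sees. -/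
lemma Setup.inner_normalVec_eq_zero {u : Vec n → Vec n} (hu : u ∈ S.Uh)
    {f : Fin S.mesh.J × Fin (n + 2)} (hf : S.mesh.IsBoundaryFace f) {x : Vec n}
    (hx : x ∈ openSimplex (S.mesh.facePts f)) :
    inner ℝ (normalVec (S.mesh.facePts f)) (u x) = 0 := by
  have hn := hf.isOuterNormal hx
  have hfr : x ∈ frontier S.mesh.domain := by
    rw [S.mesh.isOpen_domain.frontier_eq]
    refine ⟨hn.mem_closure, fun hmem => ?_⟩
    have h := hn.eventually.self_of_nhds.1 hmem
    rw [sub_self, inner_zero_left] at h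
    exact lt_irrefl _ h
  rw [← S.bdry_union] at hfr
  rcases hfr with h | h
  · rw [S.Uh_noslip u hu x h, inner_zero_right]
  · have h1 := S.Uh_freeslip u hu x h _ hn
    have hs : S.mesh.faceSign f ≠ 0 := by
      rw [BulkMesh.faceSign]
      split_ifs <;> norm_num
    rw [real_inner_smul_right, mul_eq_zero, or_iff_right hs, real_inner_comm] at h1
    rw [← normalVec_eq_norm_smul (S.mesh.affineIndependent_facePts f), real_inner_smul_left, h1,
      mul_zero]

lemma Setup.integral_divg_eq_zero {u : Vec n → Vec n} (hu : u ∈ S.Uh) :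
    ∫ x in S.Ω, divg u x = 0 := by
  classical
  rw [(S.Uh_fe u hu).integral_divg S.mesh.flatBoundary subset_rfl]
  refine Finset.sum_eq_zero fun f _ => ?_
  rw [← setIntegral_openRef, setIntegral_eq_zero_of_forall_eq_zero, mul_zero]
  intro y hy
  refine S.inner_normalVec_eq_zero hu f.2 ?_
  rw [openSimplex_eq_image]
  exact mem_image_of_mem _ hy

lemma SurfMesh.IsInterface.integral_divg {Om : Set (Vec n)} {q : Fin K → Vec n}
    (h : m.IsInterface S.Ω q Om) {u : Vec n → Vec n} (hu : u ∈ S.Uh) :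
    ∫ x in Om, divg u x =
      m.surfInt q fun j l => inner ℝ (u (lin (m.loc q j) l)) (unitNormal (m.loc q j)) := by
  rw [(S.Uh_fe u hu).integral_divg (h.flatBoundary S.mesh.isBounded_domain)
    (subset_closure.trans h.subset), SurfMesh.surfInt]
  refine Finset.sum_congr rfl fun j _ => ?_
  rw [one_mul, simplexInt, ← integral_const_mul]
  refine integral_congr_ae (Eventually.of_forall fun y => ?_)
  simp only
  rw [real_inner_comm (unitNormal _), ← real_inner_smul_left,
    normalVec_eq_norm_smul (h.nondegenerate j)]

/-- If the pressure space contains the characteristic function of the inner phase, the discrete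
velocity has no total flux through the interface. -/
lemma State.IsSolution.integral_divg_eq_zero {t : ℝ} (ht : t ∈ Icc 0 S.T)
    (h : m.IsInterface S.Ω (X.q t) (X.Om t)) (hU : X.U t ∈ S.Uh)
    (hc : ∀ φ ∈ S.Ph t, ∫ x in S.Ω, φ x = 0 → ∫ x in S.Ω, divg (X.U t) x * φ x = 0)
    (hchar : X.CharMem t) : ∫ x in X.Om t, divg (X.U t) x = 0 := by
  obtain ⟨φ₁, hφ₁, h₁⟩ := hchar
  obtain ⟨φ₀, hφ₀, h₀⟩ := S.Ph_const t ht
  have hOm : X.Om t ⊆ S.Ω := subset_closure.trans h.subset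
  have hfin : volume S.Ω ≠ ⊤ := S.mesh.isBounded_domain.measure_lt_top.ne
  have hpos : 0 < volume.real S.Ω := by
    refine ENNReal.toReal_pos ?_ hfin
    exact (S.mesh.isOpen_domain.measure_pos volume S.mesh.connected.nonempty).ne'
  have hm : MeasurableSet (X.Om t) := h.isOpen.measurableSet
  -- The mean value of the characteristic function. Subtracting it gives an admissible pressure test
  -- function, and the constant does not contribute because the total divergence is zero.
  set c : ℝ := volume.real (X.Om t) / volume.real S.Ω with hcdef
  have hφ : ∀ᵐ x ∂(volume.restrict S.Ω), (φ₁ - c • φ₀ : Lp ℝ 2 (volume.restrict S.Ω)) x =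
      (X.Om t).indicator (fun _ => (1 : ℝ)) x - c := by
    filter_upwards [Lp.coeFn_sub φ₁ (c • φ₀), Lp.coeFn_smul c φ₀, h₁, h₀] with x e1 e2 e3 e4
    rw [e1, Pi.sub_apply, e2, Pi.smul_apply, e3, e4, smul_eq_mul, mul_one]
  have hmem : φ₁ - c • φ₀ ∈ S.Ph t := (S.Ph t).sub_mem hφ₁ ((S.Ph t).smul_mem c hφ₀)
  have hdi := (S.Uh_fe _ hU).integrableOn_divg
  have hind : Integrable ((X.Om t).indicator fun _ => (1 : ℝ)) (volume.restrict S.Ω) :=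
    (integrableOn_const (C := (1 : ℝ)) hfin).integrable.indicator hm
  have hmean : ∫ x in S.Ω, (φ₁ - c • φ₀ : Lp ℝ 2 (volume.restrict S.Ω)) x = 0 := by
    rw [integral_congr_ae hφ, integral_sub hind (integrableOn_const hfin),
      setIntegral_indicator hm, inter_eq_self_of_subset_right hOm, setIntegral_const,
      setIntegral_const, smul_eq_mul, smul_eq_mul, hcdef]
    field_simp
    ring
  have h2 := hc _ hmem hmean
  have h3 : ∫ x in S.Ω, divg (X.U t) x * (φ₁ - c • φ₀ : Lp ℝ 2 (volume.restrict S.Ω)) x =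
      ∫ x in S.Ω, ((X.Om t).indicator (divg (X.U t)) x - c * divg (X.U t) x) := by
    refine integral_congr_ae ?_
    filter_upwards [hφ] with x hx
    rw [hx]
    by_cases hxm : x ∈ X.Om t
    · rw [indicator_of_mem hxm, indicator_of_mem hxm]
      ring
    · rw [indicator_of_notMem hxm, indicator_of_notMem hxm]
      ring
  rw [h3, integral_sub (hdi.integrable.indicator hm) (hdi.integrable.const_mul c),
    setIntegral_indicator hm, inter_eq_self_of_subset_right hOm, integral_const_mul,
    S.integral_divg_eq_zero hU, mul_zero, sub_zero] at h2
  exact h2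

/-- The first variation of the volume is the lumped flux of the mesh velocity; (d) with the constant
test function makes it the exact flux of the fluid velocity, which is the integral of the divergence
over the inner phase. -/
theorem State.IsSolution.ae_hasDerivAt_vol_zero (hn : n = 1 ∨ n = 2) (hX : X.IsSolution D m) :
    ∀ᵐ t ∂(volume.restrict (Ioo 0 S.T)), X.CharMem t → HasDerivAt (fun s => X.vol s) 0 t := by
  filter_upwards [hX.eq_c, hX.eq_d, hX.ae_hasDerivAt_q, ae_restrict_mem measurableSet_Ioo]
    with t hc hd hq ht hchar
  have htI : t ∈ Icc 0 S.T := ⟨ht.1.le, ht.2.le⟩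
  have h := hX.interface t htI
  have hU := hX.U_mem.1 t htI
  have h1 := hX.hasDerivAt_vol hn ht hq
  have h2 := hd fun _ => 1
  have h3 : ∀ l : Fin (n + 1) → ℝ, ∀ j, lin (m.loc (fun _ : Fin K => (1 : ℝ)) j) l = ∑ k, l k :=
    fun l j => by simp [lin, SurfMesh.loc]
  have h4 : m.surfInt (X.q t) (fun j l => inner ℝ (X.U t (lin (m.loc (X.q t) j) l))
        (lin (m.loc (fun _ : Fin K => (1 : ℝ)) j) l • unitNormal (m.loc (X.q t) j))) =
      m.surfInt (X.q t) fun j l =>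
        inner ℝ (X.U t (lin (m.loc (X.q t) j) l)) (unitNormal (m.loc (X.q t) j)) := by
    simp only [SurfMesh.surfInt, simplexInt, h3, sum_bary, one_smul]
  rw [h4, ← h.integral_divg hU,
    State.IsSolution.integral_divg_eq_zero htI h hU hc hchar] at h2
  refine h1.congr_deriv (Eq.trans ?_ h2)
  simp only [SurfMesh.loc, one_smul]

end VolumeConservation

end SurfFlow

theorem theorem3p7 {n J K : ℕ} (hn : n = 1 ∨ n = 2) (S : SurfFlow.Setup n)
    (D : SurfFlow.Phys n) (m : SurfFlow.SurfMesh n J K) (X : SurfFlow.State S K)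
    (hX : X.IsSolution D m) :
    ((∀ᵐ t ∂(volume.restrict (Ioo 0 S.T)), HasDerivAt (fun s => X.totalPsi m s) 0 t) ∧
      ∀ t ∈ Icc 0 S.T, X.totalPsi m t = X.totalPsi m 0) ∧
    ((∀ᵐ t ∂(volume.restrict (Ioo 0 S.T)), X.CharMem t → HasDerivAt (fun s => X.vol s) 0 t) ∧
      ((∀ᵐ t ∂(volume.restrict (Ioo 0 S.T)), X.CharMem t) →
        ∀ t ∈ Icc 0 S.T, X.vol t = X.vol 0)) ∧
    (n = 1 → (∀ t ∈ Icc 0 S.T, ∀ k, (X.Psi t k : EReal) < D.psiInf) →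
      ∀ᵐ t ∂(volume.restrict (Ioo 0 S.T)), ∃ e : ℝ,
        HasDerivAt (fun s => X.energy D m s) e t ∧
        e + X.dissipation D m t ≤ X.forcing D t (X.U t)) := by
  refine ⟨⟨hX.hasDerivAt_totalPsi hn, hX.totalPsi_const hn⟩,
    ⟨hX.ae_hasDerivAt_vol_zero hn, fun hchar => hX.vol_const hn ?_⟩, ?_⟩
  · filter_upwards [hX.ae_hasDerivAt_vol_zero hn, hchar] with t h1 h2 using h1 h2
  · rintro rfl hPsi
    exact hX.energy_inequality hPsi
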